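/- For a bounded domain $\Omega\subset\mathbb R^2$ let $$\beta(\Omega)=\inf_{q}\ \sup_{v}\ \frac{\int_\Omega q\,\operatorname{div}v\,dx}{|v|_{1,\Omega}\,\|q\|_{L^2(\Omega)}}$$ be its inf-sup constant, where $q$ runs over the nonzero functions of $L^2(\Omega)$ with mean value zero, $v$ runs over the nonzero fields in $H^1_0(\Omega)^2$, and $|v|_{1,\Omega}=\|\nabla v\|_{L^2(\Omega)}$. We say that $\Omega$ is star-shaped with respect to a ball with center $x_0$ if there is an open ball $B\subset\Omega$ with center $x_0$ such that every segment with one end in $B$ and the other in $\Omega$ is contained in $\Omega$. For such $\Omega$ and $x_0$, the Horgan–Payne angle $\omega(\Omega)$ with respect to $x_0$ is the infimum, over all $x\in\partial\Omega$ at which $\partial\Omega$ has a tangent, of the angle in $[0,\frac\pi2]$ between that tangent and the ray from $x_0$ through $x$. The Horgan–Payne inequality (with respect to $x_0$) is $$\beta(\Omega)\ \ge\ \sin\frac{\omega(\Omega)}2 .$$ (i) Let $\Omega\subset\mathbb R^2$ be (the interior of) any nondegenerate triangle, rectangle, rhombus or regular convex polygon. Then $\Omega$ is star-shaped with respect to a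 ball centered at its barycenter, and with respect to its barycenter the Horgan–Payne inequality holds. (ii) There exist a bounded domain $\Omega\subset\mathbb R^2$ and a point $x_0$ such that $\Omega$ is star-shaped with respect to a ball with center $x_0$ and the Horgan–Payne inequality with respect to $x_0$ is not satisfied. Explicit examples, all with $x_0=0$, are the following. (a) (Cupid's bow) For $c>0$, the domain $\Omega$ whose boundary has the polar equation $r=e^{-c\left(\frac\pi2-\left|\frac\pi2-|\theta|\right|\right)}$, $-\pi\le\theta\le\pi$, which is composed of arcs of logarithmic spirals. It is star-shaped with respect to a ball with center $0$ for every $c>0$, and the Horgan–Payne inequality fails for all sufficiently large $c$, and for $c=2.58$. (b) (Double stadium) For $0<\varepsilon<1$, the union $\Omega$ of $S$ and of its reflection in the vertical axis, where $S$ is the union of the open rectangle $\big(\sqrt{1-\varepsilon^2},\frac{\sqrt{1-\varepsilon^2}}{\varepsilon}\big)\times(-1,1)$ and of the two open discs of radius $1$ with centers $(\sqrt{1-\varepsilon^2},0)$ and $\big(\frac{\sqrt{1-\varepsilon^2}}{\varepsilon},0\big)$. For all sufficiently small $\varepsilon>0$, $\Omega$ is star-shaped with respect to a ball with center $0$ and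 the Horgan–Payne inequality fails. (c) (Octagon) For $q>0$, the open octagon $\Omega$ that is star-shaped about $0$, with corners at distance $1$ from $0$ for $\theta\in\{0,\pi\}$, at distance $q$ for $\theta\in\{\frac\pi4,\frac{3\pi}4,\frac{5\pi}4,\frac{7\pi}4\}$, and at distance $q^2$ for $\theta\in\{\frac\pi2,\frac{3\pi}2\}$. For all sufficiently small $q>0$, $\Omega$ is star-shaped with respect to a ball with center $0$ and the Horgan–Payne inequality fails. -/

import Mathlib

open Set Filter Topology MeasureTheory
open scoped ContDiff ENNReal

/-- The Euclidean plane. -/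
abbrev Plane := EuclideanSpace ℝ (Fin 2)

/-! ### Sobolev spaces and the inf-sup constant -/

/-- `φ ∈ C₀^∞(Ω)`. -/
structure IsTestFunction (Ω : Set Plane) (φ : Plane → ℝ) : Prop where
  smooth : ContDiff ℝ ∞ φ
  compactSupport : HasCompactSupport φ
  support_subset : tsupport φ ⊆ Ω

/-- `G` is the weak gradient of `u` in `Ω`. -/
def HasWeakGradient (Ω : Set Plane) (u : Plane → ℝ) (G : Plane → Plane) : Prop :=
  ∀ φ : Plane → ℝ, IsTestFunction Ω φ → ∀ i : Fin 2,
    ∫ x in Ω, u x * gradient φ x i = - ∫ x in Ω, G x i * φ x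

/-- `u ∈ H¹(Ω)`, with weak gradient `G`. -/
structure MemH1 (Ω : Set Plane) (u : Plane → ℝ) (G : Plane → Plane) : Prop where
  memLp : MemLp u 2 (volume.restrict Ω)
  memLp_grad : MemLp G 2 (volume.restrict Ω)
  weakGradient : HasWeakGradient Ω u G

/-- `u ∈ H¹₀(Ω)`, with weak gradient `G`: the closure of `C₀^∞(Ω)` in the norm of `H¹(Ω)`. -/
structure MemH10 (Ω : Set Plane) (u : Plane → ℝ) (G : Plane → Plane) : Prop
    extends MemH1 Ω u G where
  approx : ∀ ε : ℝ≥0∞, 0 < ε → ∃ φ : Plane → ℝ, IsTestFunction Ω φ ∧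
    eLpNorm (fun x => u x - φ x) 2 (volume.restrict Ω) < ε ∧
    eLpNorm (fun x => G x - gradient φ x) 2 (volume.restrict Ω) < ε

/-- `q ∈ L²(Ω)` with mean value zero. -/
structure MemL2MeanZero (Ω : Set Plane) (q : Plane → ℝ) : Prop where
  memLp : MemLp q 2 (volume.restrict Ω)
  integral_eq_zero : ∫ x in Ω, q x = 0

/-- The norm of `L²(Ω)`. -/
noncomputable def normL2 (Ω : Set Plane) (q : Plane → ℝ) : ℝ :=
  Real.sqrt (∫ x in Ω, q x ^ 2)

/-- The seminorm `|v|_{1,Ω}` of a vector field `v`, in terms of the gradients `G 0`, `G 1` of its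
two components. -/
noncomputable def seminormH1 (Ω : Set Plane) (G : Fin 2 → Plane → Plane) : ℝ :=
  Real.sqrt (∫ x in Ω, ∑ k : Fin 2, ∑ j : Fin 2, G k x j ^ 2)

/-- The pairing `⟨div v, q⟩_Ω`, in terms of the gradients `G 0`, `G 1` of the two components
of `v`. -/
noncomputable def divPairing (Ω : Set Plane) (G : Fin 2 → Plane → Plane) (q : Plane → ℝ) : ℝ :=
  ∫ x in Ω, (∑ k : Fin 2, G k x k) * q x

/-- The inf-sup constant `β(Ω)`: the infimum over `q ≠ 0` in `L²(Ω)` of mean value zero of the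
supremum over `v ≠ 0` in `H¹₀(Ω)²` of `⟨div v, q⟩ / (|v|₁ ‖q‖₀)`. -/
noncomputable def infSupConstant (Ω : Set Plane) : ℝ :=
  sInf {s : ℝ | ∃ q : Plane → ℝ, MemL2MeanZero Ω q ∧ 0 < normL2 Ω q ∧
    s = sSup {t : ℝ | ∃ (v : Fin 2 → Plane → ℝ) (G : Fin 2 → Plane → Plane),
      (∀ k, MemH10 Ω (v k) (G k)) ∧ 0 < seminormH1 Ω G ∧
      t = divPairing Ω G q / (seminormH1 Ω G * normL2 Ω q)}}

/-! ### The Horgan–Payne inequality -/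

/-- `Ω` is a bounded open set that is star-shaped with respect to a ball with center `x₀`. -/
structure IsStarShapedBall (Ω : Set Plane) (x₀ : Plane) : Prop where
  isOpen : IsOpen Ω
  isBounded : Bornology.IsBounded Ω
  star : ∃ ρ : ℝ, 0 < ρ ∧ Metric.ball x₀ ρ ⊆ Ω ∧
    ∀ y ∈ Metric.ball x₀ ρ, ∀ z ∈ Ω, segment ℝ y z ⊆ Ω

/-- The set `Γ` has a tangent at `x`, namely the line through `x` with direction `v`. (The real
tangent cone is made of all limits of secant lines; at a corner it is a union of two lines.) -/
def HasTangent (Γ : Set Plane) (x v : Plane) : Prop :=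
  v ≠ 0 ∧ tangentConeAt ℝ Γ x = (Submodule.span ℝ {v} : Set Plane)

/-- The angle in `[0, π/2]` between the lines of directions `a` and `v`. -/
noncomputable def lineAngle (a v : Plane) : ℝ :=
  min (InnerProductGeometry.angle a v) (Real.pi - InnerProductGeometry.angle a v)

/-- The Horgan–Payne angle `ω(Ω)` with respect to the center `x₀`: the infimum, over the boundary
points `x` at which there is a tangent, of the angle between the tangent and the ray from `x₀`
through `x`. -/
noncomputable def horganPayneAngle (Ω : Set Plane) (x₀ : Plane) : ℝ :=
  sInf {a : ℝ | ∃ x ∈ frontier Ω, ∃ v : Plane, HasTangent (frontier Ω) x v ∧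
    a = lineAngle (x - x₀) v}

/-- The Horgan–Payne inequality for `Ω` with respect to the center `x₀`. -/
def HorganPayneInequality (Ω : Set Plane) (x₀ : Plane) : Prop :=
  infSupConstant Ω ≥ Real.sin (horganPayneAngle Ω x₀ / 2)

/-! ### The classes of polygons -/

/-- The barycenter `|Ω|⁻¹ ∫_Ω x dx`. -/
noncomputable def barycenter (Ω : Set Plane) : Plane := ⨍ x in Ω, x

/-- Open nondegenerate triangles. -/
def IsTriangle (Ω : Set Plane) : Prop :=
  ∃ p : Fin 3 → Plane, AffineIndependent ℝ p ∧ Ω = interior (convexHull ℝ (range p))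

/-- Open nondegenerate rectangles. -/
def IsRectangle (Ω : Set Plane) : Prop :=
  ∃ p u v : Plane, u ≠ 0 ∧ v ≠ 0 ∧ inner ℝ u v = 0 ∧
    Ω = interior (convexHull ℝ {p, p + u, p + u + v, p + v})

/-- Open nondegenerate rhombi. -/
def IsRhombus (Ω : Set Plane) : Prop :=
  ∃ p u v : Plane, LinearIndependent ℝ ![u, v] ∧ ‖u‖ = ‖v‖ ∧
    Ω = interior (convexHull ℝ {p, p + u, p + u + v, p + v})

/-- Open regular (convex) polygons. -/
def IsRegularPolygon (Ω : Set Plane) : Prop :=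
  ∃ (n : ℕ) (c : Plane) (r φ : ℝ), 3 ≤ n ∧ 0 < r ∧
    Ω = interior (convexHull ℝ (range fun k : Fin n =>
      c + r • !₂[Real.cos (φ + 2 * Real.pi * (k : ℕ) / n),
        Real.sin (φ + 2 * Real.pi * (k : ℕ) / n)]))

/-! ### The three explicit domains -/

/-- The Cupid's bow: its boundary has the polar equation
`r = exp (-c (π/2 - |π/2 - |θ||))`, `-π ≤ θ ≤ π`. -/
noncomputable def cupidsBow (c : ℝ) : Set Plane :=
  {x | ∃ r θ : ℝ, -Real.pi ≤ θ ∧ θ ≤ Real.pi ∧ 0 ≤ r ∧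
    r < Real.exp (-c * (Real.pi / 2 - |Real.pi / 2 - (|θ|)|)) ∧
    x = !₂[r * Real.cos θ, r * Real.sin θ]}

/-- The right half of the double stadium: a rectangle and two unit discs. -/
noncomputable def stadium (ε : ℝ) : Set Plane :=
  {x | √(1 - ε ^ 2) < x 0 ∧ x 0 < √(1 - ε ^ 2) / ε ∧ -1 < x 1 ∧ x 1 < 1} ∪
    Metric.ball !₂[√(1 - ε ^ 2), 0] 1 ∪ Metric.ball !₂[√(1 - ε ^ 2) / ε, 0] 1

/-- The double stadium: the union of the stadium and its reflection in the vertical axis. -/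
noncomputable def doubleStadium (ε : ℝ) : Set Plane :=
  stadium ε ∪ {x | !₂[-x 0, x 1] ∈ stadium ε}

/-- The corners of the octagon, at the angles `kπ/4`, at distance `1`, `q` or `q²`. -/
noncomputable def octagonVertex (q : ℝ) (k : Fin 8) : Plane :=
  (![1, q, q ^ 2, q, 1, q, q ^ 2, q] k : ℝ) •
    !₂[Real.cos ((k : ℕ) * (Real.pi / 4)), Real.sin ((k : ℕ) * (Real.pi / 4))]

/-- The open octagon, composed of the eight triangles with corners at the origin and at two
consecutive corners of the octagon. -/
noncomputable def octagon (q : ℝ) : Set Plane :=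
  interior (⋃ k : Fin 8, convexHull ℝ {0, octagonVertex q k, octagonVertex q (k + 1)})

/-- The standard basis vectors of the plane. -/
noncomputable abbrev stdVec (i : Fin 2) : Plane := EuclideanSpace.single i 1

lemma gradient_apply_eq (f : Plane → ℝ) (x : Plane) (i : Fin 2) :
    gradient f x i = fderiv ℝ f x (stdVec i) := by
  have h : inner ℝ (gradient f x) (stdVec i) = fderiv ℝ f x (stdVec i) := by
    rw [gradient, InnerProductSpace.toDual_symm_apply]
  rw [← h, EuclideanSpace.inner_single_right]
  simp

lemma integral_fderiv_eq_zero {f : Plane → ℝ} (hf : ContDiff ℝ 1 f) (hc : HasCompactSupport f)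
    (v : Plane) : ∫ x, fderiv ℝ f x v = 0 := by
  have hd : Continuous fun x => fderiv ℝ f x v :=
    (hf.continuous_fderiv (by simp)).clm_apply continuous_const
  have hdc : HasCompactSupport fun x => fderiv ℝ f x v := (hc.fderiv_apply ℝ v)
  have := integral_mul_fderiv_eq_neg_fderiv_mul_of_integrable (μ := (volume : Measure Plane))
    (f := fun _ => (1 : ℝ)) (g := f) (v := v) (by simp)
    (by simpa using hd.integrable_of_hasCompactSupport hdc)
    (by simpa using hf.continuous.integrable_of_hasCompactSupport hc)
    (fun x _ => differentiableAt_const _) (fun x _ => (hf.differentiable (by simp)) x)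
  simpa using this

lemma integral_mul_fderiv_eq_neg {f g : Plane → ℝ} (hf : ContDiff ℝ 1 f) (hg : ContDiff ℝ 1 g)
    (hc : HasCompactSupport f) (v : Plane) :
    ∫ x, f x * fderiv ℝ g x v = - ∫ x, fderiv ℝ f x v * g x := by
  have hf' : Continuous fun x => fderiv ℝ f x v :=
    (hf.continuous_fderiv (by simp)).clm_apply continuous_const
  have hg' : Continuous fun x => fderiv ℝ g x v :=
    (hg.continuous_fderiv (by simp)).clm_apply continuous_const
  refine integral_mul_fderiv_eq_neg_fderiv_mul_of_integrable ?_ ?_ ?_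
    (fun x _ => hf.differentiable (by simp) x) (fun x _ => hg.differentiable (by simp) x)
  · exact (hf'.mul hg.continuous).integrable_of_hasCompactSupport
      ((hc.fderiv_apply ℝ v).mul_right)
  · exact (hf.continuous.mul hg').integrable_of_hasCompactSupport hc.mul_right
  · exact (hf.continuous.mul hg.continuous).integrable_of_hasCompactSupport hc.mul_right

namespace IsTestFunction

variable {Ω : Set Plane} {φ : Plane → ℝ}

lemma contDiff_one (h : IsTestFunction Ω φ) : ContDiff ℝ 1 φ := h.smooth.of_le (by simp)

lemma eq_zero (h : IsTestFunction Ω φ) {x : Plane} (hx : x ∉ Ω) : φ x = 0 :=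
  image_eq_zero_of_notMem_tsupport fun h' => hx (h.support_subset h')

lemma fderiv_eq_zero (h : IsTestFunction Ω φ) {x : Plane} (hx : x ∉ Ω) : fderiv ℝ φ x = 0 := by
  by_contra h'
  exact hx (h.support_subset (support_fderiv_subset ℝ h'))

lemma continuous_gradient (h : IsTestFunction Ω φ) : Continuous (gradient φ) :=
  (InnerProductSpace.toDual ℝ Plane).symm.continuous.comp
    (h.contDiff_one.continuous_fderiv (by simp))

lemma hasCompactSupport_gradient (h : IsTestFunction Ω φ) : HasCompactSupport (gradient φ) := by
  have := h.compactSupport.fderiv ℝ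
  exact this.comp_left (g := (InnerProductSpace.toDual ℝ Plane).symm) (map_zero _)

lemma memLp_gradient (h : IsTestFunction Ω φ) {s : Set Plane} :
    MemLp (gradient φ) 2 (volume.restrict s) :=
  h.continuous_gradient.memLp_of_hasCompactSupport h.hasCompactSupport_gradient

lemma memH10 (h : IsTestFunction Ω φ) : MemH10 Ω φ (gradient φ) where
  memLp := h.smooth.continuous.memLp_of_hasCompactSupport h.compactSupport
  memLp_grad := h.memLp_gradient
  weakGradient ψ hψ i := by
    rw [setIntegral_eq_integral_of_forall_compl_eq_zero,
      setIntegral_eq_integral_of_forall_compl_eq_zero]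
    · simp_rw [gradient_apply_eq]
      exact integral_mul_fderiv_eq_neg h.contDiff_one hψ.contDiff_one h.compactSupport _
    · intro x hx
      simp [hψ.eq_zero hx]
    · intro x hx
      simp [h.eq_zero hx]
  approx ε hε := ⟨φ, h, by simpa using hε, by simpa using hε⟩

lemma smul (h : IsTestFunction Ω φ) (c : ℝ) : IsTestFunction Ω (fun x => c * φ x) where
  smooth := contDiff_const.mul h.smooth
  compactSupport := h.compactSupport.mul_left
  support_subset := (tsupport_mul_subset_right).trans h.support_subset

lemma zero : IsTestFunction Ω (fun _ => 0) where
  smooth := contDiff_const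
  compactSupport := HasCompactSupport.zero
  support_subset := by simp [tsupport, Function.support_fun_zero]

lemma add {ψ : Plane → ℝ} (h : IsTestFunction Ω φ) (h' : IsTestFunction Ω ψ) :
    IsTestFunction Ω (fun x => φ x + ψ x) where
  smooth := h.smooth.add h'.smooth
  compactSupport := h.compactSupport.add h'.compactSupport
  support_subset := (tsupport_add φ ψ).trans (union_subset h.support_subset h'.support_subset)

end IsTestFunction

/-- The class in `L²(Ω)²` of a square integrable field. -/
noncomputable abbrev toL2 {Ω : Set Plane} {G : Plane → Plane}
    (h : MemLp G 2 (volume.restrict Ω)) : Lp Plane 2 (volume.restrict Ω) := h.toLp G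

section L2

variable {Ω : Set Plane}

lemma inner_toL2 {G H : Plane → Plane} (hG : MemLp G 2 (volume.restrict Ω))
    (hH : MemLp H 2 (volume.restrict Ω)) :
    inner ℝ (toL2 hG) (toL2 hH) = ∫ x in Ω, inner ℝ (G x) (H x) := by
  rw [L2.inner_def]
  refine integral_congr_ae ?_
  filter_upwards [hG.coeFn_toLp, hH.coeFn_toLp] with x h1 h2
  rw [h1, h2]

lemma norm_sq_toL2 {G : Plane → Plane} (hG : MemLp G 2 (volume.restrict Ω)) :
    ‖toL2 hG‖ ^ 2 = ∫ x in Ω, ∑ j : Fin 2, G x j ^ 2 := by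
  rw [← real_inner_self_eq_norm_sq, inner_toL2]
  congr 1
  ext x
  rw [real_inner_self_eq_norm_sq, EuclideanSpace.norm_sq_eq]
  simp

lemma integrable_sq_comp {G : Plane → Plane} (hG : MemLp G 2 (volume.restrict Ω)) :
    Integrable (fun x => ∑ j : Fin 2, G x j ^ 2) (volume.restrict Ω) := by
  have := hG.integrable_norm_pow (p := 2) (by simp)
  refine this.congr (ae_of_all _ fun x => ?_)
  simp [EuclideanSpace.norm_sq_eq]

lemma seminormH1_sq {G : Fin 2 → Plane → Plane}
    (hG : ∀ k, MemLp (G k) 2 (volume.restrict Ω)) :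
    seminormH1 Ω G = √(∑ k, ‖toL2 (hG k)‖ ^ 2) := by
  rw [seminormH1, integral_finsetSum _ fun k _ => integrable_sq_comp (hG k)]
  simp_rw [norm_sq_toL2]

lemma MeasureTheory.MemLp.apply {G : Plane → Plane} (hG : MemLp G 2 (volume.restrict Ω))
    (k : Fin 2) : MemLp (fun x => G x k) 2 (volume.restrict Ω) :=
  ContinuousLinearMap.comp_memLp' (EuclideanSpace.proj k : Plane →L[ℝ] ℝ) hG

lemma memLp_smul_stdVec {q : Plane → ℝ} (hq : MemLp q 2 (volume.restrict Ω)) (k : Fin 2) :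
    MemLp (fun x => q x • stdVec k) 2 (volume.restrict Ω) := by
  have : MemLp (fun x => ContinuousLinearMap.toSpanSingleton ℝ (stdVec k) (q x)) 2
    (volume.restrict Ω) := ContinuousLinearMap.comp_memLp' _ hq
  simpa using this

lemma norm_toL2_smul_stdVec {q : Plane → ℝ} (hq : MemLp q 2 (volume.restrict Ω)) (k : Fin 2) :
    ‖toL2 (memLp_smul_stdVec hq k)‖ = normL2 Ω q := by
  rw [normL2, ← Real.sqrt_sq (norm_nonneg (toL2 _)), norm_sq_toL2]
  congr 2
  ext x
  fin_cases k <;> simp [stdVec]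

lemma divPairing_eq {G : Fin 2 → Plane → Plane} (hG : ∀ k, MemLp (G k) 2 (volume.restrict Ω))
    {q : Plane → ℝ} (hq : MemLp q 2 (volume.restrict Ω)) :
    divPairing Ω G q = ∑ k, inner ℝ (toL2 (memLp_smul_stdVec hq k)) (toL2 (hG k)) := by
  simp_rw [divPairing, inner_toL2]
  rw [← integral_finsetSum _ fun k _ => ?_]
  · congr 1
    ext x
    simp [inner_smul_left, EuclideanSpace.inner_single_left, Fin.sum_univ_two]
    ring
  · refine (hq.integrable_mul ((hG k).apply k)).congr (ae_of_all _ fun x => ?_)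
    simp [inner_smul_left, EuclideanSpace.inner_single_left]

lemma abs_divPairing_le {G : Fin 2 → Plane → Plane}
    (hG : ∀ k, MemLp (G k) 2 (volume.restrict Ω))
    {q : Plane → ℝ} (hq : MemLp q 2 (volume.restrict Ω)) :
    |divPairing Ω G q| ≤ 2 * seminormH1 Ω G * normL2 Ω q := by
  rw [divPairing_eq hG hq, Fin.sum_univ_two]
  have key : ∀ k, |inner ℝ (toL2 (memLp_smul_stdVec hq k)) (toL2 (hG k))| ≤
      normL2 Ω q * seminormH1 Ω G := by
    intro k
    refine (abs_real_inner_le_norm _ _).trans ?_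
    rw [norm_toL2_smul_stdVec hq]
    refine mul_le_mul_of_nonneg_left ?_ (Real.sqrt_nonneg _)
    rw [seminormH1_sq hG]
    refine Real.le_sqrt_of_sq_le ?_
    exact Finset.single_le_sum (f := fun k => ‖toL2 (hG k)‖ ^ 2) (fun i _ => sq_nonneg _)
      (Finset.mem_univ k)
  have := abs_add_le (inner ℝ (toL2 (memLp_smul_stdVec hq 0)) (toL2 (hG 0)))
    (inner ℝ (toL2 (memLp_smul_stdVec hq 1)) (toL2 (hG 1)))
  linarith [key 0, key 1]

lemma MemH10.exists_seq {u : Plane → ℝ} {G : Plane → Plane} (h : MemH10 Ω u G) :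
    ∃ (φ : ℕ → Plane → ℝ) (hφ : ∀ n, IsTestFunction Ω (φ n)),
      Tendsto (fun n => toL2 (Ω := Ω) (hφ n).memLp_gradient) atTop (𝓝 (toL2 h.memLp_grad)) := by
  have hε : ∀ n : ℕ, (0 : ℝ≥0∞) < ((n : ℝ≥0∞) + 1)⁻¹ := fun n => by simp
  choose φ hφ _ h2 using fun n : ℕ => h.approx _ (hε n)
  refine ⟨φ, hφ, ?_⟩
  rw [Lp.tendsto_Lp_iff_tendsto_eLpNorm'']
  refine tendsto_of_tendsto_of_tendsto_of_le_of_le tendsto_const_nhds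
    (ENNReal.tendsto_inv_nat_nhds_zero.comp (tendsto_add_atTop_nat 1)) (fun n => zero_le) ?_
  intro n
  have := (h2 n).le
  change eLpNorm (gradient (φ n) - G) 2 (volume.restrict Ω) ≤ ((n + 1 : ℕ) : ℝ≥0∞)⁻¹
  rw [← eLpNorm_neg, neg_sub, Nat.cast_add, Nat.cast_one]
  exact this

end L2

/-- An estimate of `⟨div v, q⟩` for smooth `v` of compact support bounds the inf-sup constant from
above. -/
theorem infSupConstant_le {Ω : Set Plane} {q : Plane → ℝ} (hq : MemL2MeanZero Ω q)
    (hq0 : 0 < normL2 Ω q) {K : ℝ} (hK : 0 ≤ K)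
    (h : ∀ φ : Fin 2 → Plane → ℝ, (∀ k, IsTestFunction Ω (φ k)) →
      divPairing Ω (fun k => gradient (φ k)) q ≤ K * seminormH1 Ω (fun k => gradient (φ k))) :
    infSupConstant Ω ≤ K / normL2 Ω q := by
  have hbdd : BddBelow {s : ℝ | ∃ q : Plane → ℝ, MemL2MeanZero Ω q ∧ 0 < normL2 Ω q ∧
    s = sSup {t : ℝ | ∃ (v : Fin 2 → Plane → ℝ) (G : Fin 2 → Plane → Plane),
      (∀ k, MemH10 Ω (v k) (G k)) ∧ 0 < seminormH1 Ω G ∧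
      t = divPairing Ω G q / (seminormH1 Ω G * normL2 Ω q)}} := by
    refine ⟨0, ?_⟩
    rintro s ⟨p, hp, hp0, rfl⟩
    set S := {t : ℝ | ∃ (v : Fin 2 → Plane → ℝ) (G : Fin 2 → Plane → Plane),
      (∀ k, MemH10 Ω (v k) (G k)) ∧ 0 < seminormH1 Ω G ∧
      t = divPairing Ω G p / (seminormH1 Ω G * normL2 Ω p)} with hS
    have hSb : BddAbove S := by
      refine ⟨2, ?_⟩
      rintro t ⟨v, G, hv, hG, rfl⟩
      rw [div_le_iff₀ (mul_pos hG hp0), ← mul_assoc]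
      exact (le_abs_self _).trans (abs_divPairing_le (fun k => (hv k).memLp_grad) hp.memLp)
    have hφ : ∀ φ : Fin 2 → Plane → ℝ, (∀ k, IsTestFunction Ω (φ k)) →
        0 < seminormH1 Ω (fun k => gradient (φ k)) → 0 ≤ sSup S := by
      intro φ hφ hpos
      have hneg : ∀ k x, gradient (fun y => (-1) * φ k y) x = - gradient (φ k) x := by
        intro k x
        ext i
        rw [PiLp.neg_apply, gradient_apply_eq, gradient_apply_eq]
        simp [fderiv_fun_neg]
      have h1 : divPairing Ω (fun k => gradient (φ k)) p /
          (seminormH1 Ω (fun k => gradient (φ k)) * normL2 Ω p) ∈ S :=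
        ⟨φ, _, fun k => (hφ k).memH10, hpos, rfl⟩
      have e1 : seminormH1 Ω (fun k => gradient (fun y => (-1) * φ k y)) =
          seminormH1 Ω (fun k => gradient (φ k)) := by
        simp only [seminormH1, hneg]
        simp
      have e2 : divPairing Ω (fun k => gradient (fun y => (-1) * φ k y)) p =
          - divPairing Ω (fun k => gradient (φ k)) p := by
        simp only [divPairing, hneg]
        rw [← integral_neg]
        congr 1
        ext x
        simp [Fin.sum_univ_two]
        ring
      have h2 : - (divPairing Ω (fun k => gradient (φ k)) p /
          (seminormH1 Ω (fun k => gradient (φ k)) * normL2 Ω p)) ∈ S :=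
        ⟨fun k y => (-1) * φ k y, _, fun k => ((hφ k).smul _).memH10, by rw [e1]; exact hpos,
          by rw [e1, e2, neg_div]⟩
      have := le_csSup hSb h1
      have := le_csSup hSb h2
      linarith
    by_cases hne : S.Nonempty
    · obtain ⟨t, v, G, hv, hG, rfl⟩ := hne
      have hGm := fun k => (hv k).memLp_grad
      choose φ hφm hφt using fun k => (hv k).exists_seq
      have ht : Tendsto (fun n => seminormH1 Ω (fun k => gradient (φ k n))) atTop
          (𝓝 (seminormH1 Ω G)) := by
        rw [seminormH1_sq hGm]
        simp_rw [fun n => seminormH1_sq (Ω := Ω) (fun k => (hφm k n).memLp_gradient)]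
        exact (tendsto_finsetSum _ fun k _ => ((hφt k).norm.pow 2)).sqrt
      obtain ⟨n, hn⟩ := (ht.eventually (lt_mem_nhds hG)).exists
      exact hφ (fun k => φ k n) (fun k => hφm k n) hn
    · rw [not_nonempty_iff_eq_empty.1 hne, Real.sSup_empty]
  refine (csInf_le hbdd ⟨q, hq, hq0, rfl⟩).trans ?_
  refine Real.sSup_le ?_ (div_nonneg hK hq0.le)
  rintro t ⟨v, G, hv, hG, rfl⟩
  rw [div_le_div_iff₀ (mul_pos hG hq0) hq0, ← mul_assoc]
  refine mul_le_mul_of_nonneg_right ?_ hq0.le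
  have hGm := fun k => (hv k).memLp_grad
  choose φ hφm hφt using fun k => (hv k).exists_seq
  have ht : Tendsto (fun n => seminormH1 Ω (fun k => gradient (φ k n))) atTop
      (𝓝 (seminormH1 Ω G)) := by
    rw [seminormH1_sq hGm]
    simp_rw [fun n => seminormH1_sq (Ω := Ω) (fun k => (hφm k n).memLp_gradient)]
    exact (tendsto_finsetSum _ fun k _ => ((hφt k).norm.pow 2)).sqrt
  have ht' : Tendsto (fun n => divPairing Ω (fun k => gradient (φ k n)) q) atTop
      (𝓝 (divPairing Ω G q)) := by
    rw [divPairing_eq hGm hq.memLp]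
    simp_rw [fun n => divPairing_eq (Ω := Ω) (fun k => (hφm k n).memLp_gradient) hq.memLp]
    exact tendsto_finsetSum _ fun k _ => tendsto_const_nhds.inner (hφt k)
  exact le_of_tendsto_of_tendsto' ht' (ht.const_mul K) fun n => h _ fun k => hφm k n

lemma seminormH1_nonneg {Ω : Set Plane} {G : Fin 2 → Plane → Plane} :
    0 ≤ seminormH1 Ω G := Real.sqrt_nonneg _

/-- A bounded nonempty open set carries a nonzero square integrable function of mean zero. -/
lemma exists_memL2MeanZero {Ω : Set Plane} (ho : IsOpen Ω) (hb : Bornology.IsBounded Ω)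
    (hne : Ω.Nonempty) : ∃ q, MemL2MeanZero Ω q ∧ 0 < normL2 Ω q := by
  have hfin : volume Ω ≠ ⊤ := hb.measure_lt_top.ne
  have hpos : 0 < volume.real Ω :=
    ENNReal.toReal_pos (ho.measure_pos volume hne).ne' hfin
  have : IsFiniteMeasure (volume.restrict Ω) := ⟨by simpa using hb.measure_lt_top⟩
  obtain ⟨C, hC⟩ := hb.exists_norm_le
  have hcont : Continuous fun x : Plane => x 0 := by fun_prop
  have hint : Integrable (fun x : Plane => x 0) (volume.restrict Ω) := by
    refine Measure.integrableOn_of_bounded (M := C) hfin hcont.aestronglyMeasurable ?_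
    filter_upwards [ae_restrict_mem ho.measurableSet] with x hx
    exact (PiLp.norm_apply_le x 0).trans (hC x hx)
  set m := (∫ x in Ω, x 0) / volume.real Ω with hm
  refine ⟨fun x => x 0 - m, ⟨?_, ?_⟩, ?_⟩
  · refine MemLp.of_bound (hcont.sub continuous_const).aestronglyMeasurable (C + |m|) ?_
    filter_upwards [ae_restrict_mem ho.measurableSet] with x hx
    refine (norm_sub_le _ _).trans (add_le_add ((PiLp.norm_apply_le x 0).trans (hC x hx)) le_rfl)
  · rw [integral_sub hint (integrable_const _)]
    simp only [integral_const, measureReal_restrict_apply_univ, smul_eq_mul, hm]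
    field_simp
    ring
  · rw [normL2, Real.sqrt_pos]
    have hcont2 : Continuous fun x : Plane => (x 0 - m) ^ 2 := by fun_prop
    have hint2 : Integrable (fun x : Plane => (x 0 - m) ^ 2) (volume.restrict Ω) := by
      refine Measure.integrableOn_of_bounded (M := (C + |m|) ^ 2) hfin
        hcont2.aestronglyMeasurable ?_
      filter_upwards [ae_restrict_mem ho.measurableSet] with x hx
      rw [norm_pow]
      gcongr
      refine (norm_sub_le _ _).trans
        (add_le_add ((PiLp.norm_apply_le x 0).trans (hC x hx)) le_rfl)
    rw [setIntegral_pos_iff_support_of_nonneg_ae (ae_of_all _ fun x => sq_nonneg _) hint2]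
    have hop : IsOpen (Function.support (fun x : Plane => (x 0 - m) ^ 2) ∩ Ω) :=
      hcont2.isOpen_support.inter ho
    refine hop.measure_pos volume ?_
    obtain ⟨y, hy⟩ := hne
    by_cases h : y 0 = m
    · obtain ⟨r, hr, hball⟩ := Metric.isOpen_iff.1 ho y hy
      refine ⟨y + (r / 2) • stdVec 0, ?_, hball ?_⟩
      · simp [h, hr.ne']
      · simp [Metric.mem_ball, dist_eq_norm, norm_smul, abs_of_pos hr, hr]
    · exact ⟨y, by simpa [sub_eq_zero] using h, hy⟩

/-- A lower bound of the norm of `v ↦ ⟨div v, q⟩` on smooth fields of compact support bounds the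
inf-sup constant from below. -/
theorem le_infSupConstant {Ω : Set Plane} (ho : IsOpen Ω) (hb : Bornology.IsBounded Ω)
    (hne : Ω.Nonempty) {κ : ℝ}
    (h : ∀ q, MemL2MeanZero Ω q → 0 < normL2 Ω q → ∀ s : ℝ,
      (∀ φ : Fin 2 → Plane → ℝ, (∀ k, IsTestFunction Ω (φ k)) →
        divPairing Ω (fun k => gradient (φ k)) q ≤ s * seminormH1 Ω (fun k => gradient (φ k))) →
      κ * normL2 Ω q ≤ s) :
    κ ≤ infSupConstant Ω := by
  refine le_csInf ?_ ?_
  · obtain ⟨q, hq, hq0⟩ := exists_memL2MeanZero ho hb hne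
    exact ⟨_, q, hq, hq0, rfl⟩
  · rintro s ⟨q, hq, hq0, rfl⟩
    set S := {t : ℝ | ∃ (v : Fin 2 → Plane → ℝ) (G : Fin 2 → Plane → Plane),
      (∀ k, MemH10 Ω (v k) (G k)) ∧ 0 < seminormH1 Ω G ∧
      t = divPairing Ω G q / (seminormH1 Ω G * normL2 Ω q)} with hS
    have hSb : BddAbove S := by
      refine ⟨2, ?_⟩
      rintro t ⟨v, G, hv, hG, rfl⟩
      rw [div_le_iff₀ (mul_pos hG hq0), ← mul_assoc]
      exact (le_abs_self _).trans (abs_divPairing_le (fun k => (hv k).memLp_grad) hq.memLp)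
    have := h q hq hq0 (sSup S * normL2 Ω q) ?_
    · exact le_of_mul_le_mul_right this hq0
    · intro φ hφ
      rcases (seminormH1_nonneg (Ω := Ω)
        (G := fun k => gradient (φ k))).eq_or_lt with h0 | h0
      · have := abs_divPairing_le (Ω := Ω) (fun k => (hφ k).memLp_gradient) hq.memLp
        rw [← h0] at this ⊢
        simp only [mul_zero, zero_mul, abs_nonpos_iff] at this ⊢
        exact this.le
      · have := le_csSup hSb ⟨φ, _, fun k => (hφ k).memH10, h0, rfl⟩
        rw [div_le_iff₀ (mul_pos h0 hq0)] at this
        linarith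

/-- The field `(div v, curl v)` of a vector field `v`, where `curl v = ∂₁v₀ - ∂₀v₁`. -/
noncomputable def divCurl (φ : Fin 2 → Plane → ℝ) (x : Plane) : Plane :=
  !₂[gradient (φ 0) x 0 + gradient (φ 1) x 1, gradient (φ 0) x 1 - gradient (φ 1) x 0]

/-- The weak form of the Cauchy–Riemann equations `∂₀h = ∂₁g`, `∂₁h = -∂₀g` in `Ω`. -/
def WeakCauchyRiemann (Ω : Set Plane) (h g : Plane → ℝ) : Prop :=
  ∀ η : Plane → ℝ, IsTestFunction Ω η →
    (∫ x in Ω, h x * gradient η x 0 = ∫ x in Ω, g x * gradient η x 1) ∧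
    (∫ x in Ω, h x * gradient η x 1 = - ∫ x in Ω, g x * gradient η x 0)

/-- The Friedrichs inequality with constant `Γ` between conjugate functions. -/
def FriedrichsInequality (Ω : Set Plane) (Γ : ℝ) : Prop :=
  ∀ h g : Plane → ℝ, MemL2MeanZero Ω h → MemLp g 2 (volume.restrict Ω) →
    WeakCauchyRiemann Ω h g → ∫ x in Ω, h x ^ 2 ≤ Γ * ∫ x in Ω, g x ^ 2

section

variable {Ω : Set Plane} {φ : Fin 2 → Plane → ℝ}

lemma memLp_plane {s : Set Plane} {f g : Plane → ℝ} (hf : MemLp f 2 (volume.restrict s))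
    (hg : MemLp g 2 (volume.restrict s)) :
    MemLp (fun x => (!₂[f x, g x] : Plane)) 2 (volume.restrict s) := by
  have := (memLp_smul_stdVec hf 0).add (memLp_smul_stdVec hg 1)
  refine this.congr_norm ?_ (ae_of_all _ fun x => ?_)
  · have h1 := this.1
    refine h1.congr (ae_of_all _ fun x => ?_)
    ext i
    fin_cases i <;> simp
  · congr 1
    ext i
    fin_cases i <;> simp

lemma memLp_divCurl (hφ : ∀ k, IsTestFunction Ω (φ k)) :
    MemLp (divCurl φ) 2 (volume.restrict Ω) :=
  memLp_plane (((hφ 0).memLp_gradient.apply 0).add ((hφ 1).memLp_gradient.apply 1))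
    (((hφ 0).memLp_gradient.apply 1).sub ((hφ 1).memLp_gradient.apply 0))

lemma two_le_infty : (2 : WithTop ℕ∞) ≤ ((⊤ : ℕ∞) : WithTop ℕ∞) := by
  change ((2 : ℕ∞) : WithTop ℕ∞) ≤ _
  exact WithTop.coe_le_coe.2 le_top

lemma integral_fderiv_mul_comm {a b : Plane → ℝ} (ha : ContDiff ℝ ∞ a) (hb : ContDiff ℝ ∞ b)
    (hc : HasCompactSupport a) (u v : Plane) :
    ∫ x, fderiv ℝ a x u * fderiv ℝ b x v = ∫ x, fderiv ℝ a x v * fderiv ℝ b x u := by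
  have hb' : ∀ w, ContDiff ℝ 1 fun x => fderiv ℝ b x w := fun w =>
    (hb.fderiv_right (m := 1) (by exact two_le_infty)).clm_apply contDiff_const
  have key : ∀ u w x, fderiv ℝ (fun y => fderiv ℝ b y w) x u =
      fderiv ℝ (fderiv ℝ b) x u w := by
    intro u w x
    have : DifferentiableAt ℝ (fderiv ℝ b) x :=
      (hb.fderiv_right (m := 1) (by exact two_le_infty)).differentiable (by simp) x
    rw [fderiv_clm_apply this (differentiableAt_const w)]
    simp
  have ha1 : ContDiff ℝ 1 a := ha.of_le (by simp)
  have h1 := integral_mul_fderiv_eq_neg ha1 (hb' v) hc u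
  have h2 := integral_mul_fderiv_eq_neg ha1 (hb' u) hc v
  have h3 : ∫ x, a x * fderiv ℝ (fun y => fderiv ℝ b y v) x u =
      ∫ x, a x * fderiv ℝ (fun y => fderiv ℝ b y u) x v := by
    congr 1
    ext x
    rw [key, key]
    have hs : IsSymmSndFDerivAt ℝ b x := hb.contDiffAt.isSymmSndFDerivAt (by simpa using two_le_infty)
    rw [hs u v]
  linarith

lemma norm_toL2_divCurl (hφ : ∀ k, IsTestFunction Ω (φ k)) :
    ‖toL2 (memLp_divCurl hφ)‖ = seminormH1 Ω (fun k => gradient (φ k)) := by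
  rw [seminormH1, ← Real.sqrt_sq (norm_nonneg (toL2 _)), norm_sq_toL2]
  congr 1
  have hint : ∀ i j k l, Integrable (fun x => gradient (φ i) x j * gradient (φ k) x l)
      (volume.restrict Ω) := fun i j k l =>
    ((hφ i).memLp_gradient.apply j).integrable_mul ((hφ k).memLp_gradient.apply l)
  have e : ∀ x, ∑ j : Fin 2, divCurl φ x j ^ 2 = (∑ k : Fin 2, ∑ j : Fin 2,
      gradient (φ k) x j ^ 2) + 2 * (gradient (φ 0) x 0 * gradient (φ 1) x 1 -
        gradient (φ 0) x 1 * gradient (φ 1) x 0) := by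
    intro x
    simp only [divCurl, Fin.sum_univ_two, PiLp.toLp_apply, Matrix.cons_val_zero,
      Matrix.cons_val_one]
    ring
  simp_rw [e]
  rw [integral_add, integral_const_mul, integral_sub (hint 0 0 1 1) (hint 0 1 1 0)]
  · have h0 : ∀ j l : Fin 2, ∫ x in Ω, gradient (φ 0) x j * gradient (φ 1) x l =
        ∫ x, fderiv ℝ (φ 0) x (stdVec j) * fderiv ℝ (φ 1) x (stdVec l) := by
      intro j l
      simp_rw [gradient_apply_eq]
      refine setIntegral_eq_integral_of_forall_compl_eq_zero fun x hx => ?_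
      simp [(hφ 0).fderiv_eq_zero hx]
    rw [h0, h0, integral_fderiv_mul_comm (hφ 0).smooth (hφ 1).smooth (hφ 0).compactSupport
      (stdVec 0) (stdVec 1)]
    simp
  · refine integrable_finsetSum _ fun k _ => integrable_finsetSum _ fun j _ => ?_
    simpa [pow_two] using hint k j k j
  · exact ((hint 0 0 1 1).sub (hint 0 1 1 0)).const_mul 2

lemma inner_smul_stdVec_divCurl {q : Plane → ℝ} (hq : MemLp q 2 (volume.restrict Ω))
    (hφ : ∀ k, IsTestFunction Ω (φ k)) :
    inner ℝ (toL2 (memLp_smul_stdVec hq 0)) (toL2 (memLp_divCurl hφ)) =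
      divPairing Ω (fun k => gradient (φ k)) q := by
  rw [inner_toL2, divPairing]
  congr 1
  ext x
  simp [inner_smul_left, EuclideanSpace.inner_single_left, Fin.sum_univ_two, divCurl]
  ring

lemma gradient_add_apply {a b : Plane → ℝ} (ha : IsTestFunction Ω a) (hb : IsTestFunction Ω b)
    (x : Plane) (i : Fin 2) :
    gradient (fun y => a y + b y) x i = gradient a x i + gradient b x i := by
  simp_rw [gradient_apply_eq]
  rw [fderiv_fun_add (ha.contDiff_one.differentiable (by simp) x)
    (hb.contDiff_one.differentiable (by simp) x)]
  simp

lemma gradient_mul_apply {a : Plane → ℝ} (ha : IsTestFunction Ω a) (c : ℝ)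
    (x : Plane) (i : Fin 2) :
    gradient (fun y => c * a y) x i = c * gradient a x i := by
  simp_rw [gradient_apply_eq]
  rw [fderiv_const_mul (ha.contDiff_one.differentiable (by simp) x)]
  simp

variable (Ω) in
/-- The space of all fields `(div v, curl v)` with `v` smooth of compact support in `Ω`. -/
noncomputable def divCurlSpace : Submodule ℝ (Lp Plane 2 (volume.restrict Ω)) where
  carrier := {u | ∃ (φ : Fin 2 → Plane → ℝ) (hφ : ∀ k, IsTestFunction Ω (φ k)),
    u = toL2 (memLp_divCurl hφ)}
  zero_mem' := by
    refine ⟨fun _ _ => 0, fun _ => IsTestFunction.zero, ?_⟩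
    rw [eq_comm, ← norm_eq_zero, norm_toL2_divCurl fun _ => IsTestFunction.zero, seminormH1]
    simp
  add_mem' := by
    rintro _ _ ⟨φ, hφ, rfl⟩ ⟨ψ, hψ, rfl⟩
    refine ⟨fun k x => φ k x + ψ k x, fun k => (hφ k).add (hψ k), ?_⟩
    rw [toL2, toL2, toL2, ← MemLp.toLp_add]
    congr 1
    ext x i
    fin_cases i <;> simp [divCurl, gradient_add_apply (hφ _) (hψ _)] <;> ring
  smul_mem' := by
    rintro c _ ⟨φ, hφ, rfl⟩
    refine ⟨fun k x => c * φ k x, fun k => (hφ k).smul c, ?_⟩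
    rw [toL2, toL2, ← MemLp.toLp_const_smul]
    congr 1
    ext x i
    fin_cases i <;> simp [divCurl, gradient_mul_apply (hφ _)] <;> ring

end

lemma MeasureTheory.MemLp.integrable_fun_mul {Ω : Set Plane} {f g : Plane → ℝ}
    (hf : MemLp f 2 (volume.restrict Ω)) (hg : MemLp g 2 (volume.restrict Ω)) :
    Integrable (fun x => f x * g x) (volume.restrict Ω) :=
  hf.integrable_mul hg

lemma le_mul_of_discrim {H G D Γ : ℝ} (hG0 : 0 ≤ G) (hD0 : 0 ≤ D) (hΓ : 0 ≤ Γ)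
    (h2 : ∀ t : ℝ, 0 ≤ H + 2 * t * G + t ^ 2 * D) (hFr : H ≤ Γ * G) : G ≤ Γ * D := by
  rcases hG0.eq_or_lt with h0 | h0
  · rw [← h0]; positivity
  · have := h2 (-Γ)
    by_contra hlt
    push Not at hlt
    rcases hΓ.eq_or_lt with h3 | h3
    · subst h3
      have h4 := h2 (-1)
      have h5 : H ≤ 0 := by linarith
      rcases hD0.eq_or_lt with h6 | h6
      · rw [← h6] at h4; linarith
      · have h7 := h2 (-G / D)
        have e : H + 2 * (-G / D) * G + (-G / D) ^ 2 * D = H - G ^ 2 / D := by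
          field_simp
          ring
        rw [e] at h7
        have : 0 < G ^ 2 / D := by positivity
        linarith
    · nlinarith

set_option maxHeartbeats 1000000 in
/-- The Friedrichs inequality with constant `Γ` implies `β(Ω) ≥ (1 + Γ)^(-1/2)`. -/
theorem le_infSupConstant_of_friedrichs {Ω : Set Plane} (ho : IsOpen Ω)
    (hb : Bornology.IsBounded Ω) (hne : Ω.Nonempty) {Γ : ℝ} (hΓ : 0 ≤ Γ)
    (hF : FriedrichsInequality Ω Γ) : √(1 / (1 + Γ)) ≤ infSupConstant Ω := by
  refine le_infSupConstant ho hb hne fun q hq hq0 s hs => ?_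
  have : IsFiniteMeasure (volume.restrict Ω) := ⟨by simpa using hb.measure_lt_top⟩
  set X := (divCurlSpace Ω).topologicalClosure with hX
  have : CompleteSpace X := (divCurlSpace Ω).isClosed_topologicalClosure.completeSpace_coe
  set p := toL2 (memLp_smul_stdVec hq.memLp 0) with hp
  set u := X.starProjection p with hu
  have huX : u ∈ X := Submodule.starProjection_apply_mem X p
  have horth : ∀ x ∈ X, inner ℝ (p - u) x = 0 := fun x hx =>
    Submodule.starProjection_inner_eq_zero p x hx
  have h1 : MemLp (fun _ : Plane => (1 : ℝ)) 2 (volume.restrict Ω) := memLp_const 1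
  have hmean : ∀ x ∈ X, inner ℝ (toL2 (memLp_smul_stdVec h1 0)) x = 0 := by
    intro x hx
    have hcl : IsClosed {x : Lp Plane 2 (volume.restrict Ω) |
        inner ℝ (toL2 (memLp_smul_stdVec h1 0)) x = 0} :=
      isClosed_eq (by fun_prop) (by fun_prop)
    refine closure_minimal ?_ hcl hx
    rintro _ ⟨φ, hφ, rfl⟩
    change inner ℝ _ _ = 0
    rw [inner_smul_stdVec_divCurl h1 hφ, divPairing]
    have h0 : ∀ k, ∫ x in Ω, gradient (φ k) x k = 0 := by
      intro k
      simp_rw [gradient_apply_eq]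
      rw [setIntegral_eq_integral_of_forall_compl_eq_zero fun x hx => by
        simp [(hφ k).fderiv_eq_zero hx]]
      exact integral_fderiv_eq_zero (hφ k).contDiff_one (hφ k).compactSupport _
    simp_rw [mul_one]
    rw [integral_finsetSum _ fun k _ => ?_]
    · simp [h0]
    · exact ((hφ k).memLp_gradient.apply k).integrable (by simp)
  have hle : ∀ x ∈ X, inner ℝ p x ≤ s * ‖x‖ := by
    intro x hx
    have hcl : IsClosed {x : Lp Plane 2 (volume.restrict Ω) | inner ℝ p x ≤ s * ‖x‖} :=
      isClosed_le (by fun_prop) (by fun_prop)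
    refine closure_minimal ?_ hcl hx
    rintro _ ⟨φ, hφ, rfl⟩
    change inner ℝ p _ ≤ s * ‖_‖
    rw [hp, inner_smul_stdVec_divCurl hq.memLp hφ, norm_toL2_divCurl hφ]
    exact hs φ hφ
  have hU : MemLp u 2 (volume.restrict Ω) := Lp.memLp u
  have hUu : toL2 hU = u := Lp.toLp_coeFn u hU
  set d : Plane → ℝ := fun x => u x 0 with hd
  set g : Plane → ℝ := fun x => u x 1 with hg
  have hdm : MemLp d 2 (volume.restrict Ω) := hU.apply 0
  have hgm : MemLp g 2 (volume.restrict Ω) := hU.apply 1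
  have hhm : MemLp (fun x => q x - d x) 2 (volume.restrict Ω) := hq.memLp.sub hdm
  have hpu : ∀ {G : Plane → Plane} (hG : MemLp G 2 (volume.restrict Ω)),
      inner ℝ (p - u) (toL2 hG) =
        ∫ x in Ω, ((q x - d x) * G x 0 - g x * G x 1) := by
    intro G hG
    rw [inner_sub_left, hp, inner_toL2, ← hUu, inner_toL2, ← integral_sub]
    · congr 1
      ext x
      simp [inner_smul_left, PiLp.inner_apply, hd, hg,
        Fin.sum_univ_two]
      ring
    · refine (hq.memLp.integrable_fun_mul (hG.apply 0)).congr (ae_of_all _ fun x => ?_)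
      simp [inner_smul_left, EuclideanSpace.inner_single_left]
    · refine ((hdm.integrable_fun_mul (hG.apply 0)).add (hgm.integrable_fun_mul (hG.apply 1))).congr
        (ae_of_all _ fun x => ?_)
      simp [PiLp.inner_apply, hd, hg, Fin.sum_univ_two]
      ring
  have hdd := hdm.integrable_fun_mul hdm
  have hgg := hgm.integrable_fun_mul hgm
  have hhh := hhm.integrable_fun_mul hhm
  have hhd := hhm.integrable_fun_mul hdm
  have hCR : WeakCauchyRiemann Ω (fun x => q x - d x) g := by
    intro η hη
    constructor
    · have hφ : ∀ k : Fin 2, IsTestFunction Ω (![η, fun _ => 0] k) := by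
        intro k
        fin_cases k
        · exact hη
        · exact IsTestFunction.zero
      have := horth _ (subset_closure ⟨_, hφ, rfl⟩)
      rw [hpu (memLp_divCurl hφ), integral_sub (hhm.integrable_fun_mul ((memLp_divCurl hφ).apply 0))
        (hgm.integrable_fun_mul ((memLp_divCurl hφ).apply 1))] at this
      simpa [divCurl, sub_eq_zero] using this
    · have hφ : ∀ k : Fin 2, IsTestFunction Ω (![fun _ => 0, η] k) := by
        intro k
        fin_cases k
        · exact IsTestFunction.zero
        · exact hη
      have := horth _ (subset_closure ⟨_, hφ, rfl⟩)
      rw [hpu (memLp_divCurl hφ), integral_sub (hhm.integrable_fun_mul ((memLp_divCurl hφ).apply 0))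
        (hgm.integrable_fun_mul ((memLp_divCurl hφ).apply 1))] at this
      simpa [divCurl, sub_eq_zero, integral_neg, add_eq_zero_iff_eq_neg] using this
  have hd0 : ∫ x in Ω, d x = 0 := by
    have := hmean u huX
    rw [← hUu, inner_toL2] at this
    rw [← this]
    congr 1
    ext x
    simp [EuclideanSpace.inner_single_left, hd]
  have hh0 : ∫ x in Ω, (q x - d x) = 0 := by
    rw [integral_sub (hq.memLp.integrable (by simp)) (hdm.integrable (by simp)),
      hq.integral_eq_zero, hd0, sub_zero]
  have hFr := hF _ g ⟨hhm, hh0⟩ hgm hCR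
  have hcross : ∫ x in Ω, (q x - d x) * d x = ∫ x in Ω, g x * g x := by
    have := horth u huX
    rw [show inner ℝ (p - u) u = inner ℝ (p - u) (toL2 hU) by rw [hUu], hpu,
      integral_sub (hhm.integrable_fun_mul (hU.apply 0))
      (hgm.integrable_fun_mul (hU.apply 1))] at this
    exact sub_eq_zero.1 this
  have hnu : ‖u‖ ^ 2 = (∫ x in Ω, d x * d x) + ∫ x in Ω, g x * g x := by
    rw [← hUu, norm_sq_toL2, ← integral_add hdd hgg]
    congr 1
    ext x
    simp [Fin.sum_univ_two, pow_two, hd, hg]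
  have hquad : ∀ t : ℝ, ∫ x in Ω, ((q x - d x) + t * d x) ^ 2 =
      (∫ x in Ω, (q x - d x) * (q x - d x)) + 2 * t * (∫ x in Ω, (q x - d x) * d x) +
        t ^ 2 * ∫ x in Ω, d x * d x := by
    intro t
    have e : ∀ x, ((q x - d x) + t * d x) ^ 2 = (q x - d x) * (q x - d x) +
        2 * t * ((q x - d x) * d x) + t ^ 2 * (d x * d x) := fun x => by ring
    simp_rw [e]
    rw [integral_add, integral_add, integral_const_mul, integral_const_mul]
    · exact hhh
    · exact hhd.const_mul _
    · exact hhh.add (hhd.const_mul _)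
    · exact hdd.const_mul _
  have hnq : normL2 Ω q ^ 2 = (∫ x in Ω, (q x - d x) * (q x - d x)) +
      2 * (∫ x in Ω, (q x - d x) * d x) + ∫ x in Ω, d x * d x := by
    have := hquad 1
    simp only [one_mul, sub_add_cancel, mul_one, one_pow] at this
    rw [normL2, Real.sq_sqrt (integral_nonneg fun x => sq_nonneg _), this]
  simp only [pow_two] at hFr
  set D := ∫ x in Ω, d x * d x with hD
  set G := ∫ x in Ω, g x * g x with hG
  set H := ∫ x in Ω, (q x - d x) * (q x - d x) with hH
  have hD0 : 0 ≤ D := integral_nonneg fun x => mul_self_nonneg _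
  have hG0 : 0 ≤ G := integral_nonneg fun x => mul_self_nonneg _
  have hGD : G ≤ Γ * D := by
    have h2 : ∀ t : ℝ, 0 ≤ H + 2 * t * G + t ^ 2 * D := by
      intro t
      rw [← hcross, hH, hD, ← hquad]
      exact integral_nonneg fun x => sq_nonneg _
    exact le_mul_of_discrim hG0 hD0 hΓ h2 hFr
  have hmain : normL2 Ω q ^ 2 ≤ (1 + Γ) * ‖u‖ ^ 2 := by
    rw [hnq, hcross, hnu]
    nlinarith
  have hu0 : 0 < ‖u‖ := by
    by_contra h
    have : ‖u‖ = 0 := le_antisymm (not_lt.1 h) (norm_nonneg _)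
    rw [this] at hmain
    have : 0 < normL2 Ω q ^ 2 := by positivity
    simp at hmain
    linarith
  have hus : ‖u‖ ≤ s := by
    have h2 := hle u huX
    have h3 := horth u huX
    rw [inner_sub_left, sub_eq_zero, real_inner_self_eq_norm_sq] at h3
    rw [h3, pow_two] at h2
    exact le_of_mul_le_mul_right h2 hu0
  refine le_trans ?_ hus
  have h1Γ : 0 < 1 + Γ := by linarith
  rw [← Real.sqrt_sq hq0.le, ← Real.sqrt_mul (by positivity), Real.sqrt_le_left (norm_nonneg _),
    div_mul_eq_mul_div, one_mul, div_le_iff₀ h1Γ]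
  linarith

/-- The identification of the plane with `ℂ`. -/
noncomputable def toComplex : Plane →L[ℝ] ℂ :=
  (EuclideanSpace.proj 0 : Plane →L[ℝ] ℝ).smulRight (1 : ℂ) +
    (EuclideanSpace.proj 1 : Plane →L[ℝ] ℝ).smulRight Complex.I

@[simp] lemma toComplex_re (x : Plane) : (toComplex x).re = x 0 := by simp [toComplex]

@[simp] lemma toComplex_im (x : Plane) : (toComplex x).im = x 1 := by simp [toComplex]

lemma toComplex_stdVec_zero : toComplex (stdVec 0) = 1 := by
  apply Complex.ext <;> simp [stdVec]

lemma toComplex_stdVec_one : toComplex (stdVec 1) = Complex.I := by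
  apply Complex.ext <;> simp [stdVec]

lemma quadratic_form_nonneg {P Q M h g : ℝ} (hP0 : 0 ≤ P) (hQ0 : 0 ≤ Q) (hPQ : M ^ 2 ≤ P * Q) :
    0 ≤ P * h ^ 2 - 2 * M * h * g + Q * g ^ 2 := by
  rcases hP0.eq_or_lt with h0 | h0
  · have : M = 0 := by
      rw [← h0, zero_mul] at hPQ
      exact pow_eq_zero_iff two_ne_zero |>.1 (le_antisymm hPQ (sq_nonneg _))
    rw [← h0, this]
    have := mul_nonneg hQ0 (sq_nonneg g)
    linarith
  · have : 0 ≤ P * (P * h ^ 2 - 2 * M * h * g + Q * g ^ 2) := by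
      have e : P * (P * h ^ 2 - 2 * M * h * g + Q * g ^ 2) =
          (P * h - M * g) ^ 2 + (P * Q - M ^ 2) * g ^ 2 := by ring
      rw [e]
      have := mul_nonneg (sub_nonneg.2 hPQ) (sq_nonneg g)
      positivity
    exact nonneg_of_mul_nonneg_right this h0

set_option maxHeartbeats 600000 in
/-- The quadratic form inequality behind the estimate of the Friedrichs constant. -/
lemma weighted_square_le {x0 x1 n0 n1 N h g a b g0 d R k : ℝ} (hd : 0 < d) (hk0 : 0 ≤ k)
    (hk1 : k < 1) (hR : R ^ 2 * (1 - k ^ 2) = d ^ 2) (hx : 0 < x0 ^ 2 + x1 ^ 2)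
    (h1 : h ^ 2 - g ^ 2 = -g0 ^ 2 + (x0 * a - x1 * b)) (h2 : 2 * h * g = x0 * b + x1 * a)
    (hE : n0 * x0 + n1 * x1 = N) (hn : (n0 ^ 2 + n1 ^ 2) * d ^ 2 ≤ 1)
    (hN : x0 ^ 2 + x1 ^ 2 ≤ R ^ 2 * N ^ 2) :
    (1 - k) / d ^ 2 * (h ^ 2 - (1 + k) / (1 - k) * g ^ 2) ≤ N * (n0 * a - n1 * b) := by
  set r := x0 ^ 2 + x1 ^ 2 with hr
  set C := n1 * x0 - n0 * x1 with hC
  have hk : 0 < 1 - k := by linarith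
  have hd2 : 0 < d ^ 2 := by positivity
  have e1 : r * (N * (n0 * a - n1 * b)) =
      N * ((h ^ 2 - g ^ 2) * N - 2 * h * g * C) + g0 ^ 2 * N ^ 2 := by
    rw [h1, h2, hr, hC, ← hE]
    ring
  have hCN : C ^ 2 + N ^ 2 = (n0 ^ 2 + n1 ^ 2) * r := by
    rw [hr, hC, ← hE]
    ring
  have hCN' : d ^ 2 * (C ^ 2 + N ^ 2) ≤ r := by
    rw [hCN]
    nlinarith
  have hs : r * (1 - k ^ 2) ≤ d ^ 2 * N ^ 2 := by
    have : 0 ≤ 1 - k ^ 2 := by nlinarith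
    nlinarith [mul_le_mul_of_nonneg_right hN this]
  set P := d ^ 2 * N ^ 2 - (1 - k) * r with hP
  set Q := (1 + k) * r - d ^ 2 * N ^ 2 with hQ
  have hP0 : 0 ≤ P := by
    have : 0 ≤ r * (1 - k) * k := by positivity
    nlinarith
  have hQ0 : 0 ≤ Q := by nlinarith [mul_nonneg hd2.le (sq_nonneg C), mul_nonneg hk0 hx.le]
  set M := d ^ 2 * (N * C) with hM
  have hPQ : M ^ 2 ≤ P * Q := by
    have e : P * Q = 2 * r * (d ^ 2 * N ^ 2) - (d ^ 2 * N ^ 2) ^ 2 - r * (r * (1 - k ^ 2)) := by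
      rw [hP, hQ]; ring
    have e2 : M ^ 2 = (d ^ 2 * N ^ 2) * (d ^ 2 * C ^ 2) := by rw [hM]; ring
    have i1 : r * (r * (1 - k ^ 2)) ≤ r * (d ^ 2 * N ^ 2) :=
      mul_le_mul_of_nonneg_left hs hx.le
    have i2 : (d ^ 2 * N ^ 2) * (d ^ 2 * C ^ 2) ≤ (d ^ 2 * N ^ 2) * (r - d ^ 2 * N ^ 2) :=
      mul_le_mul_of_nonneg_left (by linarith) (by positivity)
    rw [e, e2]
    linarith
  have hquad : 0 ≤ P * h ^ 2 - 2 * M * h * g + Q * g ^ 2 :=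
    quadratic_form_nonneg hP0 hQ0 hPQ
  have e3 : (1 - k) / d ^ 2 * (h ^ 2 - (1 + k) / (1 - k) * g ^ 2) =
      ((1 - k) * h ^ 2 - (1 + k) * g ^ 2) / d ^ 2 := by
    field_simp
  rw [e3, div_le_iff₀ hd2]
  refine le_of_mul_le_mul_left ?_ hx
  have e4 : r * (N * (n0 * a - n1 * b) * d ^ 2) =
      d ^ 2 * (N * ((h ^ 2 - g ^ 2) * N - 2 * h * g * C)) + d ^ 2 * (g0 ^ 2 * N ^ 2) := by
    linear_combination d ^ 2 * e1
  rw [e4]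
  have : 0 ≤ d ^ 2 * (g0 ^ 2 * N ^ 2) := by positivity
  have e5 : d ^ 2 * (N * ((h ^ 2 - g ^ 2) * N - 2 * h * g * C)) -
      r * ((1 - k) * h ^ 2 - (1 + k) * g ^ 2) = P * h ^ 2 - 2 * M * h * g + Q * g ^ 2 := by
    rw [hP, hQ, hM]; ring
  linarith

/-- A smooth function on a neighbourhood of a compact set agrees near this set with a smooth
function of compact support. -/
lemma exists_contDiff_hasCompactSupport_eventuallyEq {f : Plane → ℝ} {U K : Set Plane}
    (hU : IsOpen U) (hK : IsCompact K) (hKU : K ⊆ U) (hf : ContDiffOn ℝ 1 f U) :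
    ∃ f' : Plane → ℝ, ContDiff ℝ 1 f' ∧ HasCompactSupport f' ∧ ∀ x ∈ K, f' =ᶠ[𝓝 x] f := by
  obtain ⟨ρ, hρ⟩ := hK.isBounded.subset_ball (0 : Plane)
  have hc : IsClosed (U ∩ Metric.ball 0 ρ)ᶜ := (hU.inter Metric.isOpen_ball).isClosed_compl
  obtain ⟨χ, h0, h1, -⟩ := exists_contMDiffMap_zero_one_nhds_of_isClosed
    (modelWithCornersSelf ℝ Plane) hc hK.isClosed
    (disjoint_compl_left_iff_subset.2 (subset_inter hKU hρ)) (n := 1)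
  have hχ : ContDiff ℝ 1 χ := χ.contMDiff.contDiff
  rw [eventually_nhdsSet_iff_forall] at h0 h1
  refine ⟨fun x => χ x * f x, ?_, ?_, ?_⟩
  · rw [contDiff_iff_contDiffAt]
    intro x
    by_cases hx : x ∈ U
    · exact hχ.contDiffAt.mul (hf.contDiffAt (hU.mem_nhds hx))
    · refine (contDiffAt_const (c := (0 : ℝ))).congr_of_eventuallyEq ?_
      filter_upwards [h0 x fun h => hx h.1] with y hy
      simp [hy]
  · refine HasCompactSupport.intro (isCompact_closedBall (0 : Plane) ρ) fun x hx => ?_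
    rw [(h0 x fun h => hx (Metric.ball_subset_closedBall h.2)).self_of_nhds, zero_mul]
  · intro x hx
    filter_upwards [h1 x hx] with y hy
    simp [hy]

section Gauge

variable {K : Set Plane} {d R : ℝ}

/-- The truncated square of the gauge of a set. -/
noncomputable def truncSqGauge (K : Set Plane) (x : Plane) : ℝ := (1 - min (gauge K x) 1 ^ 2) / 2

lemma lipschitzWith_truncSqGauge (hK : Convex ℝ K) (hd : 0 < d)
    (hin : Metric.ball 0 d ⊆ K) : ∃ C, LipschitzWith C (truncSqGauge K) := by
  have hL : LipschitzWith (⟨d, hd.le⟩ : NNReal)⁻¹ (gauge K) :=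
    hK.lipschitzWith_gauge (r := ⟨d, hd.le⟩) hd hin
  refine ⟨_, LipschitzWith.of_dist_le_mul (K := (⟨d, hd.le⟩ : NNReal)⁻¹) fun x y => ?_⟩
  refine le_trans ?_ (hL.dist_le_mul x y)
  set s := gauge K x
  set t := gauge K y
  have hs : 0 ≤ s := gauge_nonneg x
  have ht : 0 ≤ t := gauge_nonneg y
  simp only [truncSqGauge, Real.dist_eq]
  have e : (1 - min s 1 ^ 2) / 2 - (1 - min t 1 ^ 2) / 2 =
      (min t 1 - min s 1) * ((min t 1 + min s 1) / 2) := by ring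
  have hs1 : 0 ≤ min s 1 := le_min hs zero_le_one
  have ht1 : 0 ≤ min t 1 := le_min ht zero_le_one
  have h1 : |(min t 1 + min s 1) / 2| ≤ 1 := by
    rw [abs_of_nonneg (by positivity)]
    linarith [min_le_right t 1, min_le_right s 1]
  rw [e, abs_mul]
  calc |min t 1 - min s 1| * |(min t 1 + min s 1) / 2| ≤ |min t 1 - min s 1| * 1 := by gcongr
    _ ≤ |t - s| := by rw [mul_one]; exact abs_inf_sub_inf_le_abs _ _ _
    _ = |s - t| := abs_sub_comm _ _

lemma integral_gauge_gradient_eq_zero (hK : Convex ℝ K) (ho : IsOpen K)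
    (hd : 0 < d) (hin : Metric.ball 0 d ⊆ K) {A B : Plane → ℝ}
    (hA : ContDiff ℝ 1 A) (hB : ContDiff ℝ 1 B) (hAc : HasCompactSupport A)
    (hBc : HasCompactSupport B)
    (hdiv : ∀ x ∈ K, fderiv ℝ A x (stdVec 0) = fderiv ℝ B x (stdVec 1)) :
    IntegrableOn (fun x => gauge K x * (fderiv ℝ (gauge K) x (stdVec 0) * A x -
      fderiv ℝ (gauge K) x (stdVec 1) * B x)) K ∧
    ∫ x in K, gauge K x * (fderiv ℝ (gauge K) x (stdVec 0) * A x -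
      fderiv ℝ (gauge K) x (stdVec 1) * B x) = 0 := by
  have h0 : K ∈ 𝓝 (0 : Plane) := mem_of_superset (Metric.ball_mem_nhds _ hd) hin
  obtain ⟨C, hC⟩ := lipschitzWith_truncSqGauge hK hd hin
  have hL : LipschitzWith (⟨d, hd.le⟩ : NNReal)⁻¹ (gauge K) :=
    hK.lipschitzWith_gauge (r := ⟨d, hd.le⟩) hd hin
  set Φ := truncSqGauge K with hΦ
  obtain ⟨CA, hCA⟩ := hA.lipschitzWith_of_hasCompactSupport hAc (by simp)
  obtain ⟨CB, hCB⟩ := hB.lipschitzWith_of_hasCompactSupport hBc (by simp)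
  have iA := hC.integral_lineDeriv_mul_eq (μ := volume) hCA hAc (stdVec 0)
  have iB := hC.integral_lineDeriv_mul_eq (μ := volume) hCB hBc (stdVec 1)
  have hlA : ∀ x v, lineDeriv ℝ A x v = fderiv ℝ A x v := fun x v =>
    (hA.differentiable (by simp) x).lineDeriv_eq_fderiv
  have hlB : ∀ x v, lineDeriv ℝ B x v = fderiv ℝ B x v := fun x v =>
    (hB.differentiable (by simp) x).lineDeriv_eq_fderiv
  simp_rw [hlA, map_neg] at iA
  simp_rw [hlB, map_neg] at iB
  have hΦ0 : ∀ x ∉ K, Φ x = 0 := by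
    intro x hx
    have : 1 ≤ gauge K x := by
      by_contra h
      exact hx (ho.interior_eq ▸ (gauge_lt_one_iff_mem_interior hK h0).1 (not_le.1 h))
    simp [hΦ, truncSqGauge, min_eq_right this]
  have hint : ∀ {f : Plane → ℝ} (_ : ContDiff ℝ 1 f) (_ : HasCompactSupport f) (v : Plane),
      Integrable (fun x => lineDeriv ℝ Φ x v * f x) := by
    intro f hf hfc v
    refine Integrable.bdd_mul (c := C * ‖v‖) (hf.continuous.integrable_of_hasCompactSupport hfc)
      (aestronglyMeasurable_lineDeriv (𝕜 := ℝ) hC.continuous _) (ae_of_all _ fun x => ?_)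
    exact norm_lineDeriv_le_of_lipschitz (𝕜 := ℝ) hC
  have hzero : ∫ x, (lineDeriv ℝ Φ x (stdVec 0) * A x - lineDeriv ℝ Φ x (stdVec 1) * B x) = 0 := by
    rw [integral_sub (hint hA hAc _) (hint hB hBc _), iA, iB, sub_eq_zero]
    congr 1
    ext x
    by_cases hx : x ∈ K
    · rw [hdiv x hx]
    · rw [hΦ0 x hx]; simp
  have hae : ∀ᵐ x, lineDeriv ℝ Φ x (stdVec 0) * A x - lineDeriv ℝ Φ x (stdVec 1) * B x =
      K.indicator (fun x => - (gauge K x * (fderiv ℝ (gauge K) x (stdVec 0) * A x -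
        fderiv ℝ (gauge K) x (stdVec 1) * B x))) x := by
    have hfr : ∀ᵐ x, x ∉ frontier K := by
      rw [ae_iff]
      simpa using hK.addHaar_frontier volume
    filter_upwards [hL.ae_differentiableAt (μ := volume), hfr] with x hx hxf
    by_cases hxK : x ∈ K
    · rw [indicator_of_mem hxK]
      have hev : Φ =ᶠ[𝓝 x] fun y => (1 - gauge K y ^ 2) / 2 := by
        filter_upwards [ho.mem_nhds hxK] with y hy
        have : gauge K y ≤ 1 := gauge_le_one_of_mem hy
        simp [hΦ, truncSqGauge, min_eq_left this]
      have hder : ∀ v, lineDeriv ℝ Φ x v = - (gauge K x * fderiv ℝ (gauge K) x v) := by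
        intro v
        have h1 : HasFDerivAt (fun y => (1 - gauge K y ^ 2) / 2)
          ((2 : ℝ)⁻¹ • (-((2 * gauge K x) • fderiv ℝ (gauge K) x))) x := by
          have := ((hx.hasFDerivAt.pow 2).const_sub 1).mul_const (2 : ℝ)⁻¹
          simpa [div_eq_mul_inv] using this
        have h2 := h1.congr_of_eventuallyEq hev
        rw [h2.differentiableAt.lineDeriv_eq_fderiv, h2.fderiv]
        simp
        ring
      rw [hder, hder]
      ring
    · rw [indicator_of_notMem hxK]
      have hxc : x ∉ closure K := fun h => hxf ⟨h, by rwa [ho.interior_eq]⟩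
      have hev : Φ =ᶠ[𝓝 x] fun _ => (0 : ℝ) := by
        filter_upwards [isClosed_closure.isOpen_compl.mem_nhds hxc] with y hy
        exact hΦ0 y fun h => hy (subset_closure h)
      have hder : ∀ v, lineDeriv ℝ Φ x v = 0 := by
        intro v
        have h2 : HasFDerivAt Φ (0 : Plane →L[ℝ] ℝ) x :=
          (hasFDerivAt_const (0 : ℝ) x).congr_of_eventuallyEq hev
        rw [h2.differentiableAt.lineDeriv_eq_fderiv, h2.fderiv]
        simp
      simp [hder]
  constructor
  · have := ((hint hA hAc (stdVec 0)).sub (hint hB hBc (stdVec 1))).congr hae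
    rw [integrable_indicator_iff ho.measurableSet] at this
    simpa using this.neg
  · rw [integral_congr_ae hae, integral_indicator ho.measurableSet, integral_neg,
      neg_eq_zero] at hzero
    exact hzero

end Gauge

/-- The Friedrichs inequality for a function that is holomorphic up to the boundary of a convex
domain. -/
theorem integral_re_sq_le {K : Set Plane} {d k R : ℝ} (hK : Convex ℝ K) (ho : IsOpen K)
    (hd : 0 < d) (hk0 : 0 ≤ k) (hk1 : k < 1) (hR0 : 0 < R) (hR : R ^ 2 * (1 - k ^ 2) = d ^ 2)
    (hin : Metric.ball 0 d ⊆ K) (hout : K ⊆ Metric.closedBall 0 R) {V : Set ℂ} (hV : IsOpen V)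
    {F : ℂ → ℂ} (hF : DifferentiableOn ℂ F V) (hKV : ∀ x ∈ closure K, toComplex x ∈ V)
    (hF0 : (F 0).re = 0) :
    ∫ x in K, (F (toComplex x)).re ^ 2 ≤
      (1 + k) / (1 - k) * ∫ x in K, (F (toComplex x)).im ^ 2 := by
  have h0K : K ∈ 𝓝 (0 : Plane) := mem_of_superset (Metric.ball_mem_nhds _ hd) hin
  have hb : Bornology.IsBounded K := Metric.isBounded_closedBall.subset hout
  have hcomp : IsCompact (closure K) := hb.isCompact_closure
  have h0V : (0 : ℂ) ∈ V := by
    simpa using hKV 0 (subset_closure (mem_of_mem_nhds h0K))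
  have hF2 : DifferentiableOn ℂ (fun z => F z ^ 2) V := hF.pow 2
  set H : ℂ → ℂ := dslope (fun z => F z ^ 2) 0 with hHdef
  have hH : DifferentiableOn ℂ H V :=
    (Complex.differentiableOn_dslope (hV.mem_nhds h0V)).2 hF2
  have hFH : ∀ z, F z ^ 2 = F 0 ^ 2 + z * H z := by
    intro z
    have := sub_smul_dslope (fun z => F z ^ 2) 0 z
    rw [smul_eq_mul, sub_zero] at this
    rw [hHdef, this]
    ring
  have hU : IsOpen (toComplex ⁻¹' V) := hV.preimage toComplex.continuous
  have hHs : ContDiffOn ℝ 1 (fun x => H (toComplex x)) (toComplex ⁻¹' V) :=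
    ((hH.contDiffOn hV (n := 1)).restrict_scalars ℝ).comp toComplex.contDiff.contDiffOn
      fun x hx => hx
  obtain ⟨A, hA, hAc, hAe⟩ := exists_contDiff_hasCompactSupport_eventuallyEq hU hcomp hKV
    (Complex.reCLM.contDiff.comp_contDiffOn hHs)
  obtain ⟨B, hB, hBc, hBe⟩ := exists_contDiff_hasCompactSupport_eventuallyEq hU hcomp hKV
    (Complex.imCLM.contDiff.comp_contDiffOn hHs)
  have hdiv : ∀ x ∈ K, fderiv ℝ A x (stdVec 0) = fderiv ℝ B x (stdVec 1) := by
    intro x hx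
    have hxV := hKV x (subset_closure hx)
    have hder : HasFDerivAt H ((ContinuousLinearMap.toSpanSingleton ℂ
        (deriv H (toComplex x))).restrictScalars ℝ) (toComplex x) :=
      ((hH.differentiableAt (hV.mem_nhds hxV)).hasDerivAt.hasFDerivAt).restrictScalars ℝ
    have hder2 := hder.comp x toComplex.hasFDerivAt
    rw [(hAe x (subset_closure hx)).fderiv_eq, (hBe x (subset_closure hx)).fderiv_eq]
    have hre := (Complex.reCLM.hasFDerivAt.comp x hder2).fderiv
    have him := (Complex.imCLM.hasFDerivAt.comp x hder2).fderiv
    change fderiv ℝ (Complex.reCLM ∘ (H ∘ toComplex)) x _ =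
      fderiv ℝ (Complex.imCLM ∘ (H ∘ toComplex)) x _
    rw [hre, him]
    simp [toComplex_stdVec_zero, toComplex_stdVec_one]
  obtain ⟨hint, hzero⟩ := integral_gauge_gradient_eq_zero hK ho hd hin hA hB hAc hBc hdiv
  have hL : LipschitzWith (⟨d, hd.le⟩ : NNReal)⁻¹ (gauge K) :=
    hK.lipschitzWith_gauge (r := ⟨d, hd.le⟩) hd hin
  have hFc : ContinuousOn (fun x => F (toComplex x)) (closure K) :=
    hF.continuousOn.comp toComplex.continuous.continuousOn hKV
  have hre : IntegrableOn (fun x => (F (toComplex x)).re ^ 2) K :=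
    (((Complex.continuous_re.comp_continuousOn hFc).pow 2).integrableOn_compact hcomp).mono_set
      subset_closure
  have him : IntegrableOn (fun x => (F (toComplex x)).im ^ 2) K :=
    (((Complex.continuous_im.comp_continuousOn hFc).pow 2).integrableOn_compact hcomp).mono_set
      subset_closure
  have hpt : ∀ᵐ x ∂(volume.restrict K), (1 - k) / d ^ 2 * ((F (toComplex x)).re ^ 2 -
      (1 + k) / (1 - k) * (F (toComplex x)).im ^ 2) ≤
      gauge K x * (fderiv ℝ (gauge K) x (stdVec 0) * A x -
      fderiv ℝ (gauge K) x (stdVec 1) * B x) := by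
    have hne : ∀ᵐ x ∂(volume : Measure Plane), x ≠ 0 := by
      rw [ae_iff]; simp
    filter_upwards [ae_restrict_mem ho.measurableSet,
      ae_restrict_of_ae (hL.ae_differentiableAt (μ := volume)), ae_restrict_of_ae hne]
      with x hxK hx hx0
    have hx2 : 0 < x 0 ^ 2 + x 1 ^ 2 := by
      have := EuclideanSpace.norm_sq_eq x
      rw [Fin.sum_univ_two, Real.norm_eq_abs, Real.norm_eq_abs, sq_abs, sq_abs] at this
      rw [← this]
      have := norm_pos_iff.2 hx0
      positivity
    have hnx : ‖x‖ ^ 2 = x 0 ^ 2 + x 1 ^ 2 := by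
      rw [EuclideanSpace.norm_sq_eq]; simp
    have hxe : x = x 0 • stdVec 0 + x 1 • stdVec 1 := by
      ext i; fin_cases i <;> simp
    set n0 := fderiv ℝ (gauge K) x (stdVec 0) with hn0
    set n1 := fderiv ℝ (gauge K) x (stdVec 1) with hn1
    have hAx : A x = (H (toComplex x)).re := (hAe x (subset_closure hxK)).self_of_nhds
    have hBx : B x = (H (toComplex x)).im := (hBe x (subset_closure hxK)).self_of_nhds
    have hsq := hFH (toComplex x)
    have hsq_re := congrArg Complex.re hsq
    have hsq_im := congrArg Complex.im hsq
    simp only [pow_two, Complex.mul_re, Complex.mul_im, Complex.add_re, Complex.add_im,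
      toComplex_re, toComplex_im, hF0, ← hAx, ← hBx] at hsq_re hsq_im
    have hEuler : fderiv ℝ (gauge K) x x = gauge K x := by
      have h1 : HasDerivAt (fun t : ℝ => gauge K (t • x)) (fderiv ℝ (gauge K) x x) 1 := by
        have h2 : HasDerivAt (fun t : ℝ => t • x) x 1 := by
          simpa using (hasDerivAt_id (1 : ℝ)).smul_const x
        have h3 : HasFDerivAt (gauge K) (fderiv ℝ (gauge K) x) ((1 : ℝ) • x) := by
          rw [one_smul]; exact hx.hasFDerivAt
        exact h3.comp_hasDerivAt 1 h2
      have h4 : HasDerivAt (fun t : ℝ => gauge K (t • x)) (gauge K x) 1 := by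
        have : HasDerivAt (fun t : ℝ => t * gauge K x) (gauge K x) 1 := by
          simpa using (hasDerivAt_id (1 : ℝ)).mul_const (gauge K x)
        refine this.congr_of_eventuallyEq ?_
        filter_upwards [lt_mem_nhds (zero_lt_one' ℝ)] with t ht
        rw [gauge_smul_of_nonneg ht.le, smul_eq_mul]
      exact h1.unique h4
    have hE : n0 * x 0 + n1 * x 1 = gauge K x := by
      have := congrArg (fderiv ℝ (gauge K) x) hxe
      rw [map_add, map_smul, map_smul, ← hn0, ← hn1, smul_eq_mul, smul_eq_mul, hEuler] at this
      linarith
    have hn : (n0 ^ 2 + n1 ^ 2) * d ^ 2 ≤ 1 := by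
      have hnorm : ‖fderiv ℝ (gauge K) x‖ ≤ d⁻¹ :=
        (norm_fderiv_le_of_lipschitz ℝ hL).trans_eq (NNReal.coe_inv _)
      have h1 := (fderiv ℝ (gauge K) x).le_opNorm (n0 • stdVec 0 + n1 • stdVec 1)
      rw [map_add, map_smul, map_smul, ← hn0, ← hn1, smul_eq_mul, smul_eq_mul] at h1
      set y : Plane := n0 • stdVec 0 + n1 • stdVec 1 with hy
      have hy2 : ‖y‖ ^ 2 = n0 ^ 2 + n1 ^ 2 := by
        rw [EuclideanSpace.norm_sq_eq]; simp [hy]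
      have h2 : ‖y‖ * ‖y‖ ≤ d⁻¹ * ‖y‖ := by
        calc ‖y‖ * ‖y‖ = n0 * n0 + n1 * n1 := by linarith
          _ ≤ ‖n0 * n0 + n1 * n1‖ := le_abs_self _
          _ ≤ _ := h1.trans (by gcongr)
      have h3 : ‖y‖ ≤ d⁻¹ := by
        rcases (norm_nonneg y).eq_or_lt with h | h
        · rw [← h]; positivity
        · exact le_of_mul_le_mul_right h2 h
      rw [← hy2, ← mul_pow]
      refine pow_le_one₀ (by positivity) ?_
      rwa [← le_div_iff₀ hd, one_div]
    have hN : x 0 ^ 2 + x 1 ^ 2 ≤ R ^ 2 * gauge K x ^ 2 := by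
      have := le_gauge_of_subset_closedBall (x := x) (absorbent_nhds_zero h0K) hR0.le hout
      rw [div_le_iff₀ hR0] at this
      rw [← hnx, ← mul_pow, mul_comm]
      gcongr
    refine weighted_square_le (x0 := x 0) (x1 := x 1) (g0 := (F 0).im) hd hk0 hk1 hR hx2
      (by linarith) (by linarith) hE hn hN
  have hle := integral_mono_ae ((hre.sub (him.const_mul _)).const_mul _) hint hpt
  rw [hzero, integral_const_mul] at hle
  have hpos : 0 < (1 - k) / d ^ 2 := div_pos (by linarith) (by positivity)
  have h1 : ∫ x in K, ((F (toComplex x)).re ^ 2 -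
      (1 + k) / (1 - k) * (F (toComplex x)).im ^ 2) ≤ 0 := by
    by_contra h
    push Not at h
    exact absurd hle (not_le.2 (mul_pos hpos h))
  rw [integral_sub hre (him.const_mul _), integral_const_mul] at h1
  linarith

/-- The mollification of a function by a normalized bump function. -/
noncomputable def mollify (φ : ContDiffBump (0 : Plane)) (f : Plane → ℝ) : Plane → ℝ :=
  convolution (φ.normed volume) f (ContinuousLinearMap.lsmul ℝ ℝ) volume

section Mollify

variable {φ : ContDiffBump (0 : Plane)} {f : Plane → ℝ}

lemma mollify_apply (x : Plane) : mollify φ f x = ∫ y, φ.normed volume y * f (x - y) := by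
  simp [mollify, convolution_def]

lemma differentiable_mollify (hf : LocallyIntegrable f) : Differentiable ℝ (mollify φ f) :=
  (HasCompactSupport.contDiff_convolution_left (n := 1) _ φ.hasCompactSupport_normed
    φ.contDiff_normed hf).differentiable (by simp)

lemma fderiv_mollify (hf : LocallyIntegrable f) (x v : Plane) :
    fderiv ℝ (mollify φ f) x v = ∫ y, fderiv ℝ (φ.normed volume) (x - y) v * f y := by
  have h := HasCompactSupport.hasFDerivAt_convolution_left (ContinuousLinearMap.lsmul ℝ ℝ)
    φ.hasCompactSupport_normed (φ.contDiff_normed (μ := volume) (n := 1)) hf x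
  have hex := (φ.hasCompactSupport_normed (μ := volume)).fderiv ℝ |>.convolutionExists_left
    (ContinuousLinearMap.precompL Plane (ContinuousLinearMap.lsmul ℝ ℝ : ℝ →L[ℝ] ℝ →L[ℝ] ℝ))
    ((φ.contDiff_normed (μ := volume) (n := 1)).continuous_fderiv (by simp)) hf x
  change fderiv ℝ (convolution _ _ _ _) x v = _
  rw [h.fderiv, convolution_def, ContinuousLinearMap.integral_apply hex]
  rw [← integral_sub_left_eq_self _ volume x]
  simp [ContinuousLinearMap.precompL_apply]

lemma isTestFunction_bump {Ω : Set Plane} {x : Plane}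
    (hx : Metric.closedBall x φ.rOut ⊆ Ω) :
    IsTestFunction Ω (fun y => φ.normed volume (x - y)) where
  smooth := φ.contDiff_normed.comp (contDiff_const.sub contDiff_id)
  compactSupport := φ.hasCompactSupport_normed.comp_homeomorph (Homeomorph.subLeft x)
  support_subset := by
    refine (closure_minimal ?_ Metric.isClosed_closedBall).trans hx
    intro y hy
    have : x - y ∈ Function.support (φ.normed (volume : Measure Plane)) := hy
    rw [φ.support_normed_eq, mem_ball_zero_iff] at this
    rw [mem_closedBall_iff_norm, norm_sub_rev]
    exact this.le

lemma gradient_bump_apply (x y : Plane) (i : Fin 2) :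
    gradient (fun y => φ.normed volume (x - y)) y i =
      - fderiv ℝ (φ.normed volume) (x - y) (stdVec i) := by
  rw [gradient_apply_eq]
  have h : HasFDerivAt (φ.normed volume) (fderiv ℝ (φ.normed volume) (x - y)) (x - y) :=
    (φ.contDiff_normed.differentiable (n := 1) (by simp) _).hasFDerivAt
  have h2 := h.comp y ((hasFDerivAt_id y).const_sub x)
  change fderiv ℝ (φ.normed volume ∘ HSub.hSub x) y _ = _
  rw [h2.fderiv]
  simp

lemma mollify_cauchyRiemann {Ω : Set Plane} (ho : MeasurableSet Ω) {h g : Plane → ℝ}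
    (hh : LocallyIntegrable (Ω.indicator h)) (hg : LocallyIntegrable (Ω.indicator g))
    (hCR : WeakCauchyRiemann Ω h g) {x : Plane} (hx : Metric.closedBall x φ.rOut ⊆ Ω) :
    fderiv ℝ (mollify φ (Ω.indicator h)) x (stdVec 0) =
      fderiv ℝ (mollify φ (Ω.indicator g)) x (stdVec 1) ∧
    fderiv ℝ (mollify φ (Ω.indicator h)) x (stdVec 1) =
      - fderiv ℝ (mollify φ (Ω.indicator g)) x (stdVec 0) := by
  have key : ∀ (u : Plane → ℝ) (_ : LocallyIntegrable (Ω.indicator u)) (i : Fin 2),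
      fderiv ℝ (mollify φ (Ω.indicator u)) x (stdVec i) =
        - ∫ y in Ω, u y * gradient (fun y => φ.normed volume (x - y)) y i := by
    intro u hu i
    rw [fderiv_mollify hu, ← integral_neg, ← integral_indicator ho]
    congr 1
    ext y
    by_cases hy : y ∈ Ω
    · simp only [indicator_of_mem hy, gradient_bump_apply]
      ring
    · simp [indicator_of_notMem hy]
  obtain ⟨h1, h2⟩ := hCR _ (isTestFunction_bump hx)
  rw [key h hh, key h hh, key g hg, key g hg, h1, h2]
  exact ⟨rfl, rfl⟩

lemma sq_mollify_le (hf : LocallyIntegrable f) (hf2 : LocallyIntegrable fun x => f x ^ 2)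
    (x : Plane) : mollify φ f x ^ 2 ≤ mollify φ (fun x => f x ^ 2) x := by
  have i1 : Integrable fun y => φ.normed volume y * f (x - y) := by
    simpa [ConvolutionExistsAt] using φ.hasCompactSupport_normed.convolutionExists_left
      (ContinuousLinearMap.lsmul ℝ ℝ : ℝ →L[ℝ] ℝ →L[ℝ] ℝ) φ.continuous_normed hf x
  have i2 : Integrable fun y => φ.normed volume y * f (x - y) ^ 2 := by
    simpa [ConvolutionExistsAt] using φ.hasCompactSupport_normed.convolutionExists_left
      (ContinuousLinearMap.lsmul ℝ ℝ : ℝ →L[ℝ] ℝ →L[ℝ] ℝ) φ.continuous_normed hf2 x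
  set m := mollify φ f x with hm
  have h0 : 0 ≤ ∫ y, φ.normed volume y * (f (x - y) - m) ^ 2 :=
    integral_nonneg fun y => mul_nonneg (φ.nonneg_normed y) (sq_nonneg _)
  have e : ∀ y, φ.normed volume y * (f (x - y) - m) ^ 2 = φ.normed volume y * f (x - y) ^ 2 -
      2 * m * (φ.normed volume y * f (x - y)) + m ^ 2 * φ.normed volume y := fun y => by ring
  simp_rw [e] at h0
  rw [integral_add, integral_sub i2 (i1.const_mul _), integral_const_mul, integral_const_mul,
    φ.integral_normed, ← mollify_apply, ← mollify_apply (f := fun x => f x ^ 2), ← hm] at h0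
  · linarith
  · exact i2.sub (i1.const_mul _)
  · exact φ.integrable_normed.const_mul _

lemma integral_sq_mollify_le (hf : Integrable f) (hf2 : Integrable fun x => f x ^ 2)
    (s : Set Plane) :
    IntegrableOn (fun x => mollify φ f x ^ 2) s ∧
      ∫ x in s, mollify φ f x ^ 2 ≤ ∫ x, f x ^ 2 := by
  have hi : Integrable (mollify φ fun x => f x ^ 2) :=
    Integrable.integrable_convolution _ φ.integrable_normed hf2
  have hi2 : Integrable (fun x => mollify φ f x ^ 2) := by
    refine hi.mono' ?_ (ae_of_all _ fun x => ?_)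
    · exact ((differentiable_mollify hf.locallyIntegrable).continuous.pow 2).aestronglyMeasurable
    · rw [Real.norm_of_nonneg (sq_nonneg _)]
      exact sq_mollify_le hf.locallyIntegrable hf2.locallyIntegrable x
  refine ⟨hi2.integrableOn, ?_⟩
  calc ∫ x in s, mollify φ f x ^ 2 ≤ ∫ x, mollify φ f x ^ 2 :=
        setIntegral_le_integral hi2 (ae_of_all _ fun x => sq_nonneg _)
    _ ≤ ∫ x, mollify φ (fun x => f x ^ 2) x := integral_mono hi2 hi fun x =>
        sq_mollify_le hf.locallyIntegrable hf2.locallyIntegrable x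
    _ = ∫ x, f x ^ 2 := by
      rw [mollify, integral_convolution _ φ.integrable_normed hf2, φ.integral_normed]
      simp

end Mollify

/-- The inverse identification of `ℂ` with the plane. -/
noncomputable def ofComplex : ℂ →L[ℝ] Plane :=
  Complex.reCLM.smulRight (stdVec 0) + Complex.imCLM.smulRight (stdVec 1)

lemma ofComplex_toComplex (x : Plane) : ofComplex (toComplex x) = x := by
  ext i
  fin_cases i <;> simp [ofComplex]

/-- The Friedrichs inequality of `integral_re_sq_le`, for a function given by real and imaginary
parts with the Cauchy–Riemann equations. -/
lemma integral_sq_sub_le {K : Set Plane} {x₀ : Plane} {d k R : ℝ} (hK : Convex ℝ K)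
    (ho : IsOpen K) (hd : 0 < d) (hk0 : 0 ≤ k) (hk1 : k < 1) (hR0 : 0 < R)
    (hR : R ^ 2 * (1 - k ^ 2) = d ^ 2) (hin : Metric.ball x₀ d ⊆ K)
    (hout : K ⊆ Metric.closedBall x₀ R) {W : Set Plane} (hW : IsOpen W) (hKW : closure K ⊆ W)
    {u v : Plane → ℝ} (hu : Differentiable ℝ u) (hv : Differentiable ℝ v)
    (h1 : ∀ x ∈ W, fderiv ℝ u x (stdVec 0) = fderiv ℝ v x (stdVec 1))
    (h2 : ∀ x ∈ W, fderiv ℝ u x (stdVec 1) = - fderiv ℝ v x (stdVec 0)) :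
    ∫ x in K, (u x - u x₀) ^ 2 ≤ (1 + k) / (1 - k) * ∫ x in K, v x ^ 2 := by
  set K' : Set Plane := (fun y => x₀ + y) ⁻¹' K with hK'
  have hshift : ∀ f : Plane → ℝ, ∫ x in K, f x = ∫ y in K', f (x₀ + y) := fun f =>
    ((measurePreserving_add_left volume x₀).setIntegral_preimage_emb
      (MeasurableEquiv.addLeft x₀).measurableEmbedding f K).symm
  set F : ℂ → ℂ := fun z => ((u (x₀ + ofComplex z) - u x₀ : ℝ) : ℂ) +
    ((v (x₀ + ofComplex z) : ℝ) : ℂ) * Complex.I with hF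
  have hFd : DifferentiableOn ℂ F ((fun z => x₀ + ofComplex z) ⁻¹' W) := by
    intro z hz
    refine DifferentiableAt.differentiableWithinAt ?_
    rw [differentiableAt_complex_iff_differentiableAt_real]
    have ha : HasFDerivAt (fun z : ℂ => x₀ + ofComplex z) ofComplex z :=
      ofComplex.hasFDerivAt.const_add x₀
    have hu' := ((hu (x₀ + ofComplex z)).hasFDerivAt.comp z ha).sub_const (u x₀)
    have hv' := (hv (x₀ + ofComplex z)).hasFDerivAt.comp z ha
    have hF' := (Complex.ofRealCLM.hasFDerivAt.comp z hu').add
      ((Complex.ofRealCLM.hasFDerivAt.comp z hv').mul_const Complex.I)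
    have hF'' : HasFDerivAt F _ z := hF'
    refine ⟨hF''.differentiableAt, ?_⟩
    rw [hF''.fderiv]
    have e1 : ofComplex 1 = stdVec 0 := by simp [ofComplex]
    have e2 : ofComplex Complex.I = stdVec 1 := by simp [ofComplex]
    have g1 := h1 _ hz
    have g2 := h2 _ hz
    apply Complex.ext <;> simp [e1, e2, g1, g2]
  have hmain := integral_re_sq_le (K := K') (d := d) (k := k) (R := R) (F := F)
    (hK.translate_preimage_right x₀) (ho.preimage (continuous_const_add x₀)) hd hk0 hk1 hR0 hR
    (fun y hy => hin (by simpa using hy)) (fun y hy => by simpa using hout hy)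
    (hW.preimage (by fun_prop)) hFd ?_ ?_
  · rw [hshift, hshift]
    simpa [hF, ofComplex_toComplex] using hmain
  · intro y hy
    change x₀ + ofComplex (toComplex y) ∈ W
    rw [ofComplex_toComplex]
    exact hKW ((continuous_const_add x₀).closure_preimage_subset K hy)
  · simp [hF]

set_option maxHeartbeats 1000000 in
/-- A convex domain between two concentric discs satisfies the Friedrichs inequality with a
constant that depends only on the ratio of the radii. -/
theorem friedrichsInequality_of_convex {Ω : Set Plane} {x₀ : Plane} {d k R : ℝ}
    (hΩ : Convex ℝ Ω) (ho : IsOpen Ω) (hd : 0 < d) (hk0 : 0 ≤ k) (hk1 : k < 1) (hR0 : 0 < R)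
    (hR : R ^ 2 * (1 - k ^ 2) = d ^ 2) (hin : Metric.ball x₀ d ⊆ Ω)
    (hout : Ω ⊆ Metric.closedBall x₀ R) : FriedrichsInequality Ω ((1 + k) / (1 - k)) := by
  intro h g hh hg hCR
  have hb : Bornology.IsBounded Ω := Metric.isBounded_closedBall.subset hout
  have hfin : volume Ω ≠ ⊤ := hb.measure_lt_top.ne
  have : IsFiniteMeasure (volume.restrict Ω) := ⟨by simpa using hb.measure_lt_top⟩
  set Γ := (1 + k) / (1 - k) with hΓ
  have hΓ0 : 0 ≤ Γ := div_nonneg (by linarith) (by linarith)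
  have hsq : ∀ (u : Plane → ℝ), (fun x => Ω.indicator u x ^ 2) =
      Ω.indicator fun x => u x ^ 2 := by
    intro u
    ext x
    by_cases hx : x ∈ Ω <;> simp [hx]
  have hi : ∀ {u : Plane → ℝ}, MemLp u 2 (volume.restrict Ω) → Integrable (Ω.indicator u) :=
    fun hu => (integrable_indicator_iff ho.measurableSet).2 (hu.integrable (by simp))
  have hi2 : ∀ {u : Plane → ℝ}, MemLp u 2 (volume.restrict Ω) →
      Integrable fun x => Ω.indicator u x ^ 2 := by
    intro u hu
    rw [hsq, integrable_indicator_iff ho.measurableSet]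
    exact hu.integrable_sq
  have hint2 : ∀ u : Plane → ℝ, ∫ x, Ω.indicator u x ^ 2 = ∫ x in Ω, u x ^ 2 := by
    intro u
    rw [hsq, integral_indicator ho.measurableSet]
  have hpos : ∀ n : ℕ, (0 : ℝ) < n + 2 := fun n => by positivity
  set t : ℕ → ℝ := fun n => (n + 1) / (n + 2) with ht
  have ht0 : ∀ n, 0 < t n := fun n => by simp only [ht]; positivity
  have ht2 : ∀ n, 1 / 2 ≤ t n := fun n => by
    simp only [ht]
    rw [div_le_div_iff₀ (by norm_num) (hpos n)]
    have : (0 : ℝ) ≤ n := n.cast_nonneg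
    linarith
  have ht1 : ∀ n, 1 - t n = 1 / (n + 2) := fun n => by
    simp only [ht]
    field_simp
    ring
  have htt : Tendsto t atTop (𝓝 1) := by
    have h1 : Tendsto (fun n : ℕ => 1 - 1 / ((n : ℝ) + 2)) atTop (𝓝 (1 - 0)) := by
      refine tendsto_const_nhds.sub ?_
      have := (tendsto_one_div_add_atTop_nhds_zero_nat (𝕜 := ℝ)).comp (tendsto_add_atTop_nat 1)
      refine this.congr fun n => ?_
      simp only [Function.comp, Nat.cast_add, Nat.cast_one]
      ring
    rw [sub_zero] at h1
    exact h1.congr fun n => by linarith [ht1 n]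
  set δ : ℕ → ℝ := fun n => d / 2 * (1 - t n) with hδ
  have hδ0 : ∀ n, 0 < δ n := fun n => by
    simp only [hδ, ht1]
    have := hpos n
    positivity
  have hδt : Tendsto δ atTop (𝓝 0) := by
    have := (htt.const_sub 1).const_mul (d / 2)
    simpa using this
  set φ : ℕ → ContDiffBump (0 : Plane) := fun n =>
    ⟨δ n / 2, δ n, half_pos (hδ0 n), half_lt_self (hδ0 n)⟩ with hφ
  set S : ℕ → Set Plane := fun n => AffineMap.homothety x₀ (t n)⁻¹ ⁻¹' Ω with hS
  have hSo : ∀ n, IsOpen (S n) := fun n =>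
    ho.preimage (AffineMap.homothety_continuous x₀ _)
  have hS_mem : ∀ n x, x ∈ S n ↔ x₀ + (t n)⁻¹ • (x - x₀) ∈ Ω := by
    intro n x
    simp [hS, AffineMap.homothety_apply, add_comm]
  have hSsub : ∀ n, S n ⊆ Metric.closedBall x₀ (t n * R) := by
    intro n x hx
    have := hout ((hS_mem n x).1 hx)
    rw [mem_closedBall_iff_norm] at this ⊢
    rw [add_sub_cancel_left, norm_smul, norm_inv, Real.norm_of_nonneg (ht0 n).le,
      inv_mul_le_iff₀ (ht0 n)] at this
    exact this
  have hSball : ∀ n, Metric.ball x₀ (t n * d) ⊆ S n := by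
    intro n x hx
    rw [hS_mem]
    apply hin
    rw [mem_ball_iff_norm] at hx ⊢
    rw [add_sub_cancel_left, norm_smul, norm_inv, Real.norm_of_nonneg (ht0 n).le,
      inv_mul_lt_iff₀ (ht0 n)]
    exact hx
  have hcball : ∀ n x, x ∉ Metric.cthickening (δ n) Ωᶜ → Metric.closedBall x (δ n) ⊆ Ω := by
    intro n x hx y hy
    by_contra hyΩ
    exact hx (Metric.closedBall_subset_cthickening (E := Ωᶜ) hyΩ (δ n)
      (Metric.mem_closedBall_comm.1 hy))
  have hclos : ∀ n, closure (S n) ⊆ (Metric.cthickening (δ n) Ωᶜ)ᶜ := by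
    intro n x hx hx'
    have hy : AffineMap.homothety x₀ (t n)⁻¹ x ∈ closure Ω :=
      (AffineMap.homothety_continuous x₀ _).closure_preimage_subset Ω hx
    have h1t : 0 < 1 - t n := by rw [ht1]; have := hpos n; positivity
    have hlt : δ n < d * (1 - t n) := by
      simp only [hδ]
      nlinarith
    obtain ⟨z, hz, hxz⟩ := Metric.mem_thickening_iff.1
      (Metric.cthickening_subset_thickening' (mul_pos hd h1t) hlt Ωᶜ hx')
    apply hz
    have hw : x₀ + (1 - t n)⁻¹ • (z - x) ∈ interior Ω := by
      rw [ho.interior_eq]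
      apply hin
      rw [mem_ball_iff_norm, add_sub_cancel_left, norm_smul, norm_inv,
        Real.norm_of_nonneg h1t.le, inv_mul_lt_iff₀ h1t, mul_comm, ← dist_eq_norm, dist_comm]
      exact hxz
    have := hΩ.combo_interior_closure_mem_interior hw hy h1t (ht0 n).le (by ring)
    rw [ho.interior_eq] at this
    convert this using 1
    have e1 : (1 - t n) * (1 - t n)⁻¹ = 1 := mul_inv_cancel₀ h1t.ne'
    have e2 : t n * (t n)⁻¹ = 1 := mul_inv_cancel₀ (ht0 n).ne'
    simp only [AffineMap.homothety_apply, vsub_eq_sub, vadd_eq_add, smul_add, smul_smul, e1, e2,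
      one_smul, sub_smul]
    abel
  set H : ℕ → Plane → ℝ := fun n => mollify (φ n) (Ω.indicator h) with hH
  set G : ℕ → Plane → ℝ := fun n => mollify (φ n) (Ω.indicator g) with hG
  have hHd : ∀ n, Differentiable ℝ (H n) := fun n =>
    differentiable_mollify (hi hh.memLp).locallyIntegrable
  have hmain : ∀ n, ∫ x in S n, (H n x - H n x₀) ^ 2 ≤ Γ * ∫ x in Ω, g x ^ 2 := by
    intro n
    have hCRn := fun x (hx : x ∈ (Metric.cthickening (δ n) Ωᶜ)ᶜ) =>
      mollify_cauchyRiemann (φ := φ n) ho.measurableSet (hi hh.memLp).locallyIntegrable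
        (hi hg).locallyIntegrable hCR (hcball n x hx)
    have := integral_sq_sub_le (K := S n) (x₀ := x₀) (d := t n * d) (k := k) (R := t n * R)
      (hΩ.affine_preimage _) (hSo n) (mul_pos (ht0 n) hd) hk0 hk1 (mul_pos (ht0 n) hR0)
      (by rw [mul_pow, mul_pow, mul_assoc, hR]) (hSball n) (hSsub n)
      Metric.isClosed_cthickening.isOpen_compl (hclos n) (hHd n)
      (differentiable_mollify (hi hg).locallyIntegrable) (fun x hx => (hCRn x hx).1)
      (fun x hx => (hCRn x hx).2)
    refine this.trans (mul_le_mul_of_nonneg_left ?_ hΓ0)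
    rw [← hint2]
    exact (integral_sq_mollify_le (hi hg) (hi2 hg) (S n)).2
  have hHint : ∀ n, IntegrableOn (fun x => (H n x - H n x₀) ^ 2) (S n) := by
    intro n
    have hc : IsCompact (closure (S n)) :=
      (Metric.isBounded_closedBall.subset (hSsub n)).isCompact_closure
    exact ((((hHd n).continuous.sub continuous_const).pow 2).continuousOn.integrableOn_compact
      hc).mono_set subset_closure
  have hbound : ∀ n, H n x₀ ^ 2 * volume.real (Metric.ball x₀ (d / 2)) ≤
      2 * (Γ * ∫ x in Ω, g x ^ 2) + 2 * ∫ x in Ω, h x ^ 2 := by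
    intro n
    have hsub : Metric.ball x₀ (d / 2) ⊆ S n := by
      refine (Metric.ball_subset_ball ?_).trans (hSball n)
      have := ht2 n
      nlinarith
    obtain ⟨j1, j2⟩ := integral_sq_mollify_le (φ := φ n) (hi hh.memLp) (hi2 hh.memLp) (S n)
    rw [hint2] at j2
    have hSfin : volume (S n) ≠ ⊤ :=
      (Metric.isBounded_closedBall.subset (hSsub n)).measure_lt_top.ne
    calc H n x₀ ^ 2 * volume.real (Metric.ball x₀ (d / 2))
        ≤ H n x₀ ^ 2 * volume.real (S n) := by
          gcongr
      _ = ∫ x in S n, H n x₀ ^ 2 := by simp [mul_comm]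
      _ ≤ ∫ x in S n, (2 * (H n x - H n x₀) ^ 2 + 2 * H n x ^ 2) := by
          refine integral_mono ?_ (((hHint n).const_mul 2).add (j1.const_mul 2)) fun x => ?_
          · exact integrableOn_const hSfin
          · simp only
            nlinarith [sq_nonneg (2 * H n x - H n x₀)]
      _ = 2 * (∫ x in S n, (H n x - H n x₀) ^ 2) + 2 * ∫ x in S n, H n x ^ 2 := by
          rw [integral_add ((hHint n).const_mul 2) (j1.const_mul 2), integral_const_mul,
            integral_const_mul]
      _ ≤ _ := by
          have := hmain n
          have := j2
          simp only [hH] at *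
          linarith
  have hvol : 0 < volume.real (Metric.ball x₀ (d / 2)) :=
    ENNReal.toReal_pos (Metric.measure_ball_pos volume x₀ (half_pos hd)).ne'
      measure_ball_lt_top.ne
  set M := (2 * (Γ * ∫ x in Ω, g x ^ 2) + 2 * ∫ x in Ω, h x ^ 2) /
    volume.real (Metric.ball x₀ (d / 2)) with hM
  have hcM : ∀ n, H n x₀ ∈ Metric.closedBall (0 : ℝ) (√M) := by
    intro n
    rw [mem_closedBall_zero_iff, Real.norm_eq_abs]
    refine Real.abs_le_sqrt ?_
    rw [hM, le_div_iff₀ hvol]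
    exact hbound n
  obtain ⟨c, -, σ, hσ, hc⟩ := tendsto_subseq_of_bounded Metric.isBounded_closedBall hcM
  have hae : ∀ᵐ x, Tendsto (fun n => H n x) atTop (𝓝 (Ω.indicator h x)) := by
    refine ContDiffBump.ae_convolution_tendsto_right_of_locallyIntegrable (K := 2) hδt
      (Eventually.of_forall fun n => ?_) (hi hh.memLp).locallyIntegrable
    simp only [hφ]
    linarith
  set f : ℕ → Plane → ℝ≥0∞ := fun n => (S (σ n)).indicator fun x =>
    ENNReal.ofReal ((H (σ n) x - H (σ n) x₀) ^ 2) with hf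
  have hfm : ∀ n, Measurable (f n) := fun n =>
    (ENNReal.measurable_ofReal.comp
      (((hHd _).continuous.sub continuous_const).pow 2).measurable).indicator
      (hSo _).measurableSet
  have hlim : ∀ᵐ x ∂(volume.restrict Ω), ENNReal.ofReal ((h x - c) ^ 2) =
      liminf (fun n => f n x) atTop := by
    filter_upwards [ae_restrict_of_ae hae, ae_restrict_mem ho.measurableSet] with x hx hxΩ
    refine (Tendsto.liminf_eq ?_).symm
    rw [indicator_of_mem hxΩ] at hx
    have h1 : Tendsto (fun n => ENNReal.ofReal ((H (σ n) x - H (σ n) x₀) ^ 2)) atTop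
        (𝓝 (ENNReal.ofReal ((h x - c) ^ 2))) :=
      ENNReal.tendsto_ofReal (((hx.comp hσ.tendsto_atTop).sub hc).pow 2)
    refine h1.congr' ?_
    have h2 : Tendsto (fun n => x₀ + (t (σ n))⁻¹ • (x - x₀)) atTop (𝓝 x) := by
      have := ((htt.comp hσ.tendsto_atTop).inv₀ one_ne_zero).smul_const (x - x₀)
      have := this.const_add x₀
      simpa using this
    filter_upwards [h2.eventually (ho.mem_nhds hxΩ)] with n hn
    rw [hf]
    simp only
    rw [indicator_of_mem ((hS_mem _ _).2 hn)]
  have hfat : ∫⁻ x in Ω, ENNReal.ofReal ((h x - c) ^ 2) ≤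
      ENNReal.ofReal (Γ * ∫ x in Ω, g x ^ 2) := by
    rw [lintegral_congr_ae hlim]
    refine (lintegral_liminf_le hfm).trans ?_
    refine (liminf_le_liminf (Eventually.of_forall fun n => ?_)).trans (liminf_const _).le
    calc ∫⁻ x in Ω, f n x ≤ ∫⁻ x, f n x := setLIntegral_le_lintegral _ _
      _ = ∫⁻ x in S (σ n), ENNReal.ofReal ((H (σ n) x - H (σ n) x₀) ^ 2) :=
          lintegral_indicator (hSo _).measurableSet _
      _ = ENNReal.ofReal (∫ x in S (σ n), (H (σ n) x - H (σ n) x₀) ^ 2) :=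
          (ofReal_integral_eq_lintegral_ofReal (hHint _) (ae_of_all _ fun x => sq_nonneg _)).symm
      _ ≤ _ := ENNReal.ofReal_le_ofReal (hmain _)
  have hhc : MemLp (fun x => h x - c) 2 (volume.restrict Ω) := hh.memLp.sub (memLp_const c)
  have hfin2 : ∫ x in Ω, (h x - c) ^ 2 ≤ Γ * ∫ x in Ω, g x ^ 2 := by
    rw [← ofReal_integral_eq_lintegral_ofReal hhc.integrable_sq
      (ae_of_all _ fun x => sq_nonneg _)] at hfat
    refine (ENNReal.ofReal_le_ofReal_iff ?_).1 hfat
    exact mul_nonneg hΓ0 (integral_nonneg fun x => sq_nonneg _)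
  have hexp : ∫ x in Ω, (h x - c) ^ 2 = (∫ x in Ω, h x ^ 2) + c ^ 2 * volume.real Ω := by
    have e : ∀ x, (h x - c) ^ 2 = h x ^ 2 - 2 * c * h x + c ^ 2 := fun x => by ring
    simp_rw [e]
    have i1 := hh.memLp.integrable_sq
    have i2 := (hh.memLp.integrable (by simp)).const_mul (2 * c)
    rw [integral_add, integral_sub i1 i2, integral_const_mul, hh.integral_eq_zero]
    · simp [mul_comm]
    · exact i1.sub i2
    · exact integrable_const _
  have : 0 ≤ c ^ 2 * volume.real Ω := by positivity
  linarith

/-- The lower bound of the inf-sup constant of a convex domain between two concentric discs. -/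
theorem le_infSupConstant_of_convex {Ω : Set Plane} {x₀ : Plane} {d k R : ℝ}
    (hΩ : Convex ℝ Ω) (ho : IsOpen Ω) (hd : 0 < d) (hk0 : 0 ≤ k) (hk1 : k < 1) (hR0 : 0 < R)
    (hR : R ^ 2 * (1 - k ^ 2) = d ^ 2) (hin : Metric.ball x₀ d ⊆ Ω)
    (hout : Ω ⊆ Metric.closedBall x₀ R) : √((1 - k) / 2) ≤ infSupConstant Ω := by
  have hk : 0 < 1 - k := by linarith
  have := le_infSupConstant_of_friedrichs ho (Metric.isBounded_closedBall.subset hout)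
    ⟨x₀, hin (Metric.mem_ball_self hd)⟩ (div_nonneg (by linarith) hk.le)
    (friedrichsInequality_of_convex hΩ ho hd hk0 hk1 hR0 hR hin hout)
  have e : 1 / (1 + (1 + k) / (1 - k)) = (1 - k) / 2 := by
    field_simp
    norm_num
  rwa [e] at this

lemma hasDerivAt_max_zero_sq (y : ℝ) : HasDerivAt (fun y : ℝ => max y 0 ^ 2) (2 * max y 0) y := by
  rcases lt_trichotomy y 0 with h | h | h
  · rw [max_eq_right h.le, mul_zero]
    refine (hasDerivAt_const y (0 : ℝ)).congr_of_eventuallyEq ?_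
    filter_upwards [gt_mem_nhds h] with z hz
    simp [max_eq_right hz.le]
  · subst h
    have : (fun y : ℝ => max y 0 ^ 2) =O[𝓝 0] fun y => ‖y - 0‖ ^ 2 := by
      refine Asymptotics.IsBigO.of_bound 1 (Eventually.of_forall fun z => ?_)
      simp only [sub_zero, norm_pow, norm_norm, one_mul]
      gcongr
      rw [Real.norm_of_nonneg (le_max_right _ _)]
      exact max_le (le_abs_self _) (abs_nonneg _)
    have h2 := (this.hasFDerivAt (𝕜 := ℝ) one_lt_two).hasDerivAt
    simpa using h2
  · rw [max_eq_left h.le]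
    refine HasDerivAt.congr_of_eventuallyEq (by simpa using hasDerivAt_pow 2 y) ?_
    filter_upwards [lt_mem_nhds h] with z hz
    simp [max_eq_left hz.le]

lemma contDiff_max_zero_sq : ContDiff ℝ 1 (fun y : ℝ => max y 0 ^ 2) := by
  rw [contDiff_one_iff_deriv]
  refine ⟨fun y => (hasDerivAt_max_zero_sq y).differentiableAt, ?_⟩
  rw [funext fun y => (hasDerivAt_max_zero_sq y).deriv]
  fun_prop

/-- A `C²` function that vanishes for `y ≤ 0` and equals `y ^ 3 * (3 - 2 * y)` for `0 ≤ y`. -/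
noncomputable def ramp (y : ℝ) : ℝ := max y 0 ^ 2 * (y * (3 - 2 * y))

/-- The derivative of `ramp`. -/
noncomputable def rampDeriv (y : ℝ) : ℝ := max y 0 ^ 2 * (9 - 8 * y)

lemma hasDerivAt_ramp (y : ℝ) : HasDerivAt ramp (rampDeriv y) y := by
  have h1 : HasDerivAt (fun y : ℝ => y * (3 - 2 * y)) (1 * (3 - 2 * y) + y * (0 - 2 * 1)) y :=
    (hasDerivAt_id y).mul ((hasDerivAt_const y (3 : ℝ)).sub ((hasDerivAt_id y).const_mul 2))
  have h2 := (hasDerivAt_max_zero_sq y).mul h1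
  refine h2.congr_deriv ?_
  have : max y 0 * y = max y 0 ^ 2 := by
    rcases le_total y 0 with h | h
    · simp [max_eq_right h]
    · simp [max_eq_left h, pow_two]
  rw [rampDeriv]
  linear_combination (6 - 4 * y) * this

lemma contDiff_rampDeriv : ContDiff ℝ 1 rampDeriv :=
  contDiff_max_zero_sq.mul (contDiff_const.sub (contDiff_const.mul contDiff_id))

lemma contDiff_ramp : ContDiff ℝ 1 ramp :=
  contDiff_max_zero_sq.mul
    (contDiff_id.mul (contDiff_const.sub (contDiff_const.mul contDiff_id)))

lemma ramp_of_nonpos {y : ℝ} (h : y ≤ 0) : ramp y = 0 := by simp [ramp, max_eq_right h]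

lemma rampDeriv_of_nonpos {y : ℝ} (h : y ≤ 0) : rampDeriv y = 0 := by
  simp [rampDeriv, max_eq_right h]

lemma ramp_mono {x y : ℝ} (hx : 0 ≤ x) (hxy : x ≤ y) (hy : y ≤ 1) : ramp x ≤ ramp y := by
  have hy0 := hx.trans hxy
  simp only [ramp, max_eq_left hx, max_eq_left hy0]
  have e : y ^ 2 * (y * (3 - 2 * y)) - x ^ 2 * (x * (3 - 2 * x)) =
      (y - x) * (x ^ 2 * (1 - x) + y ^ 2 * (1 - y) + (y ^ 2 + x * y + x ^ 2) -
        2 * (y ^ 3 + y ^ 2 * x + y * x ^ 2 + x ^ 3) + (y ^ 3 + x ^ 3) +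
        (y ^ 2 + x ^ 2) + 2 * x * y) := by ring
  rw [← sub_nonneg, e]
  refine mul_nonneg (sub_nonneg.2 hxy) ?_
  have hx1 := hxy.trans hy
  have a1 := mul_nonneg hx (sub_nonneg.2 hx1)
  have a2 := mul_nonneg hy0 (sub_nonneg.2 hy)
  have a3 := mul_nonneg (sq_nonneg x) (sub_nonneg.2 hx1)
  have a4 := mul_nonneg (sq_nonneg y) (sub_nonneg.2 hy)
  have a5 := mul_nonneg (mul_nonneg hx hy0) (sub_nonneg.2 hx1)
  have a6 := mul_nonneg (mul_nonneg hx hy0) (sub_nonneg.2 hy)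
  nlinarith

lemma ramp_nonneg {y : ℝ} (hy : y ≤ 1) : 0 ≤ ramp y := by
  rcases le_total y 0 with h | h
  · rw [ramp_of_nonpos h]
  · rw [← ramp_of_nonpos (le_refl (0 : ℝ))]
    exact ramp_mono le_rfl h hy

lemma ramp_le_one {y : ℝ} (hy : y ≤ 1) : ramp y ≤ 1 := by
  rcases le_total y 0 with h | h
  · rw [ramp_of_nonpos h]; exact zero_le_one
  · refine (ramp_mono h hy le_rfl).trans ?_
    norm_num [ramp]

/-- The radial cutoff function `Φ(a² / ‖x‖²)`, `Φ u = (1 - u) ^ 3 * (1 + 2 * u)` for `‖x‖ ≥ a`. -/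
noncomputable def radialCutoff (a : ℝ) (x : Plane) : ℝ :=
  if ‖x‖ < a then 0 else ramp (1 - a ^ 2 / ‖x‖ ^ 2)

/-- The factor `t` in `∇ (radialCutoff a) x = t x`. -/
noncomputable def radialSlope (a : ℝ) (x : Plane) : ℝ :=
  if ‖x‖ < a then 0 else 2 * (a ^ 2 / (‖x‖ ^ 2) ^ 2) * rampDeriv (1 - a ^ 2 / ‖x‖ ^ 2)

section Radial

variable {a : ℝ} {x : Plane}

lemma one_sub_div_nonpos (hx : x ≠ 0) (h : ‖x‖ < a) : 1 - a ^ 2 / ‖x‖ ^ 2 ≤ 0 := by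
  have : 0 < ‖x‖ := norm_pos_iff.2 hx
  rw [sub_nonpos, one_le_div (by positivity)]
  gcongr

lemma radialCutoff_of_ne (hx : x ≠ 0) : radialCutoff a x = ramp (1 - a ^ 2 / ‖x‖ ^ 2) := by
  rw [radialCutoff]
  split_ifs with h
  · rw [ramp_of_nonpos (one_sub_div_nonpos hx h)]
  · rfl

lemma radialSlope_of_ne (hx : x ≠ 0) : radialSlope a x =
    2 * (a ^ 2 / (‖x‖ ^ 2) ^ 2) * rampDeriv (1 - a ^ 2 / ‖x‖ ^ 2) := by
  rw [radialSlope]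
  split_ifs with h
  · rw [rampDeriv_of_nonpos (one_sub_div_nonpos hx h), mul_zero]
  · rfl

lemma radialCutoff_of_lt (h : ‖x‖ < a) : radialCutoff a x = 0 := if_pos h

lemma radialSlope_of_lt (h : ‖x‖ < a) : radialSlope a x = 0 := if_pos h

lemma contDiffAt_norm_sq_inv (hx : x ≠ 0) : ContDiffAt ℝ 1 (fun y : Plane => a ^ 2 / ‖y‖ ^ 2) x :=
  contDiffAt_const.div (contDiff_norm_sq ℝ).contDiffAt (by simpa using hx)

lemma contDiffAt_radialCutoff (hx : x ≠ 0) : ContDiffAt ℝ 1 (radialCutoff a) x := by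
  refine ContDiffAt.congr_of_eventuallyEq (f := fun y => ramp (1 - a ^ 2 / ‖y‖ ^ 2)) ?_ ?_
  · exact contDiff_ramp.contDiffAt.comp x (contDiffAt_const.sub (contDiffAt_norm_sq_inv hx))
  · filter_upwards [isOpen_ne.mem_nhds hx] with y hy
    exact radialCutoff_of_ne hy

lemma contDiffAt_radialSlope (hx : x ≠ 0) : ContDiffAt ℝ 1 (radialSlope a) x := by
  refine ContDiffAt.congr_of_eventuallyEq (f := fun y => 2 * (a ^ 2 / (‖y‖ ^ 2) ^ 2) *
    rampDeriv (1 - a ^ 2 / ‖y‖ ^ 2)) ?_ ?_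
  · refine ContDiffAt.mul (contDiffAt_const.mul ?_)
      (contDiff_rampDeriv.contDiffAt.comp x (contDiffAt_const.sub (contDiffAt_norm_sq_inv hx)))
    exact contDiffAt_const.div ((contDiff_norm_sq ℝ).pow 2).contDiffAt (by simpa using hx)
  · filter_upwards [isOpen_ne.mem_nhds hx] with y hy
    exact radialSlope_of_ne hy

lemma hasFDerivAt_norm_sq_div (hx : x ≠ 0) : HasFDerivAt (fun y : Plane => 1 - a ^ 2 / ‖y‖ ^ 2)
    ((2 * (a ^ 2 / (‖x‖ ^ 2) ^ 2)) • innerSL ℝ x) x := by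
  have h1 : HasFDerivAt (fun y : Plane => ‖y‖ ^ 2) (2 • innerSL ℝ x) x :=
    (hasStrictFDerivAt_norm_sq x).hasFDerivAt
  have hne : ‖x‖ ^ 2 ≠ 0 := by simpa using hx
  have h2 : HasDerivAt (fun s : ℝ => 1 - a ^ 2 / s) (a ^ 2 / (‖x‖ ^ 2) ^ 2) (‖x‖ ^ 2) := by
    have := ((hasDerivAt_inv hne).const_mul (a ^ 2)).const_sub 1
    refine this.congr_deriv ?_
    field_simp
  refine (h2.comp_hasFDerivAt x h1).congr_fderiv ?_
  ext v
  simp only [_root_.smul_apply, smul_eq_mul, nsmul_eq_mul]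
  push_cast
  ring

lemma hasFDerivAt_radialCutoff (hx : x ≠ 0) :
    HasFDerivAt (radialCutoff a) (radialSlope a x • innerSL ℝ x) x := by
  have h := (hasDerivAt_ramp (1 - a ^ 2 / ‖x‖ ^ 2)).comp_hasFDerivAt x
    (hasFDerivAt_norm_sq_div (a := a) hx)
  have h2 := h.congr_of_eventuallyEq (f₁ := radialCutoff a) (by
    filter_upwards [isOpen_ne.mem_nhds hx] with y hy
    exact radialCutoff_of_ne hy)
  refine h2.congr_fderiv ?_
  rw [radialSlope_of_ne hx, smul_smul]
  congr 1
  ring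

lemma exists_hasFDerivAt_radialSlope (hx : x ≠ 0) :
    ∃ c : ℝ, HasFDerivAt (radialSlope a) (c • innerSL ℝ x) x := by
  have h1 : HasFDerivAt (fun y : Plane => ‖y‖ ^ 2) (2 • innerSL ℝ x) x :=
    (hasStrictFDerivAt_norm_sq x).hasFDerivAt
  have hne : ‖x‖ ^ 2 ≠ 0 := by simpa using hx
  have hd : DifferentiableAt ℝ (fun s : ℝ => 2 * (a ^ 2 / s ^ 2) * rampDeriv (1 - a ^ 2 / s))
      (‖x‖ ^ 2) := by
    have := contDiff_rampDeriv.differentiable (by simp)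
    refine DifferentiableAt.mul ?_ (this.differentiableAt.comp _ ?_)
    · exact (differentiableAt_const _).mul ((differentiableAt_const _).div
        (differentiableAt_id.pow 2) (pow_ne_zero 2 hne))
    · exact (differentiableAt_const _).sub ((differentiableAt_const _).div differentiableAt_id hne)
  have h3 := hd.hasDerivAt.comp_hasFDerivAt x h1
  refine ⟨deriv (fun s : ℝ => 2 * (a ^ 2 / s ^ 2) * rampDeriv (1 - a ^ 2 / s)) (‖x‖ ^ 2) * 2, ?_⟩
  have h4 := h3.congr_of_eventuallyEq (f₁ := radialSlope a) (by
    filter_upwards [isOpen_ne.mem_nhds hx] with y hy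
    exact radialSlope_of_ne hy)
  refine h4.congr_fderiv ?_
  ext v
  simp only [_root_.smul_apply, smul_eq_mul, nsmul_eq_mul]
  push_cast
  ring

/-- The `L²` norm over the plane of the tensor field `radialSlope a x (Jx ⊗ Jx)`. -/
lemma integral_radialSlope_sq (ha : 0 < a) :
    Integrable (fun x : Plane => (radialSlope a x * ‖x‖ ^ 2) ^ 2) ∧
    ∫ x : Plane, (radialSlope a x * ‖x‖ ^ 2) ^ 2 = 188 * Real.pi / 35 * a ^ 2 := by
  set f : ℝ → ℝ := fun r => if r < a then 0 else
    (2 * (a ^ 2 / r ^ 2) * rampDeriv (1 - a ^ 2 / r ^ 2)) ^ 2 with hf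
  have hfx : ∀ x : Plane, (radialSlope a x * ‖x‖ ^ 2) ^ 2 = f ‖x‖ := by
    intro x
    rw [radialSlope]
    simp only [hf]
    split_ifs with h
    · simp
    · have : 0 < ‖x‖ := ha.trans_le (not_lt.1 h)
      congr 1
      field_simp
  have hdim : Module.finrank ℝ Plane = 2 := by simp
  set g : ℝ → ℝ := fun r => -(2 * a ^ 2) * ((a ^ 2 / r ^ 2) + 6 * (a ^ 2 / r ^ 2) ^ 2 +
    2 * (a ^ 2 / r ^ 2) ^ 3 - 41 * (a ^ 2 / r ^ 2) ^ 4 + 321 / 5 * (a ^ 2 / r ^ 2) ^ 5 -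
    40 * (a ^ 2 / r ^ 2) ^ 6 + 64 / 7 * (a ^ 2 / r ^ 2) ^ 7) with hg
  have hderiv : ∀ r ∈ Ici a, HasDerivAt g
      (r * (2 * (a ^ 2 / r ^ 2) * rampDeriv (1 - a ^ 2 / r ^ 2)) ^ 2) r := by
    intro r hr
    have hr0 : 0 < r := ha.trans_le hr
    have h1 : HasDerivAt (fun r : ℝ => a ^ 2 / r ^ 2) (-(2 * a ^ 2 / r ^ 3)) r := by
      have := (((hasDerivAt_pow 2 r).inv (by positivity)).const_mul (a ^ 2))
      refine (this.congr_deriv ?_)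
      field_simp
      simp
      ring
    set u := a ^ 2 / r ^ 2 with hu
    have hu1 : u ≤ 1 := by
      rw [hu, div_le_one (by positivity)]
      have : a ≤ r := hr
      gcongr
    have h2 := (((((((h1.add ((h1.pow 2).const_mul 6)).add ((h1.pow 3).const_mul 2)).sub
      ((h1.pow 4).const_mul 41)).add ((h1.pow 5).const_mul (321 / 5))).sub
      ((h1.pow 6).const_mul 40)).add ((h1.pow 7).const_mul (64 / 7))).const_mul (-(2 * a ^ 2)))
    refine h2.congr_deriv ?_
    have e : -(2 * a ^ 2 / r ^ 3) * -(2 * a ^ 2) = r * (2 * u) ^ 2 := by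
      rw [hu]; field_simp
    rw [rampDeriv, max_eq_left (by linarith)]
    simp only [← hu]
    push_cast
    linear_combination (1 + 12 * u + 6 * u ^ 2 - 164 * u ^ 3 + 321 * u ^ 4 - 240 * u ^ 5 +
      64 * u ^ 6) * e
  have hlim : Tendsto g atTop (𝓝 0) := by
    have h1 : Tendsto (fun r : ℝ => a ^ 2 / r ^ 2) atTop (𝓝 0) :=
      Tendsto.const_div_atTop (tendsto_pow_atTop two_ne_zero) _
    have := (((((((h1.add ((h1.pow 2).const_mul 6)).add ((h1.pow 3).const_mul 2)).sub
      ((h1.pow 4).const_mul 41)).add ((h1.pow 5).const_mul (321 / 5))).sub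
      ((h1.pow 6).const_mul 40)).add ((h1.pow 7).const_mul (64 / 7))).const_mul (-(2 * a ^ 2)))
    simpa [hg] using this
  have hnn : ∀ r ∈ Ioi a, 0 ≤ r * (2 * (a ^ 2 / r ^ 2) * rampDeriv (1 - a ^ 2 / r ^ 2)) ^ 2 :=
    fun r hr => mul_nonneg (ha.trans hr).le (sq_nonneg _)
  have hI := integral_Ioi_of_hasDerivAt_of_nonneg' hderiv hnn hlim
  have hIi := integrableOn_Ioi_deriv_of_nonneg' hderiv hnn hlim
  have hga : g a = -(94 / 35 * a ^ 2) := by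
    simp only [hg]
    rw [div_self (by positivity)]
    ring
  have hind : ∀ r ∈ Ioi (0 : ℝ), r ^ (2 - 1) • f r = (Ici a).indicator (fun r =>
      r * (2 * (a ^ 2 / r ^ 2) * rampDeriv (1 - a ^ 2 / r ^ 2)) ^ 2) r := by
    intro r _
    simp only [hf, smul_eq_mul, Nat.add_one_sub_one, pow_one]
    by_cases h : r < a
    · rw [if_pos h, indicator_of_notMem (by simpa using h), mul_zero]
    · rw [if_neg h, indicator_of_mem (by simpa using h)]
  constructor
  · simp_rw [hfx]
    rw [integrable_fun_norm_addHaar volume (f := f), hdim, integrableOn_congr_fun hind measurableSet_Ioi]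
    refine Integrable.integrableOn ?_
    rw [integrable_indicator_iff measurableSet_Ici, integrableOn_Ici_iff_integrableOn_Ioi]
    exact hIi
  · simp_rw [hfx]
    rw [integral_fun_norm_addHaar volume f, hdim, setIntegral_congr_fun measurableSet_Ioi hind,
      setIntegral_indicator measurableSet_Ici]
    have : Ioi (0 : ℝ) ∩ Ici a = Ici a := inter_eq_right.2 fun r hr => ha.trans_le hr
    rw [this, integral_Ici_eq_integral_Ioi, hI, hga, measureReal_def,
      EuclideanSpace.volume_ball_fin_two]
    simp [Real.pi_pos.le]
    ring

end Radial

lemma measurable_realSign : Measurable Real.sign := by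
  unfold Real.sign
  exact Measurable.ite measurableSet_Iio measurable_const
    (Measurable.ite measurableSet_Ioi measurable_const measurable_const)

lemma abs_realSign_le_one (r : ℝ) : |Real.sign r| ≤ 1 := by
  rcases Real.sign_apply_eq r with h | h | h <;> simp [h]

lemma measurable_radialCutoff (a : ℝ) : Measurable (radialCutoff a) := by
  unfold radialCutoff
  refine Measurable.ite (measurableSet_lt measurable_norm measurable_const) measurable_const ?_
  exact contDiff_ramp.continuous.measurable.comp
    (measurable_const.sub (measurable_const.div (measurable_norm.pow_const 2)))

lemma measurable_radialSlope (a : ℝ) : Measurable (radialSlope a) := by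
  unfold radialSlope
  refine Measurable.ite (measurableSet_lt measurable_norm measurable_const) measurable_const ?_
  exact (measurable_const.mul (measurable_const.div ((measurable_norm.pow_const 2).pow_const 2))).mul
    (contDiff_rampDeriv.continuous.measurable.comp
      (measurable_const.sub (measurable_const.div (measurable_norm.pow_const 2))))

lemma radialCutoff_nonneg (a : ℝ) (x : Plane) : 0 ≤ radialCutoff a x := by
  rw [radialCutoff]
  split_ifs
  · exact le_rfl
  · exact ramp_nonneg (sub_le_self _ (by positivity))

lemma radialCutoff_le_one (a : ℝ) (x : Plane) : radialCutoff a x ≤ 1 := by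
  rw [radialCutoff]
  split_ifs
  · exact zero_le_one
  · exact ramp_le_one (sub_le_self _ (by positivity))

/-- The odd version of `radialCutoff`. -/
noncomputable def oddCutoff (a : ℝ) (x : Plane) : ℝ := Real.sign (x 0) * radialCutoff a x

lemma measurable_oddCutoff (a : ℝ) : Measurable (oddCutoff a) :=
  (measurable_realSign.comp (by fun_prop)).mul (measurable_radialCutoff a)

lemma abs_oddCutoff_le_one (a : ℝ) (x : Plane) : |oddCutoff a x| ≤ 1 := by
  rw [oddCutoff, abs_mul, abs_of_nonneg (radialCutoff_nonneg a x)]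
  exact mul_le_one₀ (abs_realSign_le_one _) (radialCutoff_nonneg a x) (radialCutoff_le_one a x)

lemma plane_norm_sq (x : Plane) : ‖x‖ ^ 2 = x 0 ^ 2 + x 1 ^ 2 := by
  simp [EuclideanSpace.norm_sq_eq]

/-- The reflection in the vertical axis. -/
noncomputable def planeReflection : Plane ≃ₗᵢ[ℝ] Plane :=
  LinearIsometryEquiv.piLpCongrRight 2
    ![LinearIsometryEquiv.neg ℝ, LinearIsometryEquiv.refl ℝ ℝ]

@[simp] lemma planeReflection_zero (x : Plane) : planeReflection x 0 = -x 0 := by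
  simp [planeReflection]

@[simp] lemma planeReflection_one (x : Plane) : planeReflection x 1 = x 1 := by
  simp [planeReflection]

lemma planeReflection_eq (x : Plane) : planeReflection x = !₂[-x 0, x 1] := by
  ext i; fin_cases i <;> simp

lemma planeReflection_planeReflection (x : Plane) : planeReflection (planeReflection x) = x := by
  ext i; fin_cases i <;> simp

lemma oddCutoff_planeReflection (a : ℝ) (x : Plane) :
    oddCutoff a (planeReflection x) = -oddCutoff a x := by
  simp only [oddCutoff, radialCutoff, planeReflection_zero, Real.sign_neg,
    LinearIsometryEquiv.norm_map, neg_mul]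

lemma integral_oddCutoff {Ω : Set Plane} (hsym : ∀ x ∈ Ω, planeReflection x ∈ Ω) (a : ℝ) :
    ∫ x in Ω, oddCutoff a x = 0 := by
  have hpre : planeReflection ⁻¹' Ω = Ω := by
    ext x
    refine ⟨fun h => ?_, fun h => hsym x h⟩
    rw [← planeReflection_planeReflection x]
    exact hsym _ h
  have hmp : MeasurePreserving planeReflection volume volume :=
    planeReflection.measurePreserving
  have h := hmp.setIntegral_preimage_emb
    planeReflection.toHomeomorph.measurableEmbedding (oddCutoff a) Ω
  rw [hpre] at h
  simp_rw [oddCutoff_planeReflection] at h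
  rw [integral_neg] at h
  linarith

lemma memL2MeanZero_oddCutoff {Ω : Set Plane} (hb : Bornology.IsBounded Ω)
    (hsym : ∀ x ∈ Ω, planeReflection x ∈ Ω) (a : ℝ) : MemL2MeanZero Ω (oddCutoff a) := by
  refine ⟨?_, integral_oddCutoff hsym a⟩
  have : IsFiniteMeasure (volume.restrict Ω) := ⟨by simpa using hb.measure_lt_top⟩
  exact MemLp.of_bound (measurable_oddCutoff a).aestronglyMeasurable 1
    (Eventually.of_forall fun x => abs_oddCutoff_le_one a x)

lemma integral_mul_le_sqrt_mul_sqrt {α : Type*} [MeasurableSpace α] {μ : Measure α} {f g : α → ℝ}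
    (hf0 : ∀ x, 0 ≤ f x) (hg0 : ∀ x, 0 ≤ g x) (hf : MemLp f 2 μ) (hg : MemLp g 2 μ) :
    ∫ x, f x * g x ∂μ ≤ √(∫ x, f x ^ 2 ∂μ) * √(∫ x, g x ^ 2 ∂μ) := by
  have h := integral_mul_le_Lp_mul_Lq_of_nonneg (p := 2) (q := 2) (μ := μ) (f := f) (g := g)
    Real.HolderConjugate.two_two (Eventually.of_forall hf0) (Eventually.of_forall hg0)
    (by simpa using hf) (by simpa using hg)
  simpa [Real.sqrt_eq_rpow] using h

section Neck

variable {a : ℝ} {v : Fin 2 → Plane → ℝ}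

/-- The angular component of `radialSlope a • v` times `‖x‖`. -/
noncomputable def angularPart (a : ℝ) (v : Fin 2 → Plane → ℝ) (x : Plane) : ℝ :=
  radialSlope a x * (x 0 * v 1 x - x 1 * v 0 x)

/-- The field `radialCutoff a • v + angularPart a v • J x`, where `J x = (-x 1, x 0)`. -/
noncomputable def twistedField (a : ℝ) (v : Fin 2 → Plane → ℝ) : Fin 2 → Plane → ℝ :=
  ![fun x => radialCutoff a x * v 0 x - x 1 * angularPart a v x,
    fun x => radialCutoff a x * v 1 x + x 0 * angularPart a v x]

lemma contDiff_coord (i : Fin 2) : ContDiff ℝ 1 (fun x : Plane => x i) :=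
  (EuclideanSpace.proj (𝕜 := ℝ) i).contDiff

lemma hasFDerivAt_coord (i : Fin 2) (x : Plane) :
    HasFDerivAt (fun x : Plane => x i) (EuclideanSpace.proj (𝕜 := ℝ) i : Plane →L[ℝ] ℝ) x :=
  (EuclideanSpace.proj (𝕜 := ℝ) i : Plane →L[ℝ] ℝ).hasFDerivAt

lemma contDiffAt_twistedField (hv : ∀ k, ContDiff ℝ 1 (v k)) {x : Plane} (hx : x ≠ 0) (k : Fin 2) :
    ContDiffAt ℝ 1 (twistedField a v k) x := by
  have hang : ContDiffAt ℝ 1 (angularPart a v) x :=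
    (contDiffAt_radialSlope hx).mul (((contDiff_coord 0).contDiffAt.mul (hv 1).contDiffAt).sub
      ((contDiff_coord 1).contDiffAt.mul (hv 0).contDiffAt))
  fin_cases k
  · exact ((contDiffAt_radialCutoff hx).mul (hv 0).contDiffAt).sub
      ((contDiff_coord 1).contDiffAt.mul hang)
  · exact ((contDiffAt_radialCutoff hx).mul (hv 1).contDiffAt).add
      ((contDiff_coord 0).contDiffAt.mul hang)

lemma twistedField_eq_zero_of_lt {x : Plane} (hx : ‖x‖ < a) (k : Fin 2) :
    twistedField a v k x = 0 := by
  fin_cases k <;> simp [twistedField, angularPart, radialCutoff_of_lt hx, radialSlope_of_lt hx]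

lemma twistedField_eq_zero {x : Plane} (hx : ∀ k, v k x = 0) (k : Fin 2) :
    twistedField a v k x = 0 := by
  fin_cases k <;> simp [twistedField, angularPart, hx]

/-- The divergence of `twistedField`. -/
lemma div_twistedField (hv : ∀ k, ContDiff ℝ 1 (v k)) {x : Plane} (hx : x ≠ 0) :
    fderiv ℝ (twistedField a v 0) x (stdVec 0) + fderiv ℝ (twistedField a v 1) x (stdVec 1) =
      radialCutoff a x * (fderiv ℝ (v 0) x (stdVec 0) + fderiv ℝ (v 1) x (stdVec 1)) +
      radialSlope a x * (x 1 ^ 2 * fderiv ℝ (v 0) x (stdVec 0) -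
        x 0 * x 1 * fderiv ℝ (v 0) x (stdVec 1) - x 0 * x 1 * fderiv ℝ (v 1) x (stdVec 0) +
        x 0 ^ 2 * fderiv ℝ (v 1) x (stdVec 1)) := by
  have hd := fun k => ((hv k).differentiable one_ne_zero x).hasFDerivAt
  obtain ⟨c, hc⟩ := exists_hasFDerivAt_radialSlope (a := a) hx
  have hq := hasFDerivAt_radialCutoff (a := a) hx
  have hang := hc.mul (((hasFDerivAt_coord 0 x).mul (hd 1)).sub ((hasFDerivAt_coord 1 x).mul (hd 0)))
  have h0 := (hq.mul (hd 0)).sub ((hasFDerivAt_coord 1 x).mul hang)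
  have h1 := (hq.mul (hd 1)).add ((hasFDerivAt_coord 0 x).mul hang)
  have e0 : fderiv ℝ (twistedField a v 0) x = _ := h0.fderiv
  have e1 : fderiv ℝ (twistedField a v 1) x = _ := h1.fderiv
  have i0 : inner ℝ x (stdVec 0) = x 0 := by simp [stdVec, EuclideanSpace.inner_single_right]
  have i1 : inner ℝ x (stdVec 1) = x 1 := by simp [stdVec, EuclideanSpace.inner_single_right]
  have s00 : (stdVec 0 : Plane) 0 = 1 := by simp [stdVec]
  have s01 : (stdVec 0 : Plane) 1 = 0 := by simp [stdVec]
  have s10 : (stdVec 1 : Plane) 0 = 0 := by simp [stdVec]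
  have s11 : (stdVec 1 : Plane) 1 = 1 := by simp [stdVec]
  rw [e0, e1]
  simp only [_root_.sub_apply, _root_.add_apply,
    _root_.smul_apply, smul_eq_mul, innerSL_apply_apply, PiLp.proj_apply, i0, i1, s00,
    s01, s10, s11, Pi.mul_apply, Pi.sub_apply]
  ring

variable {Ω : Set Plane}

/-- `sgn (x 0) • twistedField`. -/
noncomputable def oddTwistedField (a : ℝ) (v : Fin 2 → Plane → ℝ) (k : Fin 2) (x : Plane) : ℝ :=
  Real.sign (x 0) * twistedField a v k x

lemma eventually_realSign_eq {x : Plane} (hx : x 0 ≠ 0) :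
    ∀ᶠ y : Plane in 𝓝 x, Real.sign (y 0) = Real.sign (x 0) := by
  have hc : ContinuousAt (fun y : Plane => y 0) x := by fun_prop
  rcases lt_or_gt_of_ne hx with h | h
  · filter_upwards [hc.eventually (gt_mem_nhds h)] with y hy
    rw [Real.sign_of_neg hy, Real.sign_of_neg h]
  · filter_upwards [hc.eventually (lt_mem_nhds h)] with y hy
    rw [Real.sign_of_pos hy, Real.sign_of_pos h]

lemma contDiff_oddTwistedField (hneck : ∀ x ∈ Ω, x 0 = 0 → |x 1| < a)
    (hv : ∀ k, IsTestFunction Ω (v k)) (k : Fin 2) : ContDiff ℝ 1 (oddTwistedField a v k) := by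
  rw [contDiff_iff_contDiffAt]
  intro x
  have hv1 := fun k => (hv k).contDiff_one
  by_cases hx : x 0 = 0
  · refine (contDiffAt_const (c := (0 : ℝ))).congr_of_eventuallyEq ?_
    by_cases hs : ∃ k, x ∈ tsupport (v k)
    · obtain ⟨k, hk⟩ := hs
      have h := hneck x ((hv k).support_subset hk) hx
      have hn : ‖x‖ < a := by
        have h2 := plane_norm_sq x
        rw [hx] at h2
        have : ‖x‖ ^ 2 < a ^ 2 := by
          rw [h2, ← sq_abs (x 1)]
          have := abs_nonneg (x 1)
          nlinarith
        exact lt_of_pow_lt_pow_left₀ 2 ((abs_nonneg _).trans h.le) this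
      filter_upwards [continuous_norm.continuousAt.eventually (gt_mem_nhds hn)] with y hy
      rw [oddTwistedField, twistedField_eq_zero_of_lt hy, mul_zero]
    · push Not at hs
      have h0 := fun k => notMem_tsupport_iff_eventuallyEq.1 (hs k)
      filter_upwards [h0 0, h0 1] with y hy0 hy1
      rw [oddTwistedField, twistedField_eq_zero, mul_zero]
      intro k
      fin_cases k
      exacts [hy0, hy1]
  · have hx0 : x ≠ 0 := fun h => hx (by simp [h])
    refine ((contDiffAt_const (c := Real.sign (x 0))).mul
      (contDiffAt_twistedField (a := a) hv1 hx0 k)).congr_of_eventuallyEq ?_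
    filter_upwards [eventually_realSign_eq hx] with y hy
    rw [oddTwistedField, hy]

lemma hasCompactSupport_oddTwistedField (hv : ∀ k, IsTestFunction Ω (v k)) (k : Fin 2) :
    HasCompactSupport (oddTwistedField a v k) := by
  refine HasCompactSupport.intro
    ((hv 0).compactSupport.isCompact.union (hv 1).compactSupport.isCompact) fun x hx => ?_
  rw [oddTwistedField, twistedField_eq_zero, mul_zero]
  intro k
  rw [mem_union, not_or] at hx
  fin_cases k
  exacts [image_eq_zero_of_notMem_tsupport hx.1, image_eq_zero_of_notMem_tsupport hx.2]

lemma fderiv_oddTwistedField {x : Plane} (hx : x 0 ≠ 0) (hv : ∀ k, ContDiff ℝ 1 (v k)) (k : Fin 2) :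
    fderiv ℝ (oddTwistedField a v k) x = Real.sign (x 0) • fderiv ℝ (twistedField a v k) x := by
  have hx0 : x ≠ 0 := fun h => hx (by simp [h])
  have h := ((contDiffAt_twistedField (a := a) hv hx0 k).differentiableAt one_ne_zero)
  rw [← fderiv_const_mul h]
  apply Filter.EventuallyEq.fderiv_eq
  filter_upwards [eventually_realSign_eq hx] with y hy
  rw [oddTwistedField, hy]

lemma ae_coord_ne_zero : ∀ᵐ x : Plane, x 0 ≠ 0 := by
  have h : volume ((LinearMap.ker (EuclideanSpace.proj (𝕜 := ℝ) (0 : Fin 2) :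
      Plane →L[ℝ] ℝ).toLinearMap : Submodule ℝ Plane) : Set Plane) = 0 := by
    refine Measure.addHaar_submodule volume _ fun h => ?_
    have : (stdVec 0 : Plane) ∈ (⊤ : Submodule ℝ Plane) := trivial
    rw [← h] at this
    simp [stdVec] at this
  filter_upwards [measure_eq_zero_iff_ae_notMem.1 h] with x hx h0
  exact hx (by simpa using h0)

lemma divPairing_oddCutoff_le (ha : 0 < a) (hneck : ∀ x ∈ Ω, x 0 = 0 → |x 1| < a)
    (hv : ∀ k, IsTestFunction Ω (v k)) :
    divPairing Ω (fun k => gradient (v k)) (oddCutoff a) ≤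
      √(188 * Real.pi / 35 * a ^ 2) * seminormH1 Ω (fun k => gradient (v k)) := by
  have hv1 := fun k => (hv k).contDiff_one
  obtain ⟨hTi, hTe⟩ := integral_radialSlope_sq ha
  set D : Plane → ℝ := fun x => fderiv ℝ (oddTwistedField a v 0) x (stdVec 0) +
    fderiv ℝ (oddTwistedField a v 1) x (stdVec 1) with hD
  set P : Plane → ℝ := fun x => (∑ k, gradient (v k) x k) * oddCutoff a x with hP
  set f : Plane → ℝ := fun x => |radialSlope a x * ‖x‖ ^ 2| with hf
  set g : Plane → ℝ := fun x => √(∑ k : Fin 2, ∑ j : Fin 2, gradient (v k) x j ^ 2) with hg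
  have hgc : Continuous g := by
    have := fun k => (hv k).continuous_gradient
    simp only [hg]
    fun_prop
  have hg0 : ∀ x, (∀ k, x ∉ tsupport (v k)) → ∀ k, gradient (v k) x = 0 := by
    intro x hx k
    ext j
    rw [gradient_apply_eq]
    have := notMem_tsupport_iff_eventuallyEq.1 (hx k)
    rw [this.fderiv_eq]
    simp
  have hcpt := (hv 0).compactSupport.isCompact.union (hv 1).compactSupport.isCompact
  have hnot : ∀ x, x ∉ tsupport (v 0) ∪ tsupport (v 1) → ∀ k, gradient (v k) x = 0 := by
    intro x hx
    rw [mem_union, not_or] at hx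
    refine hg0 x fun k => ?_
    fin_cases k
    exacts [hx.1, hx.2]
  have hgs : HasCompactSupport g := by
    refine HasCompactSupport.intro hcpt fun x hx => ?_
    simp [hg, hnot x hx]
  have hgm : MemLp g 2 volume := hgc.memLp_of_hasCompactSupport hgs
  have hfm : MemLp f 2 volume := by
    rw [memLp_two_iff_integrable_sq]
    · simpa only [hf, sq_abs] using hTi
    · exact (((measurable_radialSlope a).mul (measurable_norm.pow_const 2)).abs).aestronglyMeasurable
  have hPi : Integrable P := by
    have hc : Continuous fun x => ∑ k, gradient (v k) x k := by
      have := fun k => (hv k).continuous_gradient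
      fun_prop
    refine Integrable.mul_bdd (c := 1) (hc.integrable_of_hasCompactSupport
      (HasCompactSupport.intro hcpt fun x hx => ?_)) (measurable_oddCutoff a).aestronglyMeasurable
      (Eventually.of_forall fun x => abs_oddCutoff_le_one a x)
    simp [hnot x hx]
  have hDi : ∀ k, Integrable fun x => fderiv ℝ (oddTwistedField a v k) x (stdVec k) := by
    intro k
    refine Continuous.integrable_of_hasCompactSupport ?_ ?_
    · exact ((contDiff_oddTwistedField hneck hv k).continuous_fderiv one_ne_zero).clm_apply
        continuous_const
    · exact (hasCompactSupport_oddTwistedField hv k).fderiv_apply ℝ _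
  have hD0 : ∫ x, D x = 0 := by
    rw [hD, integral_add (hDi 0) (hDi 1),
      integral_fderiv_eq_zero (contDiff_oddTwistedField hneck hv 0)
        (hasCompactSupport_oddTwistedField hv 0),
      integral_fderiv_eq_zero (contDiff_oddTwistedField hneck hv 1)
        (hasCompactSupport_oddTwistedField hv 1), add_zero]
  have hDint : Integrable D := (hDi 0).add (hDi 1)
  have hle : ∀ᵐ x, P x - D x ≤ f x * g x := by
    filter_upwards [ae_coord_ne_zero] with x hx
    have hx0 : x ≠ 0 := fun h => hx (by simp [h])
    have e := div_twistedField (a := a) hv1 hx0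
    simp only [hD, hP, fderiv_oddTwistedField hx hv1, hf, hg]
    simp only [Fin.sum_univ_two, gradient_apply_eq, _root_.smul_apply, smul_eq_mul, oddCutoff]
    set d00 := fderiv ℝ (v 0) x (stdVec 0)
    set d01 := fderiv ℝ (v 0) x (stdVec 1)
    set d10 := fderiv ℝ (v 1) x (stdVec 0)
    set d11 := fderiv ℝ (v 1) x (stdVec 1)
    set E := x 1 ^ 2 * d00 - x 0 * x 1 * d01 - x 0 * x 1 * d10 + x 0 ^ 2 * d11 with hE
    have e2 : (d00 + d11) * (Real.sign (x 0) * radialCutoff a x) -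
        (Real.sign (x 0) * fderiv ℝ (twistedField a v 0) x (stdVec 0) +
          Real.sign (x 0) * fderiv ℝ (twistedField a v 1) x (stdVec 1)) =
        -(Real.sign (x 0) * radialSlope a x * E) := by
      linear_combination (-Real.sign (x 0)) * e
    rw [e2]
    refine (neg_le_abs _).trans ?_
    rw [abs_mul, abs_mul, abs_mul]
    have hEle : |E| ≤ |‖x‖ ^ 2| * √(d00 ^ 2 + d01 ^ 2 + (d10 ^ 2 + d11 ^ 2)) := by
      rw [abs_of_nonneg (sq_nonneg ‖x‖), plane_norm_sq]
      refine Real.abs_le_sqrt (y := (x 0 ^ 2 + x 1 ^ 2) ^ 2 *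
        (d00 ^ 2 + d01 ^ 2 + (d10 ^ 2 + d11 ^ 2))) ?_ |>.trans ?_
      · rw [hE, ← sub_nonneg]
        have : (x 0 ^ 2 + x 1 ^ 2) ^ 2 * (d00 ^ 2 + d01 ^ 2 + (d10 ^ 2 + d11 ^ 2)) -
            (x 1 ^ 2 * d00 - x 0 * x 1 * d01 - x 0 * x 1 * d10 + x 0 ^ 2 * d11) ^ 2 =
            (x 1 ^ 2 * d01 + x 0 * x 1 * d00) ^ 2 + (x 1 ^ 2 * d10 + x 0 * x 1 * d00) ^ 2 +
            (x 1 ^ 2 * d11 - x 0 ^ 2 * d00) ^ 2 + (x 0 * x 1 * d01 - x 0 * x 1 * d10) ^ 2 +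
            (x 0 * x 1 * d11 + x 0 ^ 2 * d01) ^ 2 + (x 0 * x 1 * d11 + x 0 ^ 2 * d10) ^ 2 := by
          ring
        rw [this]
        positivity
      · rw [Real.sqrt_mul (sq_nonneg _), Real.sqrt_sq (by positivity)]
    calc |Real.sign (x 0)| * |radialSlope a x| * |E| ≤ 1 * |radialSlope a x| *
          (|‖x‖ ^ 2| * √(d00 ^ 2 + d01 ^ 2 + (d10 ^ 2 + d11 ^ 2))) := by
          gcongr
          exact abs_realSign_le_one _
      _ = _ := by ring
  have hdiv : divPairing Ω (fun k => gradient (v k)) (oddCutoff a) = ∫ x, P x := by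
    rw [divPairing]
    refine setIntegral_eq_integral_of_forall_compl_eq_zero fun x hx => ?_
    have : x ∉ tsupport (v 0) ∪ tsupport (v 1) := fun h =>
      hx (h.elim (fun h => (hv 0).support_subset h) (fun h => (hv 1).support_subset h))
    simp [hnot x this]
  have hsem : seminormH1 Ω (fun k => gradient (v k)) = √(∫ x, g x ^ 2) := by
    rw [seminormH1]
    congr 1
    have : ∀ x, g x ^ 2 = ∑ k : Fin 2, ∑ j : Fin 2, gradient (v k) x j ^ 2 := fun x =>
      Real.sq_sqrt (by positivity)
    simp_rw [this]
    refine setIntegral_eq_integral_of_forall_compl_eq_zero fun x hx => ?_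
    have : x ∉ tsupport (v 0) ∪ tsupport (v 1) := fun h =>
      hx (h.elim (fun h => (hv 0).support_subset h) (fun h => (hv 1).support_subset h))
    simp [hnot x this]
  have hfe : ∫ x, f x ^ 2 = 188 * Real.pi / 35 * a ^ 2 := by
    simp only [hf, sq_abs, hTe]
  rw [hdiv, hsem, ← hfe]
  calc ∫ x, P x = ∫ x, (P x - D x) := by rw [integral_sub hPi hDint, hD0, sub_zero]
    _ ≤ ∫ x, f x * g x := integral_mono_ae (hPi.sub hDint) (hfm.integrable_mul hgm) hle
    _ ≤ _ := integral_mul_le_sqrt_mul_sqrt (fun x => abs_nonneg _) (fun x => Real.sqrt_nonneg _)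
      hfm hgm

/-- An upper bound for the inf-sup constant of a symmetric domain that is narrow on the axis of
symmetry. -/
theorem infSupConstant_le_of_neck (hb : Bornology.IsBounded Ω)
    (hsym : ∀ x ∈ Ω, planeReflection x ∈ Ω) (ha : 0 < a)
    (hneck : ∀ x ∈ Ω, x 0 = 0 → |x 1| < a) {A : Set Plane} (hA : MeasurableSet A) (hAΩ : A ⊆ Ω)
    {s : ℝ} (hs0 : 0 < s) (hs1 : s < 1) (hAa : ∀ x ∈ A, a ≤ s * ‖x‖)
    (hvol : 0 < volume.real A) :
    infSupConstant Ω ≤ √(188 * Real.pi / 35 * a ^ 2 /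
      (((1 - s ^ 2) ^ 3 * (1 + 2 * s ^ 2)) ^ 2 * volume.real A)) := by
  set κ := (1 - s ^ 2) ^ 3 * (1 + 2 * s ^ 2) with hκ
  have hs2 : s ^ 2 < 1 := by nlinarith
  have hκ0 : 0 < κ := by
    have : 0 < 1 - s ^ 2 := by linarith
    positivity
  have hq := memL2MeanZero_oddCutoff hb hsym a
  have hlow : ∀ x ∈ A, κ ^ 2 ≤ oddCutoff a x ^ 2 := by
    intro x hx
    have hax := hAa x hx
    have hnx : 0 < ‖x‖ := by
      by_contra! h
      nlinarith [norm_nonneg x]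
    have hx0 : x ≠ 0 := norm_pos_iff.1 hnx
    have hx00 : x 0 ≠ 0 := by
      intro h
      have h1 := hneck x (hAΩ hx) h
      have h2 := plane_norm_sq x
      rw [h, zero_pow two_ne_zero, zero_add, ← sq_abs (x 1)] at h2
      have h3 : ‖x‖ = |x 1| := by
        rwa [pow_left_inj₀ (norm_nonneg _) (abs_nonneg _) two_ne_zero] at h2
      rw [← h3] at h1
      nlinarith
    have hsg : Real.sign (x 0) ^ 2 = 1 := by
      rcases Real.sign_apply_eq_of_ne_zero _ hx00 with h | h <;> simp [h]
    rw [oddCutoff, mul_pow (Real.sign _), hsg, one_mul, radialCutoff_of_ne hx0]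
    refine pow_le_pow_left₀ hκ0.le ?_ 2
    have hr : κ = ramp (1 - s ^ 2) := by
      rw [ramp, max_eq_left (by linarith), hκ]
      ring
    rw [hr]
    have h1 : a ^ 2 / ‖x‖ ^ 2 ≤ s ^ 2 := by
      rw [div_le_iff₀ (by positivity), ← mul_pow]
      gcongr
    exact ramp_mono (by linarith) (by linarith) (sub_le_self _ (by positivity))
  have hint : κ ^ 2 * volume.real A ≤ ∫ x in Ω, oddCutoff a x ^ 2 := by
    have hi : IntegrableOn (fun x => oddCutoff a x ^ 2) Ω := hq.memLp.integrable_sq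
    calc κ ^ 2 * volume.real A = ∫ x in A, κ ^ 2 := by
          rw [setIntegral_const, smul_eq_mul, mul_comm]
      _ ≤ ∫ x in A, oddCutoff a x ^ 2 := by
          refine setIntegral_mono_on ?_ (hi.mono_set hAΩ) hA hlow
          exact integrableOn_const (((measure_mono hAΩ).trans_lt hb.measure_lt_top).ne)
      _ ≤ _ := setIntegral_mono_set hi (Eventually.of_forall fun x => sq_nonneg _)
          hAΩ.eventuallyLE
  have hpos : 0 < κ ^ 2 * volume.real A := by positivity
  have hn0 : 0 < normL2 Ω (oddCutoff a) := Real.sqrt_pos.2 (hpos.trans_le hint)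
  refine (infSupConstant_le hq hn0 (Real.sqrt_nonneg _) fun φ hφ =>
    divPairing_oddCutoff_le ha hneck hφ).trans ?_
  rw [normL2, ← Real.sqrt_div (by positivity)]
  apply Real.sqrt_le_sqrt
  gcongr

end Neck

section TangentCone

variable {Γ : Set Plane} {x v : Plane}

lemma exists_mem_tangentConeAt_inter {ι : Type*} [Finite ι] {C : ι → Set Plane}
    (hΓ : Γ ⊆ ⋃ i, C i) (hv : v ∈ tangentConeAt ℝ Γ x) :
    ∃ i, v ∈ tangentConeAt ℝ (Γ ∩ C i) x := by
  obtain ⟨α, l, hl, c, d, hd0, hds, hcd⟩ := exists_fun_of_mem_tangentConeAt hv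
  by_contra! hcon
  have h : ∀ i, ∀ᶠ n in l, ¬ x + d n ∈ Γ ∩ C i := by
    intro i
    by_contra h
    exact hcon i (mem_tangentConeAt_of_frequently l c d hd0 (not_not.1 fun h2 => h (not_frequently.1 h2)) hcd)
  obtain ⟨n, hn1, hn2⟩ := ((eventually_all.2 h).and hds).exists
  obtain ⟨i, hi⟩ := mem_iUnion.1 (hΓ hn2)
  exact hn1 i ⟨hn2, hi⟩

lemma eq_zero_of_mem_tangentConeAt {F : Plane → ℝ} {ℓ : Plane →L[ℝ] ℝ} (hF : HasFDerivAt F ℓ x)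
    (hΓ : ∀ᶠ y in 𝓝[Γ] x, F y = F x) (hv : v ∈ tangentConeAt ℝ Γ x) : ℓ v = 0 := by
  obtain ⟨u, hu, hus⟩ := mem_nhdsWithin_iff_exists_mem_nhds_inter.1 hΓ
  rw [← tangentConeAt_inter_nhds hu] at hv
  have h := (hF.hasFDerivWithinAt (s := Γ ∩ u)).mapsTo_tangent_cone hv
  have hsub : F '' (Γ ∩ u) ⊆ {F x} := by
    rintro _ ⟨y, ⟨hy1, hy2⟩, rfl⟩
    exact hus ⟨hy2, hy1⟩
  have h2 := tangentConeAt_subset_zero (𝕜 := ℝ) (x := F x) (s := {F x})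
    (by
    intro h
    obtain ⟨y, hy⟩ := (accPt_iff_frequently.1 h).exists
    exact hy.1 hy.2) (tangentConeAt_mono hsub h)
  simpa using h2

lemma clm_apply_eq (ℓ : Plane →L[ℝ] ℝ) (v : Plane) :
    ℓ v = ℓ (stdVec 0) * v 0 + ℓ (stdVec 1) * v 1 := by
  have : v = v 0 • stdVec 0 + v 1 • stdVec 1 := by
    ext i
    fin_cases i <;> simp [stdVec]
  conv_lhs => rw [this]
  simp [mul_comm]

lemma hasTangent_of_curve {γ : ℝ → Plane} (hγ0 : γ 0 = x) (hγ : HasDerivAt γ v 0) (hv : v ≠ 0)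
    (hγΓ : ∀ᶠ t in 𝓝 0, γ t ∈ Γ) {F : Plane → ℝ} {ℓ : Plane →L[ℝ] ℝ} (hF : HasFDerivAt F ℓ x)
    (hℓ : ℓ ≠ 0) (hFΓ : ∀ᶠ y in 𝓝[Γ] x, F y = F x) : HasTangent Γ x v := by
  refine ⟨hv, ?_⟩
  have hsub : ∀ c : ℝ, c • v ∈ tangentConeAt ℝ Γ x := by
    intro c
    have h1 : tangentConeAt ℝ {t | γ t ∈ Γ} 0 = univ := tangentConeAt_of_mem_nhds hγΓ
    have h2 := (hγ.hasFDerivAt.hasFDerivWithinAt (s := {t | γ t ∈ Γ})).mapsTo_tangent_cone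
      (h1 ▸ mem_univ c)
    rw [hγ0] at h2
    refine tangentConeAt_mono ?_ (by simpa using h2)
    rintro _ ⟨t, ht, rfl⟩
    exact ht
  ext w
  constructor
  · intro hw
    have e1 := eq_zero_of_mem_tangentConeAt hF hFΓ hw
    have e2 := eq_zero_of_mem_tangentConeAt hF hFΓ (by simpa using hsub 1)
    rw [clm_apply_eq] at e1 e2
    set p := ℓ (stdVec 0)
    set q := ℓ (stdVec 1)
    have hpq : p ^ 2 + q ^ 2 ≠ 0 := by
      intro h
      have hp : p = 0 := by nlinarith [sq_nonneg p, sq_nonneg q]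
      have hq : q = 0 := by nlinarith [sq_nonneg p, sq_nonneg q]
      apply hℓ
      ext z
      rw [clm_apply_eq]
      change p * _ + q * _ = _
      simp [hp, hq]
    have hdet : w 0 * v 1 - w 1 * v 0 = 0 := by
      have h1 : p * (w 0 * v 1 - w 1 * v 0) = 0 := by linear_combination v 1 * e1 - w 1 * e2
      have h2 : q * (w 0 * v 1 - w 1 * v 0) = 0 := by linear_combination w 0 * e2 - v 0 * e1
      have h3 : (p ^ 2 + q ^ 2) * (w 0 * v 1 - w 1 * v 0) = 0 := by
        linear_combination p * h1 + q * h2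
      exact (mul_eq_zero.1 h3).resolve_left hpq
    have hvn : ‖v‖ ^ 2 ≠ 0 := by simpa using hv
    rw [plane_norm_sq] at hvn
    refine Submodule.mem_span_singleton.2 ⟨(w 0 * v 0 + w 1 * v 1) / (v 0 ^ 2 + v 1 ^ 2), ?_⟩
    ext i
    fin_cases i
    · simp
      field_simp
      linear_combination (-v 1) * hdet
    · simp
      field_simp
      linear_combination (v 0) * hdet
  · intro hw
    obtain ⟨c, rfl⟩ := Submodule.mem_span_singleton.1 hw
    exact hsub c

lemma HasTangent.mem_tangentConeAt (h : HasTangent Γ x v) : v ∈ tangentConeAt ℝ Γ x := by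
  rw [h.2]
  exact Submodule.mem_span_singleton_self v

end TangentCone

section Angle

lemma lineAngle_nonneg (a v : Plane) : 0 ≤ lineAngle a v :=
  le_min (InnerProductGeometry.angle_nonneg a v)
    (sub_nonneg.2 (InnerProductGeometry.angle_le_pi a v))

lemma lineAngle_le (a v : Plane) : lineAngle a v ≤ Real.pi / 2 := by
  rw [lineAngle]
  rcases le_total (InnerProductGeometry.angle a v) (Real.pi / 2) with h | h
  · exact (min_le_left _ _).trans h
  · exact (min_le_right _ _).trans (by linarith)

lemma sin_lineAngle (a v : Plane) : Real.sin (lineAngle a v) =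
    Real.sin (InnerProductGeometry.angle a v) := by
  rw [lineAngle]
  rcases min_choice (InnerProductGeometry.angle a v) (Real.pi - InnerProductGeometry.angle a v)
    with h | h <;> simp [h]

lemma plane_inner (a v : Plane) : inner ℝ a v = a 0 * v 0 + a 1 * v 1 := by
  simp [PiLp.inner_apply, mul_comm]

lemma sin_lineAngle_mul (a v : Plane) :
    Real.sin (lineAngle a v) * (‖a‖ * ‖v‖) = |a 0 * v 1 - a 1 * v 0| := by
  rw [sin_lineAngle, InnerProductGeometry.sin_angle_mul_norm_mul_norm, plane_inner, plane_inner,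
    plane_inner, ← Real.sqrt_sq_eq_abs]
  congr 1
  ring

lemma le_sin_lineAngle {x v : Plane} {ℓ : Plane →L[ℝ] ℝ} (hv : v ≠ 0) (hℓv : ℓ v = 0) {m : ℝ}
    (hm : 0 ≤ m) (hℓ : ℓ x ≠ 0)
    (h : m ^ 2 * (ℓ (stdVec 0) ^ 2 + ℓ (stdVec 1) ^ 2) * ‖x‖ ^ 2 ≤ ℓ x ^ 2) :
    m ≤ Real.sin (lineAngle x v) := by
  have hx : x ≠ 0 := fun h => hℓ (by simp [h])
  have hxn : 0 < ‖x‖ := norm_pos_iff.2 hx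
  have hvn : 0 < ‖v‖ := norm_pos_iff.2 hv
  have e := sin_lineAngle_mul x v
  rw [clm_apply_eq] at hℓv
  rw [clm_apply_eq ℓ x] at hℓ h
  set p := ℓ (stdVec 0)
  set q := ℓ (stdVec 1)
  have hpq : 0 < p ^ 2 + q ^ 2 := by
    by_contra! h0
    apply hℓ
    have hp : p = 0 := by nlinarith [sq_nonneg p, sq_nonneg q]
    have hq : q = 0 := by nlinarith [sq_nonneg p, sq_nonneg q]
    simp [hp, hq]
  have key : (p ^ 2 + q ^ 2) * (x 0 * v 1 - x 1 * v 0) ^ 2 = (p * x 0 + q * x 1) ^ 2 * ‖v‖ ^ 2 := by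
    rw [plane_norm_sq]
    linear_combination (p * v 0 * (-(x 0) ^ 2 + x 1 ^ 2) + q * v 1 * (x 0 ^ 2 - x 1 ^ 2) -
      2 * x 0 * x 1 * (p * v 1 + q * v 0)) * hℓv
  have h2 : (m * (‖x‖ * ‖v‖)) ^ 2 ≤ |x 0 * v 1 - x 1 * v 0| ^ 2 := by
    rw [sq_abs]
    have : (p ^ 2 + q ^ 2) * (m * (‖x‖ * ‖v‖)) ^ 2 ≤ (p ^ 2 + q ^ 2) *
        (x 0 * v 1 - x 1 * v 0) ^ 2 := by
      rw [key]
      calc _ = m ^ 2 * (p ^ 2 + q ^ 2) * ‖x‖ ^ 2 * ‖v‖ ^ 2 := by ring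
        _ ≤ _ := by gcongr
    exact le_of_mul_le_mul_left this hpq
  have h3 := (pow_le_pow_iff_left₀ (by positivity) (abs_nonneg _) two_ne_zero).1 h2
  rw [← e] at h3
  exact le_of_mul_le_mul_right h3 (by positivity)

lemma bddBelow_lineAngles (Γ : Set Plane) (x₀ : Plane) :
    BddBelow {a : ℝ | ∃ x ∈ Γ, ∃ v : Plane, HasTangent Γ x v ∧ a = lineAngle (x - x₀) v} := by
  refine ⟨0, ?_⟩
  rintro _ ⟨x, -, v, -, rfl⟩
  exact lineAngle_nonneg _ _

lemma horganPayneAngle_nonneg (Ω : Set Plane) (x₀ : Plane) : 0 ≤ horganPayneAngle Ω x₀ := by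
  refine Real.sInf_nonneg ?_
  rintro _ ⟨x, -, v, -, rfl⟩
  exact lineAngle_nonneg _ _

/-- A criterion for the failure of the Horgan–Payne inequality. -/
lemma not_horganPayneInequality {Ω : Set Plane} {m : ℝ} (hm : 0 < m)
    (hne : ∃ x ∈ frontier Ω, ∃ v, HasTangent (frontier Ω) x v)
    (hang : ∀ x ∈ frontier Ω, ∀ v, HasTangent (frontier Ω) x v → m ≤ Real.sin (lineAngle x v))
    (hβ : infSupConstant Ω < m / 2) : ¬ HorganPayneInequality Ω 0 := by
  rw [HorganPayneInequality, ge_iff_le, not_le]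
  refine hβ.trans_le ?_
  obtain ⟨x, hx, v, hv⟩ := hne
  have hmem : lineAngle (x - 0) v ∈ {a : ℝ | ∃ x ∈ frontier Ω, ∃ v : Plane,
    HasTangent (frontier Ω) x v ∧ a = lineAngle (x - 0) v} := ⟨x, hx, v, hv, rfl⟩
  have hle : horganPayneAngle Ω 0 ≤ Real.pi / 2 :=
    (csInf_le (bddBelow_lineAngles _ _) hmem).trans (lineAngle_le _ _)
  have hm1 : m ≤ 1 := (hang x hx v hv).trans (Real.sin_le_one _)
  have hge : Real.arcsin m ≤ horganPayneAngle Ω 0 := by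
    refine le_csInf ⟨_, hmem⟩ ?_
    rintro _ ⟨y, hy, w, hw, rfl⟩
    rw [sub_zero, Real.arcsin_le_iff_le_sin ⟨by linarith, hm1⟩]
    · exact hang y hy w hw
    · constructor
      · linarith [lineAngle_nonneg y w, Real.pi_pos]
      · exact lineAngle_le y w
  have h0 := horganPayneAngle_nonneg Ω 0
  have hsin : m ≤ Real.sin (horganPayneAngle Ω 0) := by
    rw [← Real.sin_arcsin (by linarith) hm1]
    exact Real.sin_le_sin_of_le_of_le_pi_div_two
      (by linarith [Real.neg_pi_div_two_le_arcsin m]) hle hge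
  have hs0 : 0 ≤ Real.sin (horganPayneAngle Ω 0 / 2) :=
    Real.sin_nonneg_of_nonneg_of_le_pi (by linarith) (by linarith [Real.pi_pos])
  have e := Real.sin_two_mul (horganPayneAngle Ω 0 / 2)
  rw [mul_div_cancel₀ _ two_ne_zero] at e
  nlinarith [Real.cos_le_one (horganPayneAngle Ω 0 / 2)]

end Angle

section Volume

lemma volume_real_box {S T : Set ℝ} (hS : MeasurableSet S) (hT : MeasurableSet T) :
    MeasurableSet {x : Plane | x 0 ∈ S ∧ x 1 ∈ T} ∧
    volume.real {x : Plane | x 0 ∈ S ∧ x 1 ∈ T} = volume.real S * volume.real T := by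
  have hmeas : MeasurableSet {x : Plane | x 0 ∈ S ∧ x 1 ∈ T} :=
    (measurableSet_preimage (f := fun x : Plane => x 0) (by fun_prop) hS).inter
      (measurableSet_preimage (f := fun x : Plane => x 1) (by fun_prop) hT)
  refine ⟨hmeas, ?_⟩
  have hmp := EuclideanSpace.volume_preserving_symm_measurableEquiv_toLp (Fin 2)
  have hset : {x : Plane | x 0 ∈ S ∧ x 1 ∈ T} =
      (MeasurableEquiv.toLp 2 (Fin 2 → ℝ)).symm ⁻¹' (Set.univ.pi ![S, T]) := by
    ext x
    simp [Fin.forall_fin_two]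
  rw [measureReal_def, hset, hmp.measure_preimage_equiv, volume_pi, Measure.pi_pi]
  simp [measureReal_def]

end Volume

section Gauge

variable {N : Plane → ℝ} {L μ : ℝ}

lemma isStarShapedBall_of_gauge (hL : 0 < L) (hμ : 0 < μ)
    (hhom : ∀ t : ℝ, 0 ≤ t → ∀ x, N (t • x) = t * N x)
    (hlip : ∀ x y, N x ≤ N y + L * ‖x - y‖) (hcoer : ∀ x, μ * ‖x‖ ≤ N x) :
    IsStarShapedBall {x | N x < 1} 0 := by
  have hcont : Continuous N := by
    refine (LipschitzWith.of_le_add_mul ⟨L, hL.le⟩ fun x y => ?_).continuous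
    rw [dist_eq_norm]
    exact hlip x y
  have h0 : N 0 = 0 := by simpa using hhom 0 le_rfl 0
  refine ⟨isOpen_lt hcont continuous_const, ?_, 1 / L, by positivity, ?_, ?_⟩
  · refine (Metric.isBounded_ball (x := (0 : Plane)) (r := 1 / μ)).subset fun x hx => ?_
    rw [mem_ball_zero_iff, lt_div_iff₀ hμ, mul_comm]
    exact (hcoer x).trans_lt hx
  · intro x hx
    rw [mem_ball_zero_iff, lt_div_iff₀ hL] at hx
    have := hlip x 0
    rw [h0, sub_zero] at this
    change N x < 1
    linarith
  · rintro y hy z hz _ ⟨a, b, ha, hb, hab, rfl⟩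
    rw [mem_ball_zero_iff, lt_div_iff₀ hL] at hy
    have h1 := hlip (a • y + b • z) (b • z)
    rw [add_sub_cancel_right, norm_smul, Real.norm_of_nonneg ha, hhom b hb] at h1
    change N (a • y + b • z) < 1
    have hz' : N z < 1 := hz
    rcases ha.eq_or_lt with rfl | ha
    · have : b = 1 := by linarith
      subst this
      linarith
    · nlinarith

lemma frontier_gauge (hcont : Continuous N) (hhom : ∀ t : ℝ, 0 ≤ t → ∀ x, N (t • x) = t * N x) :
    frontier {x | N x < 1} = {x | N x = 1} := by
  refine (frontier_lt_subset_eq hcont continuous_const).antisymm fun x hx => ?_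
  have hx : N x = 1 := hx
  rw [(isOpen_lt hcont continuous_const).frontier_eq]
  refine ⟨?_, fun h => (hx ▸ h : (1 : ℝ) < 1).ne rfl⟩
  have ht : Tendsto (fun t : ℝ => t • x) (𝓝[Ico 0 1] 1) (𝓝 x) := by
    have : Continuous fun t : ℝ => t • x := by fun_prop
    simpa using (this.tendsto 1).mono_left nhdsWithin_le_nhds
  have hne : (𝓝[Ico (0 : ℝ) 1] 1).NeBot := by
    rw [← mem_closure_iff_nhdsWithin_neBot, closure_Ico zero_ne_one]
    simp
  refine mem_closure_of_tendsto ht ?_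
  filter_upwards [self_mem_nhdsWithin] with t ht
  change N (t • x) < 1
  rw [hhom t ht.1, hx, mul_one]
  exact ht.2

end Gauge

/-- A lower bound for the angles of a curve that is covered by finitely many level lines. -/
lemma le_sin_lineAngle_of_cover {Γ : Set Plane} (hΓc : IsClosed Γ) {ι : Type*} [Finite ι]
    {C : ι → Set Plane} (hC : ∀ i, IsClosed (C i)) (hΓ : Γ ⊆ ⋃ i, C i) {F : ι → Plane → ℝ} {b m : ℝ}
    (hm : 0 ≤ m) (hF : ∀ i, ∀ x ∈ Γ ∩ C i, F i x = b)
    (hℓ : ∀ i, ∀ x ∈ Γ ∩ C i, ∃ ℓ : Plane →L[ℝ] ℝ, HasFDerivAt (F i) ℓ x ∧ ℓ x ≠ 0 ∧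
      m ^ 2 * (ℓ (stdVec 0) ^ 2 + ℓ (stdVec 1) ^ 2) * ‖x‖ ^ 2 ≤ ℓ x ^ 2)
    {x v : Plane} (hv : HasTangent Γ x v) : m ≤ Real.sin (lineAngle x v) := by
  obtain ⟨i, hi⟩ := exists_mem_tangentConeAt_inter hΓ hv.mem_tangentConeAt
  have hx : x ∈ Γ ∩ C i :=
    (hΓc.inter (hC i)).closure_eq ▸ mem_closure_of_nonempty_tangentConeAt ⟨v, hi⟩
  obtain ⟨ℓ, h1, h2, h3⟩ := hℓ i x hx
  refine le_sin_lineAngle hv.1 (eq_zero_of_mem_tangentConeAt h1 ?_ hi) hm h2 h3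
  filter_upwards [self_mem_nhdsWithin] with y hy
  rw [hF i y hy, hF i x hx]

lemma abs_coord_le_norm (x : Plane) (i : Fin 2) : |x i| ≤ ‖x‖ := by
  simpa using PiLp.norm_apply_le x i

lemma norm_le_abs_add_abs (x : Plane) : ‖x‖ ≤ |x 0| + |x 1| := by
  refine abs_le_of_sq_le_sq' ?_ (by positivity) |>.2
  rw [plane_norm_sq, add_sq, sq_abs, sq_abs]
  nlinarith [mul_nonneg (abs_nonneg (x 0)) (abs_nonneg (x 1))]

lemma mem_convexHull_zero_pair {A B x : Plane} : x ∈ convexHull ℝ {0, A, B} ↔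
    ∃ α β : ℝ, 0 ≤ α ∧ 0 ≤ β ∧ α + β ≤ 1 ∧ x = α • A + β • B := by
  constructor
  · intro hx
    rw [convexHull_insert (by simp), convexHull_pair, mem_convexJoin] at hx
    obtain ⟨_, rfl, _, ⟨a, b, ha, hb, hab, rfl⟩, c, d, hc, hd, hcd, rfl⟩ := hx
    refine ⟨d * a, d * b, by positivity, by positivity, ?_, ?_⟩
    · rw [← mul_add, hab]
      linarith
    · simp [mul_smul]
  · rintro ⟨α, β, hα, hβ, hαβ, rfl⟩
    have h := (convex_convexHull ℝ ({0, A, B} : Set Plane)).sum_mem (t := Finset.univ)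
      (w := ![1 - α - β, α, β]) (z := ![0, A, B]) ?_ ?_ ?_
    · simpa [Fin.sum_univ_three] using h
    · intro i _
      fin_cases i
      exacts [by simp; linarith, hα, hβ]
    · simp [Fin.sum_univ_three]
      ring
    · intro i _
      apply subset_convexHull
      fin_cases i <;> simp

section Octagon

variable {q : ℝ}

/-- The gauge of the octagon. -/
noncomputable def octagonGauge (q : ℝ) (x : Plane) : ℝ :=
  max (|x 0| + (√2 / q - 1) * |x 1|) (|x 1| / q ^ 2 - (1 / q ^ 2 - √2 / q) * |x 0|)

lemma octagonGauge_smul (q t : ℝ) (ht : 0 ≤ t) (x : Plane) :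
    octagonGauge q (t • x) = t * octagonGauge q x := by
  simp only [octagonGauge, PiLp.smul_apply, smul_eq_mul, abs_mul, abs_of_nonneg ht]
  rw [mul_max_of_nonneg _ _ ht]
  congr 1 <;> ring

lemma continuous_octagonGauge (q : ℝ) : Continuous (octagonGauge q) := by
  unfold octagonGauge
  fun_prop

lemma sqrt_two_div_bounds (hq0 : 0 < q) (hq : q ≤ 1 / 2) :
    2 ≤ √2 / q ∧ √2 / q ≤ 1 / q ^ 2 := by
  have h1 : (1 : ℝ) ≤ √2 := by rw [Real.one_le_sqrt]; norm_num
  have h2 : √2 ≤ 2 := by rw [Real.sqrt_le_left (by norm_num)]; norm_num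
  constructor
  · rw [le_div_iff₀ hq0]
    linarith
  · rw [div_le_div_iff₀ hq0 (by positivity)]
    nlinarith

lemma octagonVertex_eq (q : ℝ) (k : Fin 8) : octagonVertex q k =
    (![!₂[1, 0], !₂[q * (√2 / 2), q * (√2 / 2)], !₂[0, q ^ 2], !₂[-(q * (√2 / 2)), q * (√2 / 2)],
      !₂[-1, 0], !₂[-(q * (√2 / 2)), -(q * (√2 / 2))], !₂[0, -q ^ 2],
      !₂[q * (√2 / 2), -(q * (√2 / 2))]] : Fin 8 → Plane) k := by
  have e2 : (2 : ℝ) * (Real.pi / 4) = Real.pi / 2 := by ring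
  have e3 : (3 : ℝ) * (Real.pi / 4) = Real.pi - Real.pi / 4 := by ring
  have e4 : (4 : ℝ) * (Real.pi / 4) = Real.pi := by ring
  have e5 : (5 : ℝ) * (Real.pi / 4) = Real.pi / 4 + Real.pi := by ring
  have e6 : (6 : ℝ) * (Real.pi / 4) = Real.pi / 2 + Real.pi := by ring
  have e7 : (7 : ℝ) * (Real.pi / 4) = 2 * Real.pi - Real.pi / 4 := by ring
  ext i
  fin_cases k <;> fin_cases i <;>
    simp [octagonVertex, e2, e3, e4, e5, e6, e7, Real.cos_add_pi, Real.sin_add_pi,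
      Real.cos_two_pi_sub, Real.sin_two_pi_sub]

lemma octagonGauge_le_of_left (hq0 : 0 < q) (hq : q ≤ 1 / 2) {x : Plane} {s t α β : ℝ}
    (hs : |s| = 1) (ht : |t| = 1) (hα : 0 ≤ α) (hβ : 0 ≤ β) (hαβ : α + β ≤ 1)
    (e0 : x 0 = s * (α + β * (q * (√2 / 2)))) (e1 : x 1 = t * (β * (q * (√2 / 2)))) :
    octagonGauge q x ≤ 1 := by
  obtain ⟨h1, h2⟩ := sqrt_two_div_bounds hq0 hq
  have hs2 : √2 * √2 = 2 := Real.mul_self_sqrt (by norm_num)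
  rw [octagonGauge, e0, e1, abs_mul s, abs_mul t, hs, ht, abs_of_nonneg (by positivity),
    abs_of_nonneg (by positivity)]
  have e : q * (√2 / 2) * (√2 / q) = 1 := by
    field_simp
    linarith
  have e' : q * (√2 / 2) / q ^ 2 = q * (√2 / 2) * (1 / q ^ 2) := by ring
  refine max_le ?_ ?_
  · linear_combination hαβ + β * e
  · have h3 : 0 ≤ (1 / q ^ 2 - √2 / q) * α := mul_nonneg (by linarith) hα
    have : 1 * (β * (q * (√2 / 2))) / q ^ 2 - (1 / q ^ 2 - √2 / q) *
        (1 * (α + β * (q * (√2 / 2)))) = β * (q * (√2 / 2) * (√2 / q)) -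
        (1 / q ^ 2 - √2 / q) * α := by ring
    rw [this, e]
    linarith

lemma octagonGauge_le_of_right (hq0 : 0 < q) (hq : q ≤ 1 / 2) {x : Plane} {s t α β : ℝ}
    (hs : |s| = 1) (ht : |t| = 1) (hα : 0 ≤ α) (hβ : 0 ≤ β) (hαβ : α + β ≤ 1)
    (e0 : x 0 = s * (β * (q * (√2 / 2)))) (e1 : x 1 = t * (α * q ^ 2 + β * (q * (√2 / 2)))) :
    octagonGauge q x ≤ 1 := by
  have hs2 : √2 * √2 = 2 := Real.mul_self_sqrt (by norm_num)
  rw [octagonGauge, e0, e1, abs_mul s, abs_mul t, hs, ht, abs_of_nonneg (by positivity),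
    abs_of_nonneg (by positivity)]
  have e : q * (√2 / 2) * (√2 / q) = 1 := by
    field_simp
    linarith
  have eq2 : q ^ 2 / q ^ 2 = 1 := div_self (by positivity)
  have h2 : √2 ≤ 2 := by rw [Real.sqrt_le_left (by norm_num)]; norm_num
  have h3 : (√2 / q - 1) * q ^ 2 ≤ 1 := by
    have : (√2 / q - 1) * q ^ 2 = √2 * q - q ^ 2 := by field_simp
    rw [this]
    nlinarith
  refine max_le ?_ ?_
  · have : 1 * (β * (q * (√2 / 2))) + (√2 / q - 1) * (1 * (α * q ^ 2 + β * (q * (√2 / 2)))) =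
        β * (q * (√2 / 2) * (√2 / q)) + α * ((√2 / q - 1) * q ^ 2) := by ring
    rw [this, e]
    nlinarith
  · have : 1 * (α * q ^ 2 + β * (q * (√2 / 2))) / q ^ 2 - (1 / q ^ 2 - √2 / q) *
        (1 * (β * (q * (√2 / 2)))) = α * (q ^ 2 / q ^ 2) + β * (q * (√2 / 2) * (√2 / q)) := by ring
    rw [this, e, eq2]
    linarith

lemma plane_eq_smul_add {x : Plane} {α β a b c d : ℝ} (h0 : x 0 = α * a + β * c)
    (h1 : x 1 = α * b + β * d) : x = α • !₂[a, b] + β • !₂[c, d] := by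
  ext i
  fin_cases i <;> simpa

lemma iUnion_octagon_eq (hq0 : 0 < q) (hq : q ≤ 1 / 2) :
    ⋃ k : Fin 8, convexHull ℝ {0, octagonVertex q k, octagonVertex q (k + 1)} =
      {x | octagonGauge q x ≤ 1} := by
  have hs2 : √2 * √2 = 2 := Real.mul_self_sqrt (by norm_num)
  have h0 : 0 < √2 := by positivity
  have one : |(1 : ℝ)| = 1 := abs_one
  have mone : |(-1 : ℝ)| = 1 := by simp
  ext x
  simp only [mem_iUnion, mem_convexHull_zero_pair, octagonVertex_eq]
  constructor
  · rintro ⟨k, α, β, hα, hβ, hαβ, hx⟩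
    have e0 := congrArg (fun y : Plane => y 0) hx
    have e1 := congrArg (fun y : Plane => y 1) hx
    have hβα : β + α ≤ 1 := by linarith
    clear hx
    fin_cases k <;> simp at e0 e1
    · exact octagonGauge_le_of_left hq0 hq one one hα hβ hαβ (by rw [e0]; ring) (by rw [e1]; ring)
    · exact octagonGauge_le_of_right hq0 hq one one hβ hα hβα (by rw [e0]; ring) (by rw [e1]; ring)
    · exact octagonGauge_le_of_right hq0 hq mone one hα hβ hαβ (by rw [e0]; ring) (by rw [e1]; ring)
    · exact octagonGauge_le_of_left hq0 hq mone one hβ hα hβα (by rw [e0]; ring) (by rw [e1]; ring)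
    · exact octagonGauge_le_of_left hq0 hq mone mone hα hβ hαβ (by rw [e0]; ring) (by rw [e1]; ring)
    · exact octagonGauge_le_of_right hq0 hq mone mone hβ hα hβα (by rw [e0]; ring)
        (by rw [e1]; ring)
    · exact octagonGauge_le_of_right hq0 hq one mone hα hβ hαβ (by rw [e0]; ring) (by rw [e1]; ring)
    · exact octagonGauge_le_of_left hq0 hq one mone hβ hα hβα (by rw [e0]; ring) (by rw [e1]; ring)
  · intro hx
    have hx1 := (le_max_left _ _).trans (show octagonGauge q x ≤ 1 from hx)
    have hx2 := (le_max_right _ _).trans (show octagonGauge q x ≤ 1 from hx)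
    have hl : |x 1| ≤ |x 0| → 0 ≤ |x 0| - |x 1| ∧ 0 ≤ |x 1| * (√2 / q) ∧
        |x 0| - |x 1| + |x 1| * (√2 / q) ≤ 1 := fun h =>
      ⟨by linarith, by positivity, by linarith⟩
    have hr : |x 0| ≤ |x 1| → 0 ≤ (|x 1| - |x 0|) / q ^ 2 ∧ 0 ≤ |x 0| * (√2 / q) ∧
        (|x 1| - |x 0|) / q ^ 2 + |x 0| * (√2 / q) ≤ 1 := fun h =>
      ⟨div_nonneg (by linarith) (by positivity), by positivity, by
        have : (|x 1| - |x 0|) / q ^ 2 + |x 0| * (√2 / q) =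
          |x 1| / q ^ 2 - (1 / q ^ 2 - √2 / q) * |x 0| := by ring
        linarith⟩
    have e : √2 / q * (q * (√2 / 2)) = 1 := by
      field_simp
      linarith
    have e' : (|x 1| - |x 0|) / q ^ 2 * q ^ 2 = |x 1| - |x 0| := by field_simp
    have f0 : |x 0| * (√2 / q) * (q * (√2 / 2)) = |x 0| := by rw [mul_assoc, e, mul_one]
    have f1 : |x 1| * (√2 / q) * (q * (√2 / 2)) = |x 1| := by rw [mul_assoc, e, mul_one]
    rcases le_total (|x 1|) (|x 0|) with h | h
    · obtain ⟨hα, hβ, hαβ⟩ := hl h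
      have hβα := (add_comm _ _).trans_le hαβ
      rcases le_total 0 (x 0) with s0 | s0 <;> rcases le_total 0 (x 1) with s1 | s1
      · exact ⟨0, _, _, hα, hβ, hαβ, plane_eq_smul_add (by linarith [abs_of_nonneg s0, abs_of_nonneg s1])
          (by linarith [abs_of_nonneg s0, abs_of_nonneg s1])⟩
      · exact ⟨7, _, _, hβ, hα, hβα, plane_eq_smul_add (by linarith [abs_of_nonneg s0, abs_of_nonpos s1])
          (by linarith [abs_of_nonneg s0, abs_of_nonpos s1])⟩
      · exact ⟨3, _, _, hβ, hα, hβα, plane_eq_smul_add (by linarith [abs_of_nonpos s0, abs_of_nonneg s1])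
          (by linarith [abs_of_nonpos s0, abs_of_nonneg s1])⟩
      · exact ⟨4, _, _, hα, hβ, hαβ, plane_eq_smul_add (by linarith [abs_of_nonpos s0, abs_of_nonpos s1])
          (by linarith [abs_of_nonpos s0, abs_of_nonpos s1])⟩
    · obtain ⟨hα, hβ, hαβ⟩ := hr h
      have hβα := (add_comm _ _).trans_le hαβ
      rcases le_total 0 (x 0) with s0 | s0 <;> rcases le_total 0 (x 1) with s1 | s1
      · exact ⟨1, _, _, hβ, hα, hβα, plane_eq_smul_add (by linarith [abs_of_nonneg s0, abs_of_nonneg s1])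
          (by linarith [abs_of_nonneg s0, abs_of_nonneg s1])⟩
      · exact ⟨6, _, _, hα, hβ, hαβ, plane_eq_smul_add (by linarith [abs_of_nonneg s0, abs_of_nonpos s1])
          (by linarith [abs_of_nonneg s0, abs_of_nonpos s1])⟩
      · exact ⟨2, _, _, hα, hβ, hαβ, plane_eq_smul_add (by linarith [abs_of_nonpos s0, abs_of_nonneg s1])
          (by linarith [abs_of_nonpos s0, abs_of_nonneg s1])⟩
      · exact ⟨5, _, _, hβ, hα, hβα, plane_eq_smul_add (by linarith [abs_of_nonpos s0, abs_of_nonpos s1])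
          (by linarith [abs_of_nonpos s0, abs_of_nonpos s1])⟩

lemma octagon_eq (hq0 : 0 < q) (hq : q ≤ 1 / 2) : octagon q = {x | octagonGauge q x < 1} := by
  rw [octagon, iUnion_octagon_eq hq0 hq]
  refine Subset.antisymm (fun x hx => ?_) (interior_maximal (fun x hx =>
    le_of_lt (show octagonGauge q x < 1 from hx))
    (isOpen_lt (continuous_octagonGauge q) continuous_const))
  have hle : x ∈ {x | octagonGauge q x ≤ 1} := interior_subset hx
  refine lt_of_le_of_ne (show octagonGauge q x ≤ 1 from hle) fun h1 => ?_
  have hc : Continuous fun t : ℝ => t • x := by fun_prop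
  have hev : ∀ᶠ t : ℝ in 𝓝 1, t • x ∈ {x | octagonGauge q x ≤ 1} :=
    hc.continuousAt.preimage_mem_nhds (by simpa only [one_smul] using mem_interior_iff_mem_nhds.1 hx)
  obtain ⟨t, ht, ht1⟩ := ((hev.filter_mono nhdsWithin_le_nhds).and
    (self_mem_nhdsWithin : Ioi (1 : ℝ) ∈ 𝓝[>] 1)).exists
  have ht1 : 1 < t := ht1
  have : octagonGauge q (t • x) ≤ 1 := ht
  rw [octagonGauge_smul q t (by linarith), h1] at this
  linarith

lemma octagonGauge_le_add (hq0 : 0 < q) (hq : q ≤ 1 / 2) (x y : Plane) :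
    octagonGauge q x ≤ octagonGauge q y + (√2 / q + (1 / q ^ 2 + 1 / q ^ 2)) * ‖x - y‖ := by
  obtain ⟨h1, h2⟩ := sqrt_two_div_bounds hq0 hq
  have hk : 0 ≤ √2 / q - 1 := by linarith
  have hμ : 0 ≤ 1 / q ^ 2 - √2 / q := by linarith
  have hd : ∀ i, |(|x i| - |y i|)| ≤ ‖x - y‖ := fun i =>
    (abs_abs_sub_abs_le_abs_sub (x i) (y i)).trans (abs_coord_le_norm (x - y) i)
  have d0 := abs_le.1 (hd 0)
  have d1 := abs_le.1 (hd 1)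
  have hn := norm_nonneg (x - y)
  refine max_le ?_ ?_
  · have hy : |y 0| + (√2 / q - 1) * |y 1| ≤ octagonGauge q y := le_max_left _ _
    have := mul_le_mul_of_nonneg_left d1.2 hk
    have h3 : 0 ≤ 1 / q ^ 2 * ‖x - y‖ := by positivity
    linarith [d0.2]
  · have hy : |y 1| / q ^ 2 - (1 / q ^ 2 - √2 / q) * |y 0| ≤ octagonGauge q y := le_max_right _ _
    have h4 := mul_le_mul_of_nonneg_left d0.1 hμ
    have h5 := mul_le_mul_of_nonneg_left d1.2 (show 0 ≤ 1 / q ^ 2 by positivity)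
    have h3 : 0 ≤ √2 / q * ‖x - y‖ := by positivity
    have e1 : |x 1| / q ^ 2 = 1 / q ^ 2 * |x 1| := by ring
    have e2 : |y 1| / q ^ 2 = 1 / q ^ 2 * |y 1| := by ring
    rw [e1]
    rw [e2] at hy
    linarith

lemma norm_le_octagonGauge (hq0 : 0 < q) (hq : q ≤ 1 / 2) (x : Plane) :
    1 * ‖x‖ ≤ octagonGauge q x := by
  obtain ⟨h1, h2⟩ := sqrt_two_div_bounds hq0 hq
  rw [one_mul]
  refine (norm_le_abs_add_abs x).trans (le_trans ?_ (le_max_left _ _))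
  nlinarith [abs_nonneg (x 1)]

lemma isStarShapedBall_octagon (hq0 : 0 < q) (hq : q ≤ 1 / 2) : IsStarShapedBall (octagon q) 0 := by
  rw [octagon_eq hq0 hq]
  exact isStarShapedBall_of_gauge (L := √2 / q + (1 / q ^ 2 + 1 / q ^ 2)) (by positivity) one_pos
    (octagonGauge_smul q) (octagonGauge_le_add hq0 hq) (norm_le_octagonGauge hq0 hq)

lemma frontier_octagon (hq0 : 0 < q) (hq : q ≤ 1 / 2) :
    frontier (octagon q) = {x | octagonGauge q x = 1} := by
  rw [octagon_eq hq0 hq]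
  exact frontier_gauge (continuous_octagonGauge q) (octagonGauge_smul q)

/-- The linear functional `x ↦ a * x 0 + b * x 1`. -/
noncomputable def coordForm (a b : ℝ) : Plane →L[ℝ] ℝ :=
  a • EuclideanSpace.proj 0 + b • EuclideanSpace.proj 1

@[simp] lemma coordForm_apply (a b : ℝ) (x : Plane) : coordForm a b x = a * x 0 + b * x 1 := by
  simp [coordForm]

/-- The sign `1` or `-1`. -/
noncomputable def boolSign (b : Bool) : ℝ := if b then 1 else -1

lemma boolSign_sq (b : Bool) : boolSign b ^ 2 = 1 := by cases b <;> simp [boolSign]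

lemma exists_boolSign (r : ℝ) : ∃ b, boolSign b * r = |r| := by
  rcases le_total 0 r with h | h
  · exact ⟨true, by simp [boolSign, abs_of_nonneg h]⟩
  · exact ⟨false, by simp [boolSign, abs_of_nonpos h]⟩

lemma abs_eq_boolSign_mul {b : Bool} {r : ℝ} (h : 0 ≤ boolSign b * r) : |r| = boolSign b * r := by
  rw [← abs_of_nonneg h, abs_mul]
  cases b <;> simp [boolSign]

lemma stdVec_coord : (stdVec 0 : Plane) 0 = 1 ∧ (stdVec 0 : Plane) 1 = 0 ∧
    (stdVec 1 : Plane) 0 = 0 ∧ (stdVec 1 : Plane) 1 = 1 := by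
  simp [stdVec]

/-- The linear forms that equal `1` on the edges of the octagon. -/
noncomputable def octagonForm (q : ℝ) (i : Bool × Bool × Bool) : Plane →L[ℝ] ℝ :=
  if i.2.2 then coordForm (boolSign i.1) ((√2 / q - 1) * boolSign i.2.1)
  else coordForm (-(1 / q ^ 2 - √2 / q) * boolSign i.1) (1 / q ^ 2 * boolSign i.2.1)

lemma le_sin_lineAngle_octagon (hq0 : 0 < q) (hq : q ≤ 1 / 2) {x v : Plane}
    (hv : HasTangent (frontier (octagon q)) x v) : q / √2 ≤ Real.sin (lineAngle x v) := by
  obtain ⟨hb1, hb2⟩ := sqrt_two_div_bounds hq0 hq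
  have hs2 : √2 * √2 = 2 := Real.mul_self_sqrt (by norm_num)
  have hm2 : (q / √2) ^ 2 = q ^ 2 / 2 := by rw [div_pow, Real.sq_sqrt (by norm_num)]
  refine le_sin_lineAngle_of_cover isClosed_frontier (ι := Bool × Bool × Bool)
    (C := fun i => {x | 0 ≤ boolSign i.1 * x 0 ∧ 0 ≤ boolSign i.2.1 * x 1 ∧ octagonForm q i x = 1})
    (F := fun i => octagonForm q i) (b := 1) ?_ ?_ (by positivity) ?_ ?_ hv
  · intro i
    exact (isClosed_le (f := fun _ : Plane => (0 : ℝ)) (g := fun x => boolSign i.1 * x 0)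
      (by fun_prop) (by fun_prop)).inter ((isClosed_le (f := fun _ : Plane => (0 : ℝ))
      (g := fun x => boolSign i.2.1 * x 1) (by fun_prop) (by fun_prop)).inter
      (isClosed_eq (f := fun x : Plane => octagonForm q i x) (g := fun _ => (1 : ℝ))
        (by fun_prop) (by fun_prop)))
  · intro y hy
    rw [frontier_octagon hq0 hq] at hy
    have hy : octagonGauge q y = 1 := hy
    obtain ⟨b0, h0⟩ := exists_boolSign (y 0)
    obtain ⟨b1, h1⟩ := exists_boolSign (y 1)
    rw [octagonGauge, ← h0, ← h1] at hy
    refine mem_iUnion.2 ?_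
    have p0 : 0 ≤ boolSign b0 * y 0 := h0 ▸ abs_nonneg _
    have p1 : 0 ≤ boolSign b1 * y 1 := h1 ▸ abs_nonneg _
    rcases max_choice (boolSign b0 * y 0 + (√2 / q - 1) * (boolSign b1 * y 1))
      (boolSign b1 * y 1 / q ^ 2 - (1 / q ^ 2 - √2 / q) * (boolSign b0 * y 0)) with h | h
    · refine ⟨(b0, b1, true), p0, p1, ?_⟩
      rw [h] at hy
      simp only [octagonForm, if_true, coordForm_apply]
      linarith
    · refine ⟨(b0, b1, false), p0, p1, ?_⟩
      rw [h] at hy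
      simp only [octagonForm, Bool.false_eq_true, if_false, coordForm_apply]
      linear_combination hy
  · rintro i y ⟨-, -, -, h⟩
    exact h
  · rintro ⟨b0, b1, b2⟩ y ⟨hy, p0, p1, h⟩
    refine ⟨octagonForm q _, ContinuousLinearMap.hasFDerivAt _, by rw [h]; exact one_ne_zero, ?_⟩
    rw [h, hm2]
    rw [frontier_octagon hq0 hq] at hy
    have hy : octagonGauge q y = 1 := hy
    have a0 := abs_eq_boolSign_mul p0
    have a1 := abs_eq_boolSign_mul p1
    obtain ⟨s00, s01, s10, s11⟩ := stdVec_coord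
    have c0 := boolSign_sq b0
    have c1 := boolSign_sq b1
    have hyn := norm_le_octagonGauge hq0 hq y
    rw [hy, one_mul] at hyn
    have hyn2 : ‖y‖ ^ 2 ≤ 1 := pow_le_one₀ (norm_nonneg _) hyn
    have hq2 : q ^ 2 * (√2 / q) ^ 2 = 2 := by
      rw [div_pow, Real.sq_sqrt (by norm_num)]
      field_simp
    cases b2
    · simp only [octagonForm, Bool.false_eq_true, if_false, coordForm_apply] at h ⊢
      have hf1 : boolSign b0 * y 0 + (√2 / q - 1) * (boolSign b1 * y 1) ≤ 1 := by
        refine le_trans ?_ hy.le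
        rw [← a0, ← a1]
        exact le_max_left _ _
      set X := boolSign b0 * y 0 with hX
      set Y := boolSign b1 * y 1 with hY
      have h' : 1 / q ^ 2 * Y - (1 / q ^ 2 - √2 / q) * X = 1 := by
        linear_combination h
      have hμ : 0 ≤ 1 / q ^ 2 - √2 / q := by linarith
      have hXY : X ≤ Y := by
        have : (1 + (1 / q ^ 2 - √2 / q)) * (X - Y) ≤ 0 := by linarith
        by_contra! hc
        have := mul_pos (show 0 < 1 + (1 / q ^ 2 - √2 / q) by linarith) (sub_pos.2 hc)
        linarith
      have hYq : Y * (√2 / q) ≤ 1 := by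
        have := mul_le_mul_of_nonneg_left hXY hμ
        linarith
      have hn : ‖y‖ ^ 2 = X ^ 2 + Y ^ 2 := by
        rw [plane_norm_sq, hX, hY]
        linear_combination (-(y 0) ^ 2) * c0 - (y 1) ^ 2 * c1
      have hY2 : (Y * (√2 / q)) ^ 2 ≤ 1 := pow_le_one₀ (by positivity) hYq
      have hnq : ‖y‖ ^ 2 ≤ q ^ 2 := by
        rw [hn]
        have : 2 * Y ^ 2 = q ^ 2 * (Y * (√2 / q)) ^ 2 := by
          rw [mul_pow]
          linear_combination (-Y ^ 2) * hq2
        have h1 : X ^ 2 ≤ Y ^ 2 := pow_le_pow_left₀ p0 hXY 2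
        have h2 : q ^ 2 * (Y * (√2 / q)) ^ 2 ≤ q ^ 2 * 1 := by gcongr
        linarith
      have hlen : (-(1 / q ^ 2 - √2 / q) * boolSign b0) ^ 2 + (1 / q ^ 2 * boolSign b1) ^ 2 ≤
          2 * (1 / q ^ 2) ^ 2 := by
        rw [mul_pow, mul_pow, c0, c1, neg_sq]
        have h1 : (1 / q ^ 2 - √2 / q) ^ 2 ≤ (1 / q ^ 2) ^ 2 :=
          pow_le_pow_left₀ hμ (by linarith) 2
        linarith
      simp only [s00, s01, s10, s11, mul_one, mul_zero, add_zero, zero_add]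
      calc _ ≤ q ^ 2 / 2 * (2 * (1 / q ^ 2) ^ 2) * q ^ 2 := by gcongr
        _ = 1 := by field_simp
        _ ≤ _ := by norm_num
    · simp only [octagonForm, if_true, coordForm_apply, s00, s01, s10, s11, mul_one, mul_zero,
        add_zero, zero_add]
      have hlen : boolSign b0 ^ 2 + ((√2 / q - 1) * boolSign b1) ^ 2 ≤ (√2 / q) ^ 2 := by
        rw [mul_pow, c0, c1]
        nlinarith
      calc _ ≤ q ^ 2 / 2 * (√2 / q) ^ 2 * 1 := by gcongr
        _ = 1 := by linarith
        _ ≤ _ := by norm_num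

lemma exists_hasTangent_octagon (hq0 : 0 < q) (hq : q ≤ 1 / 2) :
    ∃ x ∈ frontier (octagon q), ∃ v, HasTangent (frontier (octagon q)) x v := by
  obtain ⟨hb1, hb2⟩ := sqrt_two_div_bounds hq0 hq
  rw [frontier_octagon hq0 hq]
  have hloc : ∀ y : Plane, 0 < y 1 → y 1 < y 0 →
      octagonGauge q y = coordForm 1 (√2 / q - 1) y := by
    intro y h1 h2
    rw [octagonGauge, abs_of_pos h1, abs_of_pos (h1.trans h2), max_eq_left, coordForm_apply, one_mul]
    have e1 : y 1 / q ^ 2 = 1 / q ^ 2 * y 1 := by ring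
    rw [e1]
    nlinarith
  set k := √2 / q - 1 with hk
  have hk1 : 1 ≤ k := by linarith
  set x : Plane := !₂[1 / (1 + k / 2), 1 / (2 + k)] with hx
  have hx0 : x 0 = 1 / (1 + k / 2) := rfl
  have hx1 : x 1 = 1 / (2 + k) := rfl
  have hx01 : x 1 < x 0 := by
    rw [hx0, hx1]
    apply one_div_lt_one_div_of_lt <;> linarith
  have hx1p : 0 < x 1 := by rw [hx1]; positivity
  have hxform : coordForm 1 k x = 1 := by
    rw [coordForm_apply, hx0, hx1]
    field_simp
  have hc : ∀ i, ContinuousAt (fun y : Plane => y i) x := fun i => by fun_prop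
  have hev : ∀ᶠ y : Plane in 𝓝 x, 0 < y 1 ∧ y 1 < y 0 :=
    ((hc 1).eventually (lt_mem_nhds hx1p)).and ((hc 1).eventually_lt (hc 0) hx01)
  set v : Plane := !₂[-k, 1] with hv
  have hv0 : v ≠ 0 := fun h => by
    have := congrArg (fun y : Plane => y 1) h
    simp [hv] at this
  have hcurve : HasDerivAt (fun t : ℝ => x + t • v) v 0 := by
    simpa using ((hasDerivAt_id (0 : ℝ)).smul_const v).const_add x
  refine ⟨x, (hloc x hx1p hx01).trans hxform, v, hasTangent_of_curve (by simp) hcurve hv0 ?_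
    (coordForm 1 k).hasFDerivAt ?_ ?_⟩
  · have h2 : Tendsto (fun t : ℝ => x + t • v) (𝓝 0) (𝓝 x) := by
      simpa using hcurve.continuousAt.tendsto
    filter_upwards [h2.eventually hev] with t ht
    rw [hloc _ ht.1 ht.2, map_add, map_smul, hxform]
    simp [hv]
  · intro h
    have := hxform
    rw [h] at this
    simp at this
  · filter_upwards [hev.filter_mono nhdsWithin_le_nhds, self_mem_nhdsWithin] with y hy hyΓ
    have hyΓ : octagonGauge q y = 1 := hyΓ
    rw [← hloc y hy.1 hy.2, hyΓ, hxform]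

lemma not_horganPayneInequality_octagon (hq0 : 0 < q) (hq : q ≤ 1 / 6000) :
    ¬ HorganPayneInequality (octagon q) 0 := by
  have hq2 : q ≤ 1 / 2 := by linarith
  obtain ⟨hb1, hb2⟩ := sqrt_two_div_bounds hq0 hq2
  have hs2 : √2 * √2 = 2 := Real.mul_self_sqrt (by norm_num)
  have hstar := isStarShapedBall_octagon hq0 hq2
  refine not_horganPayneInequality (m := q / √2) (by positivity) (exists_hasTangent_octagon hq0 hq2)
    (fun x _ v hv => le_sin_lineAngle_octagon hq0 hq2 hv) ?_
  obtain ⟨hAm, hAv⟩ := volume_real_box (S := Ioo (1 / 4 : ℝ) (1 / 2)) (T := Ioo (-(q / 4)) (q / 4))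
    measurableSet_Ioo measurableSet_Ioo
  have hvol : volume.real {x : Plane | x 0 ∈ Ioo (1 / 4 : ℝ) (1 / 2) ∧ x 1 ∈ Ioo (-(q / 4)) (q / 4)}
      = q / 8 := by
    rw [hAv, Real.volume_real_Ioo_of_le (by norm_num), Real.volume_real_Ioo_of_le (by linarith)]
    ring
  refine (infSupConstant_le_of_neck (a := q ^ 2) (s := 1 / 2) hstar.isBounded ?_ (by positivity) ?_
    hAm ?_ (by norm_num) (by norm_num) ?_ (by rw [hvol]; positivity)).trans_lt ?_
  · intro x hx
    rw [octagon_eq hq0 hq2] at hx ⊢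
    simpa [octagonGauge] using hx
  · intro x hx hx0
    rw [octagon_eq hq0 hq2] at hx
    have := (le_max_right _ _).trans_lt (show octagonGauge q x < 1 from hx)
    rw [hx0, abs_zero, mul_zero, sub_zero, div_lt_one (by positivity)] at this
    exact this
  · rintro x ⟨⟨h1, h2⟩, h3⟩
    rw [octagon_eq hq0 hq2]
    have h4 : |x 1| < q / 4 := abs_lt.2 h3
    have h5 : |x 0| = x 0 := abs_of_pos (by linarith)
    have h6 : √2 / q * |x 1| ≤ √2 / q * (q / 4) := by gcongr
    have h7 : √2 / q * (q / 4) = √2 / 4 := by field_simp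
    have h8 : √2 < 3 / 2 := by rw [Real.sqrt_lt' (by norm_num)]; norm_num
    have h9 := abs_nonneg (x 1)
    have h10 : 0 ≤ (1 + (1 / q ^ 2 - √2 / q)) * (|x 0| - |x 1|) :=
      mul_nonneg (by linarith) (by linarith)
    have e1 : |x 1| / q ^ 2 = 1 / q ^ 2 * |x 1| := by ring
    change octagonGauge q x < 1
    rw [octagonGauge, max_eq_left (by rw [e1]; linarith)]
    linarith
  · rintro x ⟨⟨h1, h2⟩, h3⟩
    have := (le_abs_self (x 0)).trans (abs_coord_le_norm x 0)
    nlinarith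
  · have hκ : ((1 - (1 / 2 : ℝ) ^ 2) ^ 3 * (1 + 2 * (1 / 2) ^ 2)) ^ 2 = 6561 / 16384 := by norm_num
    have hm2 : (q / √2 / 2) ^ 2 = q ^ 2 / 8 := by
      rw [div_pow, div_pow, Real.sq_sqrt (by norm_num)]
      ring
    rw [hvol, hκ, Real.sqrt_lt' (by positivity), hm2, div_lt_iff₀ (by positivity)]
    have hπ : Real.pi < 4 := Real.pi_lt_four
    have h4 : 0 < q ^ 4 := by positivity
    have h5 : 188 * Real.pi / 35 * (q ^ 2) ^ 2 ≤ 22 * q ^ 4 := by nlinarith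
    have h3 : q ^ 4 ≤ q ^ 3 * (1 / 6000) := by
      rw [pow_succ]
      gcongr
    have : 0 < q ^ 3 := by positivity
    linarith

end Octagon

section Stadium

variable {ε : ℝ}

lemma mem_ball_plane {a : ℝ} {x : Plane} :
    x ∈ Metric.ball (!₂[a, 0] : Plane) 1 ↔ (x 0 - a) ^ 2 + x 1 ^ 2 < 1 := by
  rw [mem_ball_iff_norm, ← sq_lt_one_iff₀ (norm_nonneg _), plane_norm_sq]
  simp

lemma stadium_bounds (h0 : 0 < ε) (h1 : ε < 1) :
    0 < √(1 - ε ^ 2) ∧ √(1 - ε ^ 2) < 1 ∧ √(1 - ε ^ 2) < √(1 - ε ^ 2) / ε ∧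
      √(1 - ε ^ 2) ^ 2 = 1 - ε ^ 2 ∧ ε * (√(1 - ε ^ 2) / ε) = √(1 - ε ^ 2) := by
  have hp : 0 < 1 - ε ^ 2 := by nlinarith
  have hs := Real.sqrt_pos.2 hp
  refine ⟨hs, ?_, ?_, Real.sq_sqrt hp.le, by field_simp⟩
  · rw [Real.sqrt_lt' one_pos]
    nlinarith
  · rw [lt_div_iff₀ h0]
    nlinarith

lemma mem_stadium (h0 : 0 < ε) (h1 : ε < 1) {x : Plane} : x ∈ stadium ε ↔
    ∃ t, √(1 - ε ^ 2) ≤ t ∧ t ≤ √(1 - ε ^ 2) / ε ∧ (x 0 - t) ^ 2 + x 1 ^ 2 < 1 := by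
  obtain ⟨hc0, hc1, hcb, -, -⟩ := stadium_bounds h0 h1
  simp only [stadium, mem_union, mem_ball_plane, mem_ofPred_eq]
  set c := √(1 - ε ^ 2)
  set b := c / ε
  constructor
  · rintro ((⟨h1, h2, h3, h4⟩ | h) | h)
    · exact ⟨x 0, h1.le, h2.le, by nlinarith⟩
    · exact ⟨c, le_rfl, hcb.le, h⟩
    · exact ⟨b, hcb.le, le_rfl, h⟩
  · rintro ⟨t, ht1, ht2, ht⟩
    rcases le_or_gt (x 0) c with h | h
    · exact Or.inl (Or.inr (by nlinarith))
    · rcases le_or_gt b (x 0) with h' | h'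
      · exact Or.inr (by nlinarith)
      · have : x 1 ^ 2 < 1 := by nlinarith
        exact Or.inl (Or.inl ⟨h, h', by nlinarith, by nlinarith⟩)

lemma convex_stadium (h0 : 0 < ε) (h1 : ε < 1) : Convex ℝ (stadium ε) := by
  intro x hx y hy a b ha hb hab
  rw [mem_stadium h0 h1] at *
  obtain ⟨t, ht1, ht2, ht⟩ := hx
  obtain ⟨s, hs1, hs2, hs⟩ := hy
  have key : ∀ p q : ℝ, (a * p + b * q) ^ 2 ≤ a * p ^ 2 + b * q ^ 2 := by
    intro p q
    have : a * p ^ 2 + b * q ^ 2 - (a * p + b * q) ^ 2 = a * b * (p - q) ^ 2 := by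
      obtain rfl : b = 1 - a := by linarith
      ring
    nlinarith [mul_nonneg (mul_nonneg ha hb) (sq_nonneg (p - q))]
  refine ⟨a * t + b * s, ?_, ?_, ?_⟩
  · calc _ = a * √(1 - ε ^ 2) + b * √(1 - ε ^ 2) := by rw [← add_mul, hab, one_mul]
      _ ≤ _ := by gcongr
  · calc _ ≤ a * (√(1 - ε ^ 2) / ε) + b * (√(1 - ε ^ 2) / ε) := by gcongr
      _ = _ := by rw [← add_mul, hab, one_mul]
  · have e : (a • x + b • y) 0 - (a * t + b * s) = a * (x 0 - t) + b * (y 0 - s) := by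
      simp
      ring
    rw [e]
    simp only [PiLp.add_apply, PiLp.smul_apply, smul_eq_mul]
    have k0 := key (x 0 - t) (y 0 - s)
    have k1 := key (x 1) (y 1)
    have h : a * ((x 0 - t) ^ 2 + x 1 ^ 2) + b * ((y 0 - s) ^ 2 + y 1 ^ 2) < a * 1 + b * 1 := by
      rcases ha.eq_or_lt with rfl | ha
      · have : b = 1 := by linarith
        subst this
        linarith
      · have := mul_lt_mul_of_pos_left ht ha
        have := mul_le_mul_of_nonneg_left hs.le hb
        linarith
    linarith

/-- The squared distance to a segment of the horizontal axis, as a function of the abscissa `u`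
and the ordinate `y`. -/
noncomputable def segmentDistSq (ε u y : ℝ) : ℝ :=
  max (√(1 - ε ^ 2) - u) 0 ^ 2 + max (u - √(1 - ε ^ 2) / ε) 0 ^ 2 + y ^ 2

lemma segmentDistSq_le (h0 : 0 < ε) (h1 : ε < 1) {u y t : ℝ} (ht1 : √(1 - ε ^ 2) ≤ t)
    (ht2 : t ≤ √(1 - ε ^ 2) / ε) : segmentDistSq ε u y ≤ (u - t) ^ 2 + y ^ 2 := by
  obtain ⟨hc0, hc1, hcb, -, -⟩ := stadium_bounds h0 h1
  rw [segmentDistSq]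
  set c := √(1 - ε ^ 2)
  set b := c / ε
  gcongr
  rcases le_total u c with h | h
  · rw [max_eq_left (by linarith), max_eq_right (by linarith)]
    nlinarith
  · rw [max_eq_right (by linarith)]
    rcases le_total u b with h' | h'
    · rw [max_eq_right (by linarith)]
      nlinarith [sq_nonneg (u - t)]
    · rw [max_eq_left (by linarith)]
      nlinarith

lemma mem_stadium_iff (h0 : 0 < ε) (h1 : ε < 1) {x : Plane} :
    x ∈ stadium ε ↔ segmentDistSq ε (x 0) (x 1) < 1 := by
  obtain ⟨hc0, hc1, hcb, -, -⟩ := stadium_bounds h0 h1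
  rw [mem_stadium h0 h1]
  constructor
  · rintro ⟨t, ht1, ht2, ht⟩
    exact (segmentDistSq_le h0 h1 ht1 ht2).trans_lt ht
  · intro h
    rw [segmentDistSq] at h
    set c := √(1 - ε ^ 2)
    set b := c / ε
    rcases le_total (x 0) c with h' | h'
    · refine ⟨c, le_rfl, hcb.le, ?_⟩
      rw [max_eq_left (by linarith), max_eq_right (by linarith)] at h
      linarith
    · rw [max_eq_right (by linarith)] at h
      rcases le_total (x 0) b with h2 | h2
      · refine ⟨x 0, h', h2, ?_⟩
        rw [max_eq_right (by linarith)] at h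
        linarith
      · refine ⟨b, hcb.le, le_rfl, ?_⟩
        rw [max_eq_left (by linarith)] at h
        linarith

lemma doubleStadium_eq_union : doubleStadium ε = stadium ε ∪ planeReflection ⁻¹' stadium ε := by
  simp only [doubleStadium, preimage, planeReflection_eq]

lemma mem_doubleStadium (h0 : 0 < ε) (h1 : ε < 1) {x : Plane} :
    x ∈ doubleStadium ε ↔ segmentDistSq ε |x 0| (x 1) < 1 := by
  obtain ⟨hc0, hc1, hcb, -, -⟩ := stadium_bounds h0 h1
  rw [doubleStadium_eq_union, mem_union, mem_preimage]
  have key : ∀ y : Plane, y ∈ stadium ε → segmentDistSq ε |y 0| (y 1) < 1 := by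
    intro y hy
    obtain ⟨t, ht1, ht2, ht⟩ := (mem_stadium h0 h1).1 hy
    refine (segmentDistSq_le h0 h1 ht1 ht2).trans_lt (lt_of_le_of_lt ?_ ht)
    nlinarith [le_abs_self (y 0), sq_abs (y 0)]
  constructor
  · rintro (h | h)
    · exact key x h
    · simpa using key _ h
  · intro h
    rcases le_total 0 (x 0) with h' | h'
    · rw [abs_of_nonneg h'] at h
      exact Or.inl ((mem_stadium_iff h0 h1).2 h)
    · rw [abs_of_nonpos h'] at h
      refine Or.inr ((mem_stadium_iff h0 h1).2 ?_)
      simpa using h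

lemma continuous_segmentDistSq (ε : ℝ) :
    Continuous fun x : Plane => segmentDistSq ε |x 0| (x 1) := by
  unfold segmentDistSq
  fun_prop

lemma doubleStadium_eq (h0 : 0 < ε) (h1 : ε < 1) :
    doubleStadium ε = {x | segmentDistSq ε |x 0| (x 1) < 1} :=
  Set.ext fun _ => mem_doubleStadium h0 h1

lemma isOpen_doubleStadium (h0 : 0 < ε) (h1 : ε < 1) : IsOpen (doubleStadium ε) := by
  rw [doubleStadium_eq h0 h1]
  exact isOpen_lt (continuous_segmentDistSq ε) continuous_const

lemma isStarShapedBall_doubleStadium (h0 : 0 < ε) (h1 : ε < 1) :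
    IsStarShapedBall (doubleStadium ε) 0 := by
  obtain ⟨hc0, hc1, hcb, -, -⟩ := stadium_bounds h0 h1
  have hball : ∀ y : Plane, ‖y‖ < 1 - √(1 - ε ^ 2) → y ∈ stadium ε := by
    intro y hy
    refine Or.inl (Or.inr ?_)
    rw [mem_ball_iff_norm]
    have : ‖(!₂[√(1 - ε ^ 2), 0] : Plane)‖ = √(1 - ε ^ 2) := by
      rw [EuclideanSpace.norm_eq]
      simp [hc0.le]
    linarith [norm_sub_le y !₂[√(1 - ε ^ 2), 0]]
  have hball' : ∀ y : Plane, ‖y‖ < 1 - √(1 - ε ^ 2) → y ∈ planeReflection ⁻¹' stadium ε :=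
    fun y hy => hball _ (by rwa [LinearIsometryEquiv.norm_map])
  have hconv' : Convex ℝ (planeReflection ⁻¹' stadium ε) :=
    (convex_stadium h0 h1).linear_preimage planeReflection.toLinearEquiv.toLinearMap
  refine ⟨isOpen_doubleStadium h0 h1, ?_, 1 - √(1 - ε ^ 2), by linarith, ?_, ?_⟩
  · refine (Metric.isBounded_ball (x := (0 : Plane)) (r := √(1 - ε ^ 2) / ε + 2)).subset
      fun x hx => ?_
    rw [mem_ball_zero_iff]
    rw [mem_doubleStadium h0 h1, segmentDistSq] at hx
    have e1 := sq_nonneg (max (√(1 - ε ^ 2) - |x 0|) 0)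
    have e2 := le_max_left (|x 0| - √(1 - ε ^ 2) / ε) 0
    have e3 := le_max_right (|x 0| - √(1 - ε ^ 2) / ε) 0
    have e4 : |x 1| < 1 := by
      rw [← sq_lt_one_iff_abs_lt_one]
      nlinarith
    have e5 : max (|x 0| - √(1 - ε ^ 2) / ε) 0 < 1 := by nlinarith [sq_nonneg (x 1)]
    linarith [norm_le_abs_add_abs x]
  · intro y hy
    rw [doubleStadium_eq_union]
    exact Or.inl (hball y (mem_ball_zero_iff.1 hy))
  · intro y hy z hz
    rw [mem_ball_zero_iff] at hy
    rw [doubleStadium_eq_union] at hz ⊢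
    rcases hz with hz | hz
    · exact ((convex_stadium h0 h1).segment_subset (hball y hy) hz).trans subset_union_left
    · exact (hconv'.segment_subset (hball' y hy) hz).trans subset_union_right

lemma frontier_doubleStadium_subset (h0 : 0 < ε) (h1 : ε < 1) :
    frontier (doubleStadium ε) ⊆ {x | segmentDistSq ε |x 0| (x 1) = 1} := by
  rw [doubleStadium_eq h0 h1]
  exact frontier_lt_subset_eq (continuous_segmentDistSq ε) continuous_const

lemma hasFDerivAt_segmentDistSq (ε s : ℝ) (x : Plane) :
    HasFDerivAt (fun x : Plane => segmentDistSq ε (s * x 0) (x 1))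
      (coordForm (2 * (max (s * x 0 - √(1 - ε ^ 2) / ε) 0 - max (√(1 - ε ^ 2) - s * x 0) 0) * s)
        (2 * x 1)) x := by
  have hu : HasFDerivAt (fun x : Plane => s * x 0) _ x := (hasFDerivAt_coord 0 x).const_mul s
  have d1 := (hasDerivAt_max_zero_sq (√(1 - ε ^ 2) - s * x 0)).comp_hasFDerivAt x
    (hu.const_sub (√(1 - ε ^ 2)))
  have d2 := (hasDerivAt_max_zero_sq (s * x 0 - √(1 - ε ^ 2) / ε)).comp_hasFDerivAt x
    (hu.sub_const (√(1 - ε ^ 2) / ε))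
  have d3 := (hasDerivAt_pow 2 (x 1)).comp_hasFDerivAt x (hasFDerivAt_coord 1 x)
  refine ((d1.add d2).add d3).congr_fderiv ?_
  ext v
  simp
  ring

lemma le_sin_lineAngle_doubleStadium (h0 : 0 < ε) (h1 : ε < 1) {x v : Plane}
    (hv : HasTangent (frontier (doubleStadium ε)) x v) : ε ≤ Real.sin (lineAngle x v) := by
  obtain ⟨hc0, hc1, hcb, hc2, hbc⟩ := stadium_bounds h0 h1
  have hsub := frontier_doubleStadium_subset h0 h1
  refine le_sin_lineAngle_of_cover isClosed_frontier (ι := Bool)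
    (C := fun i => {x | 0 ≤ boolSign i * x 0})
    (F := fun i x => segmentDistSq ε (boolSign i * x 0) (x 1)) (b := 1) ?_ ?_ h0.le ?_ ?_ hv
  · exact fun i => isClosed_le (f := fun _ : Plane => (0 : ℝ)) (g := fun x => boolSign i * x 0)
      (by fun_prop) (by fun_prop)
  · intro y _
    obtain ⟨b, hb⟩ := exists_boolSign (y 0)
    exact mem_iUnion.2 ⟨b, show 0 ≤ boolSign b * y 0 from hb ▸ abs_nonneg (y 0)⟩
  · rintro i y ⟨hy, hi⟩
    have := hsub hy
    rwa [mem_ofPred_eq, abs_eq_boolSign_mul hi] at this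
  · rintro i y ⟨hy, hi⟩
    have hy1 : segmentDistSq ε |y 0| (y 1) = 1 := hsub hy
    have hi : 0 ≤ boolSign i * y 0 := hi
    rw [abs_eq_boolSign_mul hi] at hy1
    refine ⟨_, hasFDerivAt_segmentDistSq ε (boolSign i) y, ?_⟩
    obtain ⟨s00, s01, s10, s11⟩ := stdVec_coord
    simp only [coordForm_apply, s00, s01, s10, s11, mul_one, mul_zero, add_zero, zero_add]
    rw [segmentDistSq] at hy1
    have hs := boolSign_sq i
    have hn : ‖y‖ ^ 2 = (boolSign i * y 0) ^ 2 + y 1 ^ 2 := by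
      rw [plane_norm_sq]
      linear_combination (-(y 0) ^ 2) * hs
    rw [hn]
    set c := √(1 - ε ^ 2)
    set b := c / ε
    set u := boolSign i * y 0 with hu
    set w := max (u - b) 0 - max (c - u) 0 with hw
    have e : 2 * w * boolSign i * y 0 + 2 * y 1 * y 1 = 2 * (w * u + y 1 ^ 2) := by
      rw [hu]
      ring
    have e2 : (2 * w * boolSign i) ^ 2 + (2 * y 1) ^ 2 = 4 * (w ^ 2 + y 1 ^ 2) := by
      linear_combination 4 * w ^ 2 * hs
    rw [e, e2]
    suffices h : w ^ 2 + y 1 ^ 2 = 1 ∧ 0 < w * u + y 1 ^ 2 ∧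
        ε ^ 2 * (u ^ 2 + y 1 ^ 2) ≤ (w * u + y 1 ^ 2) ^ 2 by
      obtain ⟨g1, g2, g3⟩ := h
      rw [g1]
      refine ⟨by positivity, by linarith⟩
    rcases le_total u c with h | h
    · rw [max_eq_left (by linarith), max_eq_right (by linarith)] at hy1
      have hwe : w = u - c := by
        rw [hw, max_eq_right (by linarith), max_eq_left (by linarith)]
        ring
      have hp : w * u + y 1 ^ 2 = 1 - c ^ 2 + c * u := by
        rw [hwe]
        linear_combination hy1
      have hyy : y 1 ^ 2 = 1 - (c - u) ^ 2 := by linarith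
      refine ⟨by rw [hwe]; linarith, ?_, ?_⟩
      · rw [hp, hc2]
        have := mul_nonneg hc0.le hi
        nlinarith
      · rw [hp, hyy, hc2]
        have : (1 - (1 - ε ^ 2) + c * u) ^ 2 - ε ^ 2 * (u ^ 2 + (1 - (c - u) ^ 2)) =
            (c * u) ^ 2 := by
          linear_combination ε ^ 2 * hc2
        nlinarith [sq_nonneg (c * u)]
    · rw [max_eq_right (a := c - u) (by linarith)] at hy1
      rcases le_total u b with h' | h'
      · rw [max_eq_right (by linarith)] at hy1
        have hwe : w = 0 := by
          rw [hw, max_eq_right (by linarith), max_eq_right (by linarith)]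
          ring
        have hyy : y 1 ^ 2 = 1 := by linarith
        rw [hwe, hyy]
        refine ⟨by norm_num, by norm_num, ?_⟩
        have : (ε * u) ^ 2 ≤ (ε * b) ^ 2 := by gcongr
        rw [hbc, hc2] at this
        linarith
      · rw [max_eq_left (by linarith)] at hy1
        have hwe : w = u - b := by
          rw [hw, max_eq_left (by linarith), max_eq_right (by linarith)]
          ring
        have hyy : y 1 ^ 2 = 1 - (u - b) ^ 2 := by linarith
        have hb0 : 0 < b := hc0.trans hcb
        have hub : 0 ≤ b * (u - b) := mul_nonneg hb0.le (by linarith)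
        have hp : w * u + y 1 ^ 2 = 1 + b * (u - b) := by
          rw [hwe, hyy]
          ring
        refine ⟨by rw [hwe]; linarith, by rw [hp]; linarith, ?_⟩
        rw [hp, hyy]
        have e1 : ε ^ 2 * b ^ 2 = 1 - ε ^ 2 := by rw [← mul_pow, hbc, hc2]
        have e3 : ε ^ 2 * (u ^ 2 + (1 - (u - b) ^ 2)) = 1 + 2 * ε ^ 2 * (b * (u - b)) := by
          linear_combination e1
        rw [e3]
        have hε : ε ^ 2 ≤ 1 := pow_le_one₀ h0.le h1.le
        have h2 : ε ^ 2 * (b * (u - b)) ≤ 1 * (b * (u - b)) := mul_le_mul_of_nonneg_right hε hub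
        have h3 := sq_nonneg (b * (u - b))
        linarith

lemma segmentDistSq_of_mem {u y : ℝ} (h1 : √(1 - ε ^ 2) ≤ u) (h2 : u ≤ √(1 - ε ^ 2) / ε) :
    segmentDistSq ε u y = y ^ 2 := by
  rw [segmentDistSq, max_eq_right (by linarith), max_eq_right (by linarith)]
  ring

lemma mem_frontier_doubleStadium (h0 : 0 < ε) (h1 : ε < 1) {x : Plane} (hx0 : √(1 - ε ^ 2) < x 0)
    (hx1 : x 0 < √(1 - ε ^ 2) / ε) (hx : x 1 = 1) : x ∈ frontier (doubleStadium ε) := by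
  obtain ⟨hc0, hc1, hcb, hc2, hbc⟩ := stadium_bounds h0 h1
  rw [(isOpen_doubleStadium h0 h1).frontier_eq]
  have habs : |x 0| = x 0 := abs_of_pos (hc0.trans hx0)
  constructor
  · have ht : Tendsto (fun t : ℝ => x - t • stdVec 1) (𝓝[>] 0) (𝓝 x) := by
      have : Continuous fun t : ℝ => x - t • (stdVec 1 : Plane) := by fun_prop
      simpa using (this.tendsto 0).mono_left nhdsWithin_le_nhds
    refine mem_closure_of_tendsto ht ?_
    filter_upwards [Ioo_mem_nhdsGT (zero_lt_one' ℝ)] with t ht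
    rw [mem_doubleStadium h0 h1]
    obtain ⟨s00, s01, s10, s11⟩ := stdVec_coord
    simp only [PiLp.sub_apply, PiLp.smul_apply, s10, s11, smul_eq_mul, mul_zero, sub_zero, mul_one,
      habs, hx]
    rw [segmentDistSq_of_mem hx0.le hx1.le]
    nlinarith [ht.1, ht.2]
  · rw [mem_doubleStadium h0 h1, habs, hx, segmentDistSq_of_mem hx0.le hx1.le]
    norm_num

lemma exists_hasTangent_doubleStadium (h0 : 0 < ε) (h1 : ε < 1) :
    ∃ x ∈ frontier (doubleStadium ε), ∃ v, HasTangent (frontier (doubleStadium ε)) x v := by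
  obtain ⟨hc0, hc1, hcb, hc2, hbc⟩ := stadium_bounds h0 h1
  set x : Plane := !₂[(√(1 - ε ^ 2) + √(1 - ε ^ 2) / ε) / 2, 1] with hx
  have hx0 : x 0 = (√(1 - ε ^ 2) + √(1 - ε ^ 2) / ε) / 2 := rfl
  have hx1 : x 1 = 1 := rfl
  obtain ⟨s00, s01, s10, s11⟩ := stdVec_coord
  have hc : ContinuousAt (fun y : Plane => y 0) x := by fun_prop
  have hev : ∀ᶠ y : Plane in 𝓝 x, √(1 - ε ^ 2) < y 0 ∧ y 0 < √(1 - ε ^ 2) / ε :=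
    (hc.eventually (lt_mem_nhds (show √(1 - ε ^ 2) < x 0 by linarith))).and
      (hc.eventually (gt_mem_nhds (show x 0 < √(1 - ε ^ 2) / ε by linarith)))
  have hcurve : HasDerivAt (fun t : ℝ => x + t • (stdVec 0 : Plane)) (stdVec 0) 0 := by
    simpa using ((hasDerivAt_id (0 : ℝ)).smul_const (stdVec 0 : Plane)).const_add x
  have hxx := hev.self_of_nhds
  refine ⟨x, mem_frontier_doubleStadium h0 h1 hxx.1 hxx.2 hx1, stdVec 0,
    hasTangent_of_curve (by simp) hcurve ?_ ?_ (hasFDerivAt_segmentDistSq ε 1 x) ?_ ?_⟩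
  · intro h
    rw [h] at s00
    simp at s00
  · have h2 : Tendsto (fun t : ℝ => x + t • (stdVec 0 : Plane)) (𝓝 0) (𝓝 x) := by
      simpa using hcurve.continuousAt.tendsto
    filter_upwards [h2.eventually hev] with t ht
    exact mem_frontier_doubleStadium h0 h1 ht.1 ht.2 (by simp [hx1])
  · intro h
    have := congrArg (fun ℓ : Plane →L[ℝ] ℝ => ℓ (stdVec 1)) h
    simp [hx1] at this
  · filter_upwards [hev.filter_mono nhdsWithin_le_nhds, self_mem_nhdsWithin] with y hy hyΓ
    have hyΓ := frontier_doubleStadium_subset h0 h1 hyΓ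
    rw [mem_ofPred_eq, abs_of_pos (hc0.trans hy.1)] at hyΓ
    rw [one_mul, one_mul, hyΓ, segmentDistSq_of_mem hxx.1.le hxx.2.le, hx1, one_pow]

lemma not_horganPayneInequality_doubleStadium (h0 : 0 < ε) (hε : ε ≤ 1 / 1000) :
    ¬ HorganPayneInequality (doubleStadium ε) 0 := by
  have h1 : ε < 1 := by linarith
  obtain ⟨hc0, hc1, hcb, hc2, hbc⟩ := stadium_bounds h0 h1
  have hstar := isStarShapedBall_doubleStadium h0 h1
  have hchalf : 1 / 2 ≤ √(1 - ε ^ 2) := by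
    apply Real.le_sqrt_of_sq_le
    nlinarith
  refine not_horganPayneInequality h0 (exists_hasTangent_doubleStadium h0 h1)
    (fun x _ v hv => le_sin_lineAngle_doubleStadium h0 h1 hv) ?_
  obtain ⟨hAm, hAv⟩ := volume_real_box (S := Ioo (√(1 - ε ^ 2)) (√(1 - ε ^ 2) / ε))
    (T := Ioo (-1) 1) measurableSet_Ioo measurableSet_Ioo
  rw [Real.volume_real_Ioo_of_le hcb.le, Real.volume_real_Ioo_of_le (by norm_num)] at hAv
  have hvol : 1 / (2 * ε) ≤ volume.real {x : Plane | x 0 ∈ Ioo (√(1 - ε ^ 2)) (√(1 - ε ^ 2) / ε) ∧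
      x 1 ∈ Ioo (-1 : ℝ) 1} := by
    rw [hAv, div_le_iff₀ (by positivity)]
    nlinarith
  have hvpos := (show 0 < 1 / (2 * ε) by positivity).trans_le hvol
  refine (infSupConstant_le_of_neck (a := ε) (s := 1 / 2) hstar.isBounded ?_ h0 ?_
    hAm ?_ (by norm_num) (by norm_num) ?_ hvpos).trans_lt ?_
  · intro x hx
    rw [mem_doubleStadium h0 h1] at hx ⊢
    simpa using hx
  · intro x hx hx0
    rw [mem_doubleStadium h0 h1, hx0, abs_zero, segmentDistSq, max_eq_left (by linarith),
      max_eq_right (by linarith), sub_zero, hc2] at hx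
    exact abs_lt_of_sq_lt_sq (by linarith) h0.le
  · rintro x ⟨⟨h1, h2⟩, h3, h4⟩
    exact Or.inl (Or.inl (Or.inl ⟨h1, h2, h3, h4⟩))
  · rintro x ⟨⟨h1, h2⟩, h3⟩
    have := (le_abs_self (x 0)).trans (abs_coord_le_norm x 0)
    linarith
  · have hκ : ((1 - (1 / 2 : ℝ) ^ 2) ^ 3 * (1 + 2 * (1 / 2) ^ 2)) ^ 2 = 6561 / 16384 := by norm_num
    rw [hκ, Real.sqrt_lt' (by positivity), div_lt_iff₀ (by positivity)]
    have hπ : Real.pi < 4 := Real.pi_lt_four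
    have h4 : 0 < ε ^ 2 := by positivity
    have h5 : 188 * Real.pi / 35 * ε ^ 2 ≤ 22 * ε ^ 2 := by nlinarith
    refine h5.trans_lt ?_
    calc 22 * ε ^ 2 < (ε / 2) ^ 2 * (6561 / 16384 * 500) := by linarith
      _ ≤ (ε / 2) ^ 2 * (6561 / 16384 * (1 / (2 * ε))) := by
        gcongr
        rw [le_div_iff₀ (by positivity)]
        linarith
      _ ≤ _ := by gcongr

end Stadium

section Cupid

variable {c : ℝ}

/-- The point of the closed first quadrant of `ℂ` with the coordinates `|x 0|` and `|x 1|`. -/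
noncomputable def foldedPoint (x : Plane) : ℂ := ⟨|x 0|, |x 1|⟩

lemma norm_foldedPoint (x : Plane) : ‖foldedPoint x‖ = ‖x‖ := by
  rw [← pow_left_inj₀ (norm_nonneg _) (norm_nonneg _) two_ne_zero, plane_norm_sq, Complex.sq_norm,
    Complex.normSq_apply]
  simp [foldedPoint, ← pow_two]

lemma norm_foldedPoint_sub_le (x y : Plane) : ‖foldedPoint x - foldedPoint y‖ ≤ ‖x - y‖ := by
  refine (pow_le_pow_iff_left₀ (norm_nonneg _) (norm_nonneg _) two_ne_zero).1 ?_
  rw [plane_norm_sq, Complex.sq_norm, Complex.normSq_apply]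
  have h : ∀ a b : ℝ, (|a| - |b|) * (|a| - |b|) ≤ (a - b) ^ 2 := by
    intro a b
    rw [← pow_two]
    exact sq_le_sq.2 (abs_abs_sub_abs_le_abs_sub a b)
  exact add_le_add (h _ _) (h _ _)

lemma foldedPoint_smul {t : ℝ} (ht : 0 ≤ t) (x : Plane) :
    foldedPoint (t • x) = t * foldedPoint x := by
  apply Complex.ext <;> simp [foldedPoint, abs_mul, abs_of_nonneg ht]

lemma foldedPoint_ne_zero {x : Plane} (hx : x ≠ 0) : foldedPoint x ≠ 0 := by
  rw [← norm_pos_iff, norm_foldedPoint]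
  exact norm_pos_iff.2 hx

lemma arg_foldedPoint_nonneg (x : Plane) : 0 ≤ (foldedPoint x).arg :=
  Complex.arg_nonneg_iff.2 (abs_nonneg _)

lemma arg_le_pi_div_two {z : ℂ} (hz : 0 ≤ z.re) : z.arg ≤ Real.pi / 2 :=
  (le_abs_self _).trans (Complex.abs_arg_le_pi_div_two_iff.2 hz)

/-- The gauge of the Cupid's bow. -/
noncomputable def cupidGauge (c : ℝ) (x : Plane) : ℝ := ‖x‖ * Real.exp (c * (foldedPoint x).arg)

lemma cupidGauge_smul (c t : ℝ) (ht : 0 ≤ t) (x : Plane) :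
    cupidGauge c (t • x) = t * cupidGauge c x := by
  rcases ht.eq_or_lt with rfl | h
  · simp [cupidGauge]
  · rw [cupidGauge, cupidGauge, foldedPoint_smul ht, Complex.arg_real_mul _ h, norm_smul,
      Real.norm_of_nonneg ht, mul_assoc]

lemma norm_le_cupidGauge (hc : 0 < c) (x : Plane) : 1 * ‖x‖ ≤ cupidGauge c x := by
  rw [cupidGauge, mul_comm]
  gcongr
  exact Real.one_le_exp (mul_nonneg hc.le (arg_foldedPoint_nonneg x))

/-- The exponent of the power function whose level lines are logarithmic spirals. -/
noncomputable def spiralExponent (c : ℝ) : ℂ := ⟨1, -c⟩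

lemma norm_cpow_spiralExponent {z : ℂ} (hz : z ≠ 0) :
    ‖z ^ spiralExponent c‖ = ‖z‖ * Real.exp (c * z.arg) := by
  rw [Complex.norm_cpow_of_ne_zero hz]
  simp only [spiralExponent, Real.rpow_one, mul_neg, Real.exp_neg, div_inv_eq_mul, mul_comm]

lemma mem_slitPlane_of_quadrant {z : ℂ} (h0 : 0 ≤ z.re) (hz : z ≠ 0) : z ∈ Complex.slitPlane := by
  rw [Complex.mem_slitPlane_iff]
  by_contra! h
  exact hz (Complex.ext (le_antisymm h.1 h0) h.2)

lemma convex_quadrant : Convex ℝ {z : ℂ | 0 ≤ z.re ∧ 0 ≤ z.im ∧ z ≠ 0} := by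
  rintro z ⟨hz0, hz1, hz⟩ w ⟨hw0, hw1, hw⟩ a b ha hb hab
  have e0 : (a • z + b • w).re = a * z.re + b * w.re := by simp
  have e1 : (a • z + b • w).im = a * z.im + b * w.im := by simp
  have p0 := mul_nonneg ha hz0
  have p1 := mul_nonneg ha hz1
  have p2 := mul_nonneg hb hw0
  have p3 := mul_nonneg hb hw1
  refine ⟨by rw [e0]; linarith, by rw [e1]; linarith, fun h => ?_⟩
  have q0 := e0.symm.trans (congrArg Complex.re h)
  have q1 := e1.symm.trans (congrArg Complex.im h)
  simp only [Complex.zero_re, Complex.zero_im] at q0 q1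
  rcases ha.eq_or_lt with rfl | ha
  · have hb1 : b = 1 := by linarith
    subst hb1
    exact hw (Complex.ext (by simp; linarith) (by simp; linarith))
  · refine hz (Complex.ext ?_ ?_)
    · have : a * z.re = 0 := by linarith
      simpa [ha.ne'] using this
    · have : a * z.im = 0 := by linarith
      simpa [ha.ne'] using this

lemma norm_cpow_sub_le (hc : 0 < c) {z w : ℂ} (hz : z ∈ {z : ℂ | 0 ≤ z.re ∧ 0 ≤ z.im ∧ z ≠ 0})
    (hw : w ∈ {z : ℂ | 0 ≤ z.re ∧ 0 ≤ z.im ∧ z ≠ 0}) :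
    ‖w ^ spiralExponent c - z ^ spiralExponent c‖ ≤
      (1 + c) * Real.exp (c * (Real.pi / 2)) * ‖w - z‖ := by
  refine convex_quadrant.norm_image_sub_le_of_norm_hasDerivWithin_le
    (f := fun z : ℂ => z ^ spiralExponent c)
    (f' := fun z => spiralExponent c * z ^ (spiralExponent c - 1) * 1) ?_ ?_ hz hw
  · rintro u ⟨h0, h1, hu⟩
    exact ((hasDerivAt_id u).cpow_const (mem_slitPlane_of_quadrant h0 hu)).hasDerivWithinAt
  · rintro u ⟨h0, h1, hu⟩
    rw [mul_one, norm_mul, Complex.norm_cpow_of_ne_zero hu]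
    have e0 : (spiralExponent c - 1).re = 0 := by simp [spiralExponent]
    have e1 : (spiralExponent c - 1).im = -c := by simp [spiralExponent]
    rw [e0, e1, Real.rpow_zero, one_div, ← Real.exp_neg]
    gcongr
    · refine (Complex.norm_le_abs_re_add_abs_im _).trans ?_
      simp [spiralExponent, abs_of_pos hc]
    · have := mul_le_mul_of_nonneg_left (arg_le_pi_div_two h0) hc.le
      linarith

lemma foldedPoint_mem_quadrant {x : Plane} (hx : x ≠ 0) :
    foldedPoint x ∈ {z : ℂ | 0 ≤ z.re ∧ 0 ≤ z.im ∧ z ≠ 0} :=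
  ⟨abs_nonneg _, abs_nonneg _, foldedPoint_ne_zero hx⟩

lemma cupidGauge_eq_norm {x : Plane} (hx : x ≠ 0) :
    cupidGauge c x = ‖foldedPoint x ^ spiralExponent c‖ := by
  rw [norm_cpow_spiralExponent (foldedPoint_ne_zero hx), norm_foldedPoint, cupidGauge]

lemma cupidGauge_nonneg (c : ℝ) (x : Plane) : 0 ≤ cupidGauge c x := by
  unfold cupidGauge
  positivity

lemma cupidGauge_le_add (hc : 0 < c) (x y : Plane) :
    cupidGauge c x ≤ cupidGauge c y + (1 + c) * Real.exp (c * (Real.pi / 2)) * ‖x - y‖ := by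
  by_cases hx : x = 0
  · have := cupidGauge_nonneg c y
    rw [hx, cupidGauge, norm_zero, zero_mul]
    positivity
  by_cases hy : y = 0
  · have h1 : Real.exp (c * (foldedPoint x).arg) ≤ Real.exp (c * (Real.pi / 2)) := by
      gcongr
      exact arg_le_pi_div_two (abs_nonneg _)
    rw [hy, sub_zero]
    have e : cupidGauge c 0 = 0 := by simp [cupidGauge]
    rw [e, zero_add, cupidGauge, mul_comm]
    gcongr
    have := Real.exp_pos (c * (Real.pi / 2))
    nlinarith
  rw [cupidGauge_eq_norm hx, cupidGauge_eq_norm hy]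
  have h := norm_cpow_sub_le hc (foldedPoint_mem_quadrant hy) (foldedPoint_mem_quadrant hx)
  have h2 := norm_sub_norm_le (foldedPoint x ^ spiralExponent c) (foldedPoint y ^ spiralExponent c)
  have h3 := mul_le_mul_of_nonneg_left (norm_foldedPoint_sub_le x y)
    (show 0 ≤ (1 + c) * Real.exp (c * (Real.pi / 2)) by positivity)
  linarith

lemma continuous_cupidGauge (hc : 0 < c) : Continuous (cupidGauge c) := by
  refine (LipschitzWith.of_le_add_mul ⟨(1 + c) * Real.exp (c * (Real.pi / 2)), by positivity⟩
    fun x y => ?_).continuous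
  rw [dist_eq_norm]
  exact cupidGauge_le_add hc x y

lemma cupidGauge_polar (c : ℝ) {r θ : ℝ} (hr : 0 ≤ r) (h1 : -Real.pi ≤ θ) (h2 : θ ≤ Real.pi) :
    cupidGauge c !₂[r * Real.cos θ, r * Real.sin θ] =
      r * Real.exp (c * (Real.pi / 2 - |Real.pi / 2 - (|θ|)|)) := by
  have hn : ‖(!₂[r * Real.cos θ, r * Real.sin θ] : Plane)‖ = r := by
    rw [← pow_left_inj₀ (norm_nonneg _) hr two_ne_zero, plane_norm_sq]
    simp only [Matrix.cons_val_zero, Matrix.cons_val_one]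
    linear_combination r ^ 2 * Real.cos_sq_add_sin_sq θ
  rcases hr.eq_or_lt with rfl | hr0
  · rw [cupidGauge, hn, zero_mul, zero_mul]
  rw [cupidGauge, hn]
  congr 3
  have hθ : |θ| ≤ Real.pi := abs_le.2 ⟨h1, h2⟩
  have hθ0 := abs_nonneg θ
  have hπ := Real.pi_pos
  set ψ := Real.pi / 2 - |Real.pi / 2 - (|θ|)| with hψ
  have hcs : |Real.cos θ| = Real.cos ψ ∧ |Real.sin θ| = Real.sin ψ ∧ ψ ∈ Ioc (-Real.pi) Real.pi := by
    rw [Real.abs_sin_eq_sin_abs_of_abs_le_pi hθ, ← Real.cos_abs θ]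
    rcases le_total (|θ|) (Real.pi / 2) with h | h
    · have e : ψ = |θ| := by
        rw [hψ, abs_of_nonneg (sub_nonneg.2 h)]
        ring
      rw [e]
      exact ⟨abs_of_nonneg (Real.cos_nonneg_of_neg_pi_div_two_le_of_le (by linarith) h), rfl,
        by linarith, hθ⟩
    · have e : ψ = Real.pi - |θ| := by
        rw [hψ, abs_of_nonpos (sub_nonpos.2 h)]
        ring
      rw [e, Real.cos_pi_sub, Real.sin_pi_sub]
      exact ⟨abs_of_nonpos (Real.cos_nonpos_of_pi_div_two_le_of_le h (by linarith)), rfl,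
        by linarith, by linarith⟩
  have e : foldedPoint !₂[r * Real.cos θ, r * Real.sin θ] =
      r * (Complex.cos ψ + Complex.sin ψ * Complex.I) := by
    rw [← Complex.ofReal_cos, ← Complex.ofReal_sin]
    apply Complex.ext
    · simp [foldedPoint, abs_mul, abs_of_pos hr0, hcs.1, -Complex.ofReal_cos, -Complex.ofReal_sin]
    · simp [foldedPoint, abs_mul, abs_of_pos hr0, hcs.2.1, -Complex.ofReal_cos, -Complex.ofReal_sin]
  rw [e, Complex.arg_mul_cos_add_sin_mul_I hr0 hcs.2.2]

lemma cupidsBow_eq (c : ℝ) : cupidsBow c = {x | cupidGauge c x < 1} := by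
  have key : ∀ r ψ : ℝ, r * Real.exp (c * ψ) < 1 ↔ r < Real.exp (-c * ψ) := by
    intro r ψ
    rw [neg_mul, Real.exp_neg, ← one_div, lt_div_iff₀ (Real.exp_pos _)]
  ext x
  constructor
  · rintro ⟨r, θ, h1, h2, hr, hlt, rfl⟩
    change cupidGauge c _ < 1
    rwa [cupidGauge_polar c hr h1 h2, key]
  · intro hx
    have hx : cupidGauge c x < 1 := hx
    have e : x = !₂[‖toComplex x‖ * Real.cos (toComplex x).arg,
        ‖toComplex x‖ * Real.sin (toComplex x).arg] := by
      rw [Complex.norm_mul_cos_arg, Complex.norm_mul_sin_arg]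
      ext i
      fin_cases i <;> simp
    refine ⟨‖toComplex x‖, (toComplex x).arg, (Complex.neg_pi_lt_arg _).le, Complex.arg_le_pi _,
      norm_nonneg _, ?_, e⟩
    rw [e, cupidGauge_polar c (norm_nonneg _) (Complex.neg_pi_lt_arg _).le
      (Complex.arg_le_pi _), key] at hx
    exact hx

lemma isStarShapedBall_cupidsBow (hc : 0 < c) : IsStarShapedBall (cupidsBow c) 0 := by
  rw [cupidsBow_eq]
  exact isStarShapedBall_of_gauge (L := (1 + c) * Real.exp (c * (Real.pi / 2))) (by positivity)
    one_pos (cupidGauge_smul c) (cupidGauge_le_add hc) (norm_le_cupidGauge hc)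

lemma frontier_cupidsBow (hc : 0 < c) : frontier (cupidsBow c) = {x | cupidGauge c x = 1} := by
  rw [cupidsBow_eq]
  exact frontier_gauge (continuous_cupidGauge hc) (cupidGauge_smul c)

/-- The linear map `x ↦ s * x 0 + t * x 1 * I`. -/
noncomputable def quadrantMap (s t : ℝ) : Plane →L[ℝ] ℂ :=
  (coordForm s 0).smulRight (1 : ℂ) + (coordForm 0 t).smulRight Complex.I

@[simp] lemma quadrantMap_re (s t : ℝ) (x : Plane) : (quadrantMap s t x).re = s * x 0 := by
  simp [quadrantMap]

@[simp] lemma quadrantMap_im (s t : ℝ) (x : Plane) : (quadrantMap s t x).im = t * x 1 := by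
  simp [quadrantMap]

/-- The logarithm of `cupidGauge` in a quadrant. -/
noncomputable def logCupidGauge (c s t : ℝ) (x : Plane) : ℝ :=
  (spiralExponent c * Complex.log (quadrantMap s t x)).re

lemma hasFDerivAt_logCupidGauge {s t : ℝ} {x : Plane}
    (hx : quadrantMap s t x ∈ Complex.slitPlane) :
    ∃ ℓ : Plane →L[ℝ] ℝ, HasFDerivAt (logCupidGauge c s t) ℓ x ∧
      ∀ v, ℓ v = (spiralExponent c * ((quadrantMap s t x)⁻¹ * quadrantMap s t v)).re := by
  have h1 := (Complex.hasStrictFDerivAt_log_real hx).hasFDerivAt.comp x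
    (quadrantMap s t).hasFDerivAt
  have h2 := Complex.reCLM.hasFDerivAt.comp x (h1.const_mul (spiralExponent c))
  exact ⟨_, h2, fun v => by simp⟩

lemma logCupidGauge_eq {s t : Bool} {x : Plane} (hs : 0 ≤ boolSign s * x 0)
    (ht : 0 ≤ boolSign t * x 1) (hx : cupidGauge c x = 1) :
    logCupidGauge c (boolSign s) (boolSign t) x = 0 := by
  have e : quadrantMap (boolSign s) (boolSign t) x = foldedPoint x := by
    apply Complex.ext
    · simp [foldedPoint, abs_eq_boolSign_mul hs]
    · simp [foldedPoint, abs_eq_boolSign_mul ht]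
  have hx0 : x ≠ 0 := by
    rintro rfl
    simp [cupidGauge] at hx
  have hn : 0 < ‖x‖ := norm_pos_iff.2 hx0
  rw [logCupidGauge, e, Complex.mul_re, Complex.log_re, Complex.log_im, norm_foldedPoint]
  have h := congrArg Real.log hx
  rw [cupidGauge, Real.log_mul hn.ne' (Real.exp_pos _).ne', Real.log_exp, Real.log_one] at h
  simp only [spiralExponent]
  linarith

lemma quadrantMap_mem_slitPlane {s t : Bool} {x : Plane} (hs : 0 ≤ boolSign s * x 0)
    (ht : 0 ≤ boolSign t * x 1) (hx : x ≠ 0) :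
    quadrantMap (boolSign s) (boolSign t) x ∈ Complex.slitPlane ∧
      ‖quadrantMap (boolSign s) (boolSign t) x‖ = ‖x‖ := by
  have e : quadrantMap (boolSign s) (boolSign t) x = foldedPoint x := by
    apply Complex.ext
    · simp [foldedPoint, abs_eq_boolSign_mul hs]
    · simp [foldedPoint, abs_eq_boolSign_mul ht]
  rw [e]
  exact ⟨mem_slitPlane_of_quadrant (abs_nonneg _) (foldedPoint_ne_zero hx), norm_foldedPoint x⟩

lemma ne_zero_of_cupidGauge {x : Plane} (hx : cupidGauge c x = 1) : x ≠ 0 := by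
  rintro rfl
  simp [cupidGauge] at hx

lemma le_sin_lineAngle_cupidsBow (hc : 0 < c) {x v : Plane}
    (hv : HasTangent (frontier (cupidsBow c)) x v) :
    1 / √(1 + c ^ 2) ≤ Real.sin (lineAngle x v) := by
  have hm2 : (1 / √(1 + c ^ 2)) ^ 2 = 1 / (1 + c ^ 2) := by
    rw [div_pow, one_pow, Real.sq_sqrt (by positivity)]
  refine le_sin_lineAngle_of_cover isClosed_frontier (ι := Bool × Bool)
    (C := fun i => {x | 0 ≤ boolSign i.1 * x 0 ∧ 0 ≤ boolSign i.2 * x 1})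
    (F := fun i => logCupidGauge c (boolSign i.1) (boolSign i.2)) (b := 0) ?_ ?_ (by positivity)
    ?_ ?_ hv
  · intro i
    exact (isClosed_le (f := fun _ : Plane => (0 : ℝ)) (g := fun x => boolSign i.1 * x 0)
      (by fun_prop) (by fun_prop)).inter (isClosed_le (f := fun _ : Plane => (0 : ℝ))
      (g := fun x => boolSign i.2 * x 1) (by fun_prop) (by fun_prop))
  · intro y _
    obtain ⟨b0, h0⟩ := exists_boolSign (y 0)
    obtain ⟨b1, h1⟩ := exists_boolSign (y 1)
    exact mem_iUnion.2 ⟨(b0, b1), show 0 ≤ boolSign b0 * y 0 from h0 ▸ abs_nonneg (y 0),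
      show 0 ≤ boolSign b1 * y 1 from h1 ▸ abs_nonneg (y 1)⟩
  · rintro i y ⟨hy, h0, h1⟩
    rw [frontier_cupidsBow hc] at hy
    exact logCupidGauge_eq h0 h1 hy
  · rintro ⟨b0, b1⟩ y ⟨hy, h0, h1⟩
    rw [frontier_cupidsBow hc] at hy
    have hy0 : y ≠ 0 := ne_zero_of_cupidGauge hy
    obtain ⟨hsl, hn⟩ := quadrantMap_mem_slitPlane h0 h1 hy0
    obtain ⟨ℓ, h1, h2⟩ := hasFDerivAt_logCupidGauge (c := c) hsl
    refine ⟨ℓ, h1, ?_⟩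
    have hz : quadrantMap (boolSign b0) (boolSign b1) y ≠ 0 := Complex.slitPlane_ne_zero hsl
    have hℓ : ℓ y = 1 := by
      rw [h2, inv_mul_cancel₀ hz]
      simp [spiralExponent]
    obtain ⟨s00, s01, s10, s11⟩ := stdVec_coord
    set ζ := spiralExponent c * (quadrantMap (boolSign b0) (boolSign b1) y)⁻¹ with hζ
    have e0 : ℓ (stdVec 0) = boolSign b0 * ζ.re := by
      have : quadrantMap (boolSign b0) (boolSign b1) (stdVec 0) = (boolSign b0 : ℂ) := by
        apply Complex.ext <;> simp
      rw [h2, this, ← mul_assoc, ← hζ, Complex.re_mul_ofReal, mul_comm]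
    have e1 : ℓ (stdVec 1) = -(boolSign b1 * ζ.im) := by
      have : quadrantMap (boolSign b0) (boolSign b1) (stdVec 1) = (boolSign b1 : ℂ) * Complex.I := by
        apply Complex.ext <;> simp
      rw [h2, this, ← mul_assoc, ← hζ]
      simp
      ring
    have hsum : ℓ (stdVec 0) ^ 2 + ℓ (stdVec 1) ^ 2 = (1 + c ^ 2) / ‖y‖ ^ 2 := by
      have : ‖ζ‖ ^ 2 = (1 + c ^ 2) / ‖y‖ ^ 2 := by
        rw [hζ, norm_mul, norm_inv, hn, mul_pow, inv_pow, Complex.sq_norm, Complex.normSq_apply]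
        simp only [spiralExponent]
        ring
      rw [← this, e0, e1, Complex.sq_norm, Complex.normSq_apply]
      linear_combination ζ.re ^ 2 * boolSign_sq b0 + ζ.im ^ 2 * boolSign_sq b1
    rw [hℓ, hsum, hm2]
    have : 0 < ‖y‖ := norm_pos_iff.2 hy0
    refine ⟨one_ne_zero, le_of_eq ?_⟩
    field_simp

lemma exists_hasTangent_cupidsBow (hc : 0 < c) :
    ∃ x ∈ frontier (cupidsBow c), ∃ v, HasTangent (frontier (cupidsBow c)) x v := by
  rw [frontier_cupidsBow hc]
  have hπ := Real.pi_pos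
  obtain ⟨s00, s01, s10, s11⟩ := stdVec_coord
  set γ : ℝ → Plane := fun t =>
    (Real.exp (-c * (Real.pi / 4 + t)) * Real.cos (Real.pi / 4 + t)) • stdVec 0 +
    (Real.exp (-c * (Real.pi / 4 + t)) * Real.sin (Real.pi / 4 + t)) • stdVec 1 with hγ
  have hmem : ∀ᶠ t in 𝓝 (0 : ℝ), cupidGauge c (γ t) = 1 := by
    filter_upwards [Ioo_mem_nhds (show -(Real.pi / 4) < 0 by linarith)
      (show 0 < Real.pi / 4 by linarith)] with t ht
    have e : γ t = !₂[Real.exp (-c * (Real.pi / 4 + t)) * Real.cos (Real.pi / 4 + t),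
        Real.exp (-c * (Real.pi / 4 + t)) * Real.sin (Real.pi / 4 + t)] := by
      ext i
      fin_cases i <;> simp [hγ]
    rw [e, cupidGauge_polar c (Real.exp_pos _).le (by linarith [ht.1]) (by linarith [ht.2]),
      abs_of_pos (show 0 < Real.pi / 4 + t by linarith [ht.1]),
      abs_of_pos (show 0 < Real.pi / 2 - (Real.pi / 4 + t) by linarith [ht.2]), ← Real.exp_add,
      ← Real.exp_zero]
    congr 1
    ring
  have hx := hmem.self_of_nhds
  have hd : HasDerivAt (fun t : ℝ => Real.pi / 4 + t) 1 0 := (hasDerivAt_id (0 : ℝ)).const_add _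
  have he := (hd.const_mul (-c)).exp
  have hcurve := ((he.mul hd.cos).smul_const (stdVec 0 : Plane)).add
    ((he.mul hd.sin).smul_const (stdVec 1 : Plane))
  have hcos : 0 < Real.cos (Real.pi / 4) := by rw [Real.cos_pi_div_four]; positivity
  have hsin : 0 < Real.sin (Real.pi / 4) := by rw [Real.sin_pi_div_four]; positivity
  have hE := Real.exp_pos (-c * (Real.pi / 4))
  have g0 : 0 < γ 0 0 := by
    simp only [hγ, add_zero, PiLp.add_apply, PiLp.smul_apply, s00, s10, smul_eq_mul]
    positivity
  have g1 : 0 < γ 0 1 := by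
    simp only [hγ, add_zero, PiLp.add_apply, PiLp.smul_apply, s01, s11, smul_eq_mul]
    positivity
  have b0 : boolSign true = 1 := rfl
  have hnn : ∀ y : Plane, 0 < y 0 → 0 < y 1 → cupidGauge c y = 1 →
      logCupidGauge c (boolSign true) (boolSign true) y = 0 := fun y h0 h1 hy =>
    logCupidGauge_eq (by rw [b0, one_mul]; exact h0.le) (by rw [b0, one_mul]; exact h1.le) hy
  obtain ⟨hsl, hn⟩ := quadrantMap_mem_slitPlane (s := true) (t := true)
    (by rw [b0, one_mul]; exact g0.le) (by rw [b0, one_mul]; exact g1.le) (ne_zero_of_cupidGauge hx)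
  obtain ⟨ℓ, h1, h2⟩ := hasFDerivAt_logCupidGauge (c := c) hsl
  refine ⟨γ 0, hx, _, hasTangent_of_curve (γ := γ) rfl hcurve ?_ hmem h1 ?_ ?_⟩
  · intro h
    have h0 := congrArg (fun y : Plane => y 0) h
    simp only [add_zero, mul_one, PiLp.add_apply, PiLp.smul_apply, s00, s10, smul_eq_mul, mul_zero,
      PiLp.zero_apply] at h0
    nlinarith [mul_pos hE hcos, mul_pos hE hsin, mul_pos hc (mul_pos hE hcos)]
  · intro h
    have := h2 (γ 0)
    rw [h, inv_mul_cancel₀ (Complex.slitPlane_ne_zero hsl)] at this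
    simp [spiralExponent] at this
  · have hcont : ∀ i, ContinuousAt (fun y : Plane => y i) (γ 0) := fun i => by fun_prop
    have hev : ∀ᶠ y : Plane in 𝓝 (γ 0), 0 < y 0 ∧ 0 < y 1 :=
      ((hcont 0).eventually (lt_mem_nhds g0)).and ((hcont 1).eventually (lt_mem_nhds g1))
    filter_upwards [hev.filter_mono nhdsWithin_le_nhds, self_mem_nhdsWithin] with y hy hyΓ
    rw [hnn y hy.1 hy.2 hyΓ, hnn _ g0 g1 hx]

lemma arg_foldedPoint_le {x : Plane} (hx : x 0 ≠ 0) : (foldedPoint x).arg ≤ |x 1| / |x 0| := by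
  have hre : 0 < (foldedPoint x).re := abs_pos.2 hx
  have h := Real.le_tan (arg_foldedPoint_nonneg x) ((le_abs_self _).trans_lt
    (Complex.abs_arg_lt_pi_div_two_iff.2 (Or.inl hre)))
  rwa [Complex.tan_arg] at h

/-- The general bound for the Cupid's bow in terms of two boxes it contains. -/
lemma not_horganPayneInequality_cupidsBow_of_box (hc : 0 < c) {p P w s a : ℝ} (hp : 0 < p)
    (hpP : p < P) (hw : 0 < w) (hs0 : 0 < s) (hs1 : s < 1)
    (ha : a = Real.exp (-(c * (Real.pi / 2))))
    (hbox : ∀ x : Plane, p < |x 0| → |x 0| < P → |x 1| < w → cupidGauge c x < 1)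
    (has : a ≤ s * p)
    (hnum : 188 * Real.pi / 35 * a ^ 2 * (4 * (1 + c ^ 2)) <
      ((1 - s ^ 2) ^ 3 * (1 + 2 * s ^ 2)) ^ 2 * (4 * (P - p) * w)) :
    ¬ HorganPayneInequality (cupidsBow c) 0 := by
  have hstar := isStarShapedBall_cupidsBow hc
  have ha0 : 0 < a := by rw [ha]; exact Real.exp_pos _
  refine not_horganPayneInequality (m := 1 / √(1 + c ^ 2)) (by positivity)
    (exists_hasTangent_cupidsBow hc) (fun x _ v hv => le_sin_lineAngle_cupidsBow hc hv) ?_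
  have hSm : MeasurableSet (Ioo p P ∪ Ioo (-P) (-p)) := measurableSet_Ioo.union measurableSet_Ioo
  have hSabs : ∀ r ∈ Ioo p P ∪ Ioo (-P) (-p), p < |r| ∧ |r| < P := by
    rintro r (⟨h1, h2⟩ | ⟨h1, h2⟩)
    · rw [abs_of_pos (hp.trans h1)]
      exact ⟨h1, h2⟩
    · rw [abs_of_neg (by linarith)]
      exact ⟨by linarith, by linarith⟩
  obtain ⟨hAm, hAv⟩ := volume_real_box (T := Ioo (-w) w) hSm measurableSet_Ioo
  rw [measureReal_union (disjoint_left.2 fun r h1 h2 => by linarith [h1.1, h2.2]) measurableSet_Ioo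
      measure_Ioo_lt_top.ne measure_Ioo_lt_top.ne,
    Real.volume_real_Ioo_of_le hpP.le, Real.volume_real_Ioo_of_le (by linarith),
    Real.volume_real_Ioo_of_le (by linarith)] at hAv
  have hvol : (P - p + (-p - -P)) * (w - -w) = 4 * (P - p) * w := by ring
  rw [hvol] at hAv
  have hPp : 0 < P - p := sub_pos.2 hpP
  refine (infSupConstant_le_of_neck (a := a) (s := s) hstar.isBounded ?_ ha0 ?_
    hAm ?_ hs0 hs1 ?_ (by rw [hAv]; positivity)).trans_lt ?_
  · intro x hx
    rw [cupidsBow_eq] at hx ⊢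
    have : cupidGauge c (planeReflection x) = cupidGauge c x := by
      simp [cupidGauge, foldedPoint]
    exact this.trans_lt hx
  · intro x hx hx0
    rw [cupidsBow_eq] at hx
    by_cases hx1 : x 1 = 0
    · rw [hx1, abs_zero]
      exact ha0
    have hpos : 0 < |x 1| := abs_pos.2 hx1
    have harg : (foldedPoint x).arg = Real.pi / 2 := by
      have : foldedPoint x = (|x 1| : ℝ) * Complex.I := by
        apply Complex.ext <;> simp [foldedPoint, hx0]
      rw [this, Complex.arg_real_mul _ hpos, Complex.arg_I]
    have hx : ‖x‖ * Real.exp (c * (foldedPoint x).arg) < 1 := hx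
    rw [harg, ← lt_div_iff₀ (Real.exp_pos _), one_div, ← Real.exp_neg, ← ha] at hx
    exact (abs_coord_le_norm x 1).trans_lt hx
  · rintro x ⟨h0, h1⟩
    rw [cupidsBow_eq]
    exact hbox x (hSabs _ h0).1 (hSabs _ h0).2 (abs_lt.2 h1)
  · rintro x ⟨h0, h1⟩
    have := (hSabs _ h0).1.trans_le (abs_coord_le_norm x 0)
    nlinarith
  · have hs2 : 0 < 1 - s ^ 2 := by nlinarith
    have hm2 : (1 / √(1 + c ^ 2) / 2) ^ 2 = 1 / (4 * (1 + c ^ 2)) := by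
      rw [div_pow, div_pow, Real.sq_sqrt (by positivity)]
      field_simp
      norm_num
    rw [hAv, Real.sqrt_lt' (by positivity), hm2, div_lt_div_iff₀ (by positivity) (by positivity),
      one_mul]
    exact hnum

lemma eventually_not_horganPayneInequality_cupidsBow :
    ∀ᶠ c : ℝ in atTop, ¬ HorganPayneInequality (cupidsBow c) 0 := by
  have ht := Real.tendsto_pow_mul_exp_neg_atTop_nhds_zero 3
  filter_upwards [eventually_ge_atTop 5, ht.eventually (gt_mem_nhds (show (0 : ℝ) < 1 / 20000 by
    norm_num))] with c hc5 hc3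
  have hc : 0 < c := by linarith
  have hπ3 := Real.pi_gt_three
  have hπ4 := Real.pi_lt_four
  refine not_horganPayneInequality_cupidsBow_of_box hc (p := 1 / 4) (P := 1 / 2)
    (w := 1 / (16 * c)) (s := 1 / 2) (by norm_num) (by norm_num) (by positivity) (by norm_num)
    (by norm_num) rfl ?_ ?_ ?_
  · intro x h1 h2 h3
    have hx0 : x 0 ≠ 0 := abs_pos.1 (by linarith)
    have harg : c * (foldedPoint x).arg ≤ 1 / 4 := by
      have h4 := arg_foldedPoint_le hx0
      have h5 : |x 1| / |x 0| ≤ 1 / (16 * c) / (1 / 4) := by gcongr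
      have h6 : c * (1 / (16 * c) / (1 / 4)) = 1 / 4 := by
        field_simp
        norm_num
      rw [← h6]
      gcongr
      linarith
    have hexp : Real.exp (1 / 4) ≤ 4 / 3 := by
      have := Real.one_sub_le_exp_neg (1 / 4)
      rw [Real.exp_neg] at this
      have h7 := Real.exp_pos (1 / 4)
      rw [le_div_iff₀ (by norm_num)]
      have h8 : Real.exp (1 / 4) * (Real.exp (1 / 4))⁻¹ = 1 := mul_inv_cancel₀ h7.ne'
      nlinarith
    have hw : 1 / (16 * c) ≤ 1 / 80 := by
      apply one_div_le_one_div_of_le <;> linarith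
    have hn : ‖x‖ ≤ 1 / 2 + 1 / 80 := (norm_le_abs_add_abs x).trans (by linarith)
    calc cupidGauge c x ≤ (1 / 2 + 1 / 80) * Real.exp (1 / 4) := by
          unfold cupidGauge
          gcongr
      _ ≤ (1 / 2 + 1 / 80) * (4 / 3) := by gcongr
      _ < 1 := by norm_num
  · rw [Real.exp_neg, inv_le_comm₀ (Real.exp_pos _) (by norm_num)]
    have := Real.add_one_le_exp (c * (Real.pi / 2))
    have : 5 * (3 / 2) ≤ c * (Real.pi / 2) := by gcongr
    norm_num
    linarith
  · have hκ : ((1 - (1 / 2 : ℝ) ^ 2) ^ 3 * (1 + 2 * (1 / 2) ^ 2)) ^ 2 = 6561 / 16384 := by norm_num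
    rw [hκ, ← Real.exp_nat_mul]
    have h1 : Real.exp ((2 : ℕ) * -(c * (Real.pi / 2))) ≤ Real.exp (-c) := by
      apply Real.exp_le_exp.2
      push_cast
      nlinarith
    have h2 : 1 + c ^ 2 ≤ 2 * c ^ 2 := by nlinarith
    calc _ ≤ 188 * 4 / 35 * Real.exp (-c) * (4 * (2 * c ^ 2)) := by gcongr
      _ = 188 * 32 / 35 * (c ^ 3 * Real.exp (-c)) / c := by
        field_simp
        norm_num
      _ < 188 * 32 / 35 * (1 / 20000) / c := by gcongr
      _ ≤ 6561 / 16384 * (1 / 16) / c :=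
        div_le_div_of_nonneg_right (by norm_num) hc.le
      _ = _ := by
        field_simp
        norm_num

lemma exp_lt_of_pow {t ρ : ℝ} (ht : t < 64) (h : ρ ^ 2 < (1 - t / 64) ^ 128) :
    ρ * Real.exp t < 1 := by
  have h1 := Real.one_sub_le_exp_neg (t / 64)
  have h2 : (1 - t / 64) ^ 128 ≤ Real.exp (-t) ^ 2 := by
    have e : Real.exp (-t) ^ 2 = Real.exp (-(t / 64)) ^ 128 := by
      rw [← Real.exp_nat_mul, ← Real.exp_nat_mul]
      congr 1
      push_cast
      ring
    rw [e]
    exact pow_le_pow_left₀ (by linarith) h1 _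
  have h3 := lt_of_pow_lt_pow_left₀ 2 (Real.exp_pos _).le (h.trans_le h2)
  rwa [Real.exp_neg, ← one_div, lt_div_iff₀ (Real.exp_pos _)] at h3

lemma cupidGauge_lt_one {x : Plane} (hc : 0 < c) {lo hi w : ℝ} (hlo : 0 < lo) (hw : 0 ≤ w)
    (h1 : lo ≤ |x 0|) (h2 : |x 0| ≤ hi) (h3 : |x 1| ≤ w) (ht : c * (w / lo) < 64)
    (hnum : hi ^ 2 + w ^ 2 < (1 - c * (w / lo) / 64) ^ 128) : cupidGauge c x < 1 := by
  have hx0 : x 0 ≠ 0 := abs_pos.1 (by linarith)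
  have h4 := arg_foldedPoint_le hx0
  have h5 : |x 1| / |x 0| ≤ w / lo := by gcongr
  have hn : ‖x‖ ^ 2 ≤ hi ^ 2 + w ^ 2 := by
    rw [plane_norm_sq, ← sq_abs (x 0), ← sq_abs (x 1)]
    gcongr
  refine lt_of_le_of_lt ?_ (exp_lt_of_pow ht (hn.trans_lt hnum))
  unfold cupidGauge
  gcongr
  linarith

lemma not_horganPayneInequality_cupidsBow :
    ¬ HorganPayneInequality (cupidsBow 2.58) 0 := by
  have hexp : Real.exp (-(2.58 * (Real.pi / 2))) ^ 2 ≤ 0.000303 := by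
    have h1 : Real.exp (-(2.58 * (Real.pi / 2))) ^ 2 = (Real.exp (2.58 * Real.pi))⁻¹ := by
      rw [← Real.exp_nat_mul, ← Real.exp_neg]
      congr 1
      push_cast
      ring
    have h2 : Real.exp 1 ^ 8 * (1 + 0.105 + 0.105 ^ 2 / 2) ≤ Real.exp (2.58 * Real.pi) := by
      have h3 := Real.quadratic_le_exp_of_nonneg (show (0 : ℝ) ≤ 0.105 by norm_num)
      calc Real.exp 1 ^ 8 * (1 + 0.105 + 0.105 ^ 2 / 2) ≤ Real.exp 1 ^ 8 * Real.exp 0.105 := by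
            gcongr
        _ = Real.exp (8 + 0.105) := by
            rw [Real.exp_add, ← Real.exp_nat_mul]
            norm_num
        _ ≤ _ := by
            apply Real.exp_le_exp.2
            linarith [Real.pi_gt_d4]
    have h4 : (2.7182 : ℝ) ^ 8 ≤ Real.exp 1 ^ 8 := by
      have := Real.exp_one_gt_d9
      gcongr
      linarith
    rw [h1, inv_le_comm₀ (Real.exp_pos _) (by norm_num)]
    refine le_trans ?_ h2
    refine le_trans ?_ (mul_le_mul_of_nonneg_right h4 (by norm_num))
    norm_num
  refine not_horganPayneInequality_cupidsBow_of_box (by norm_num) (p := 0.14) (P := 0.62)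
    (w := 0.09) (s := 1 / 8) (by norm_num) (by norm_num) (by norm_num) (by norm_num)
    (by norm_num) rfl ?_ ?_ ?_
  · intro x h1 h2 h3
    rcases le_total |x 0| 0.162 with g | g
    · exact cupidGauge_lt_one (by norm_num) (lo := 0.14) (by norm_num) (by norm_num) h1.le g h3.le
        (by norm_num) (by norm_num)
    rcases le_total |x 0| 0.21 with g2 | g2
    · exact cupidGauge_lt_one (by norm_num) (by norm_num) (by norm_num) g g2 h3.le
        (by norm_num) (by norm_num)
    rcases le_total |x 0| 0.3 with g3 | g3
    · exact cupidGauge_lt_one (by norm_num) (by norm_num) (by norm_num) g2 g3 h3.le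
        (by norm_num) (by norm_num)
    rcases le_total |x 0| 0.42 with g4 | g4
    · exact cupidGauge_lt_one (by norm_num) (by norm_num) (by norm_num) g3 g4 h3.le
        (by norm_num) (by norm_num)
    rcases le_total |x 0| 0.54 with g5 | g5
    · exact cupidGauge_lt_one (by norm_num) (by norm_num) (by norm_num) g4 g5 h3.le
        (by norm_num) (by norm_num)
    · exact cupidGauge_lt_one (by norm_num) (by norm_num) (by norm_num) g5 h2.le h3.le
        (by norm_num) (by norm_num)
  · refine abs_le_of_sq_le_sq' (hexp.trans ?_) (by norm_num) |>.2
    norm_num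
  · have hπ := Real.pi_lt_d4
    refine lt_of_le_of_lt (b := 188 * 3.1416 / 35 * 0.000303 * (4 * (1 + 2.58 ^ 2))) ?_ ?_
    · gcongr
    · norm_num

end Cupid

section Edge

variable {Ω : Set Plane} {x₀ n p p' : Plane} {d : ℝ}

lemma eq_smul_of_inner_eq_zero {a b : Plane} (hn : n ≠ 0) (hb : b ≠ 0) (ha0 : inner ℝ n a = 0)
    (hb0 : inner ℝ n b = 0) : a = (inner ℝ a b / ‖b‖ ^ 2) • b := by
  rw [plane_inner] at *
  have hnn : ‖n‖ ^ 2 ≠ 0 := by simpa using hn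
  have hbb : ‖b‖ ^ 2 ≠ 0 := by simpa using hb
  rw [plane_norm_sq] at *
  have hdet : a 0 * b 1 - a 1 * b 0 = 0 := by
    have h1 : n 0 * (a 0 * b 1 - a 1 * b 0) = 0 := by linear_combination b 1 * ha0 - a 1 * hb0
    have h2 : n 1 * (a 0 * b 1 - a 1 * b 0) = 0 := by linear_combination a 0 * hb0 - b 0 * ha0
    have h3 : (n 0 ^ 2 + n 1 ^ 2) * (a 0 * b 1 - a 1 * b 0) = 0 := by
      linear_combination n 0 * h1 + n 1 * h2
    exact (mul_eq_zero.1 h3).resolve_left hnn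
  ext i
  fin_cases i
  · simp
    field_simp
    linear_combination b 1 * hdet
  · simp
    field_simp
    linear_combination (-b 0) * hdet

lemma edge_mem_frontier (hΩ : Convex ℝ Ω) (ho : IsOpen Ω) (hd : 0 < d) (hp : p ∈ closure Ω)
    (hp' : p' ∈ closure Ω) (hpn : inner ℝ n (p - x₀) = d) (hpn' : inner ℝ n (p' - x₀) = d)
    (hle : ∀ x ∈ Ω, inner ℝ n (x - x₀) ≤ d) {t : ℝ} (ht : t ∈ Ioo (0 : ℝ) 1) :
    p + t • (p' - p) ∈ frontier Ω := by
  have hn : n ≠ 0 := by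
    rintro rfl
    rw [inner_zero_left] at hpn
    exact hd.ne hpn
  rw [ho.frontier_eq]
  refine ⟨hΩ.closure.add_smul_sub_mem hp hp' ⟨ht.1.le, ht.2.le⟩, fun hmem => ?_⟩
  have hc : Continuous fun s : ℝ => p + t • (p' - p) + s • n := by fun_prop
  have hev : ∀ᶠ s : ℝ in 𝓝 0, p + t • (p' - p) + s • n ∈ Ω :=
    hc.continuousAt.preimage_mem_nhds (by simpa using ho.mem_nhds hmem)
  obtain ⟨s, hs, hs0⟩ := ((hev.filter_mono nhdsWithin_le_nhds).and
    (self_mem_nhdsWithin : Ioi (0 : ℝ) ∈ 𝓝[>] 0)).exists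
  have hs0 : 0 < s := hs0
  have h := hle _ hs
  have e : p + t • (p' - p) + s • n - x₀ = (p - x₀) + t • ((p' - x₀) - (p - x₀)) + s • n := by
    module
  have hb0 : inner ℝ n ((p' - x₀) - (p - x₀)) = 0 := by
    rw [inner_sub_right, hpn, hpn', sub_self]
  rw [e, inner_add_right, inner_add_right, inner_smul_right, inner_smul_right, hb0, hpn,
    real_inner_self_eq_norm_sq] at h
  have : 0 < ‖n‖ := norm_pos_iff.2 hn
  have : 0 < s * ‖n‖ ^ 2 := by positivity
  linarith

lemma edge_hasTangent (hΩ : Convex ℝ Ω) (ho : IsOpen Ω) (hx₀ : x₀ ∈ Ω) (hd : 0 < d)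
    (hp : p ∈ closure Ω) (hp' : p' ∈ closure Ω) (hne : p ≠ p') (hpn : inner ℝ n (p - x₀) = d)
    (hpn' : inner ℝ n (p' - x₀) = d) (hle : ∀ x ∈ Ω, inner ℝ n (x - x₀) ≤ d) {t : ℝ}
    (ht : t ∈ Ioo (0 : ℝ) 1) : HasTangent (frontier Ω) (p + t • (p' - p)) (p' - p) := by
  have hn : n ≠ 0 := by
    rintro rfl
    rw [inner_zero_left] at hpn
    exact hd.ne hpn
  have hb : p' - p ≠ 0 := sub_ne_zero.2 hne.symm
  have hb0 : inner ℝ n (p' - p) = 0 := by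
    have : p' - p = (p' - x₀) - (p - x₀) := by module
    rw [this, inner_sub_right, hpn, hpn', sub_self]
  have hbn : 0 < ‖p' - p‖ := norm_pos_iff.2 hb
  set x := p + t • (p' - p) with hx
  have hxn : inner ℝ n (x - x₀) = d := by
    have : x - x₀ = (p - x₀) + t • (p' - p) := by rw [hx]; module
    rw [this, inner_add_right, inner_smul_right, hb0, hpn, mul_zero, add_zero]
  have hcurve : HasDerivAt (fun s : ℝ => x + s • (p' - p)) (p' - p) 0 := by
    simpa using ((hasDerivAt_id (0 : ℝ)).smul_const (p' - p)).const_add x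
  refine hasTangent_of_curve (by simp) hcurve hb ?_ (innerSL ℝ n).hasFDerivAt ?_ ?_
  · have hc : ContinuousAt (fun s : ℝ => t + s) 0 := by fun_prop
    have : ∀ᶠ s : ℝ in 𝓝 0, t + s ∈ Ioo (0 : ℝ) 1 :=
      hc.preimage_mem_nhds (by simpa using Ioo_mem_nhds ht.1 ht.2)
    filter_upwards [this] with s hs
    have e : x + s • (p' - p) = p + (t + s) • (p' - p) := by rw [hx]; module
    rw [e]
    exact edge_mem_frontier hΩ ho hd hp hp' hpn hpn' hle hs
  · intro h
    have h2 : innerSL ℝ n n = 0 := by rw [h]; rfl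
    rw [innerSL_apply_apply, inner_self_eq_zero] at h2
    exact hn h2
  · set z : Plane → Plane := fun y => x₀ + (d / inner ℝ n (y - x₀)) • (y - x₀) with hz
    have hzc : ContinuousAt z x := by
      have h1 : ContinuousAt (fun y : Plane => inner ℝ n (y - x₀)) x := by fun_prop
      have h2 : ContinuousAt (fun y : Plane => y - x₀) x := by fun_prop
      exact continuousAt_const.add ((continuousAt_const.div h1 (by rw [hxn]; exact hd.ne')).smul h2)
    have hzx : z x = x := by
      simp only [hz, hxn, div_self hd.ne', one_smul]
      module
    have hσc : ContinuousAt (fun y => inner ℝ (z y - p) (p' - p) / ‖p' - p‖ ^ 2) x :=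
      ((hzc.sub continuousAt_const).inner continuousAt_const).div_const _
    have hσx : inner ℝ (z x - p) (p' - p) / ‖p' - p‖ ^ 2 = t := by
      rw [hzx, hx, add_sub_cancel_left, inner_smul_left, real_inner_self_eq_norm_sq]
      simp
      field_simp
    have hνc : ContinuousAt (fun y : Plane => inner ℝ n (y - x₀)) x := by fun_prop
    have hev1 : ∀ᶠ y in 𝓝 x, 0 < inner ℝ n (y - x₀) :=
      hνc.eventually (lt_mem_nhds (show 0 < inner ℝ n (x - x₀) by rw [hxn]; exact hd))
    have hev2 : ∀ᶠ y in 𝓝 x, inner ℝ (z y - p) (p' - p) / ‖p' - p‖ ^ 2 ∈ Ioo (0 : ℝ) 1 :=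
      hσc.preimage_mem_nhds (by rw [hσx]; exact Ioo_mem_nhds ht.1 ht.2)
    filter_upwards [hev1.filter_mono nhdsWithin_le_nhds, hev2.filter_mono nhdsWithin_le_nhds,
      self_mem_nhdsWithin] with y h1 h2 hyΓ
    suffices h : inner ℝ n (y - x₀) = d by
      have e1 : innerSL ℝ n y = inner ℝ n (y - x₀) + inner ℝ n x₀ := by
        rw [innerSL_apply_apply, ← inner_add_right, sub_add_cancel]
      have e2 : innerSL ℝ n x = inner ℝ n (x - x₀) + inner ℝ n x₀ := by
        rw [innerSL_apply_apply, ← inner_add_right, sub_add_cancel]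
      rw [e1, e2, h, hxn]
    have hyle : inner ℝ n (y - x₀) ≤ d := by
      have hcl : IsClosed {y : Plane | inner ℝ n (y - x₀) ≤ d} :=
        isClosed_le (by fun_prop) continuous_const
      exact closure_minimal hle hcl (frontier_subset_closure hyΓ)
    by_contra hne'
    have hlt : inner ℝ n (y - x₀) < d := lt_of_le_of_ne hyle hne'
    set ν := inner ℝ n (y - x₀) with hν
    have hzp : z y - p = (inner ℝ (z y - p) (p' - p) / ‖p' - p‖ ^ 2) • (p' - p) := by
      refine eq_smul_of_inner_eq_zero hn hb ?_ hb0
      have : z y - p = (d / ν) • (y - x₀) - (p - x₀) := by simp only [hz]; module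
      rw [this, inner_sub_right, inner_smul_right, hpn, ← hν, div_mul_cancel₀ _ h1.ne', sub_self]
    have hzcl : z y ∈ closure Ω := by
      have : z y = p + (inner ℝ (z y - p) (p' - p) / ‖p' - p‖ ^ 2) • (p' - p) := by
        rw [← hzp]
        module
      rw [this]
      exact hΩ.closure.add_smul_sub_mem hp hp' ⟨h2.1.le, h2.2.le⟩
    have hyΩ : y ∈ interior Ω := by
      refine hΩ.openSegment_interior_closure_subset_interior (ho.interior_eq.symm ▸ hx₀) hzcl
        ⟨1 - ν / d, ν / d, ?_, by positivity, by ring, ?_⟩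
      · rw [sub_pos, div_lt_one hd]
        exact hlt
      · simp only [hz]
        rw [smul_add, smul_smul]
        have : ν / d * (d / ν) = 1 := by field_simp
        rw [this]
        module
    rw [ho.frontier_eq] at hyΓ
    exact hyΓ.2 (interior_subset hyΩ)

lemma lineAngle_eq_arcsin {a v : Plane} (hv : v ≠ 0) (ha : a ≠ 0) (hn : ‖n‖ = 1)
    (hnv : inner ℝ n v = 0) (hd : 0 ≤ inner ℝ n a) :
    lineAngle a v = Real.arcsin (inner ℝ n a / ‖a‖) := by
  rw [← Real.arcsin_sin (x := lineAngle a v) (by linarith [lineAngle_nonneg a v, Real.pi_pos])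
    (lineAngle_le a v)]
  congr 1
  have hvn : 0 < ‖v‖ := norm_pos_iff.2 hv
  have han : 0 < ‖a‖ := norm_pos_iff.2 ha
  have e := sin_lineAngle_mul a v
  have hn2 : n 0 ^ 2 + n 1 ^ 2 = 1 := by rw [← plane_norm_sq, hn, one_pow]
  have h0 := hnv
  rw [plane_inner] at h0
  have key : (a 0 * v 1 - a 1 * v 0) ^ 2 = (inner ℝ n a * ‖v‖) ^ 2 := by
    rw [mul_pow, plane_norm_sq, plane_inner]
    linear_combination (n 0 * v 0 * (-(a 0) ^ 2 + a 1 ^ 2) + n 1 * v 1 * (a 0 ^ 2 - a 1 ^ 2) -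
      2 * a 0 * a 1 * (n 0 * v 1 + n 1 * v 0)) * h0 - (a 0 * v 1 - a 1 * v 0) ^ 2 * hn2
  have habs : |a 0 * v 1 - a 1 * v 0| = inner ℝ n a * ‖v‖ := by
    rw [← abs_of_nonneg (mul_nonneg hd hvn.le)]
    exact sq_eq_sq_iff_abs_eq_abs _ _ |>.1 key
  rw [habs] at e
  field_simp
  nlinarith

lemma horganPayneAngle_le_of_edge {R : ℝ} (hΩ : Convex ℝ Ω) (ho : IsOpen Ω) (hx₀ : x₀ ∈ Ω)
    (hd : 0 < d) (hn : ‖n‖ = 1)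
    (hp : p ∈ closure Ω) (hp' : p' ∈ closure Ω) (hne : p ≠ p') (hpn : inner ℝ n (p - x₀) = d)
    (hpn' : inner ℝ n (p' - x₀) = d) (hle : ∀ x ∈ Ω, inner ℝ n (x - x₀) ≤ d)
    (hR : ‖p - x₀‖ = R) : horganPayneAngle Ω x₀ ≤ Real.arcsin (d / R) := by
  have hR0 : R ≠ 0 := by
    rintro rfl
    rw [norm_eq_zero] at hR
    rw [hR, inner_zero_right] at hpn
    exact hd.ne hpn
  have hb0 : inner ℝ n (p' - p) = 0 := by
    have : p' - p = (p' - x₀) - (p - x₀) := by module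
    rw [this, inner_sub_right, hpn, hpn', sub_self]
  have hbound : ∀ t ∈ Ioo (0 : ℝ) 1, horganPayneAngle Ω x₀ ≤
      Real.arcsin (d / ‖p + t • (p' - p) - x₀‖) := by
    intro t ht
    have hxn : inner ℝ n (p + t • (p' - p) - x₀) = d := by
      have : p + t • (p' - p) - x₀ = (p - x₀) + t • (p' - p) := by module
      rw [this, inner_add_right, inner_smul_right, hb0, hpn, mul_zero, add_zero]
    refine csInf_le (bddBelow_lineAngles _ _) ⟨_, edge_mem_frontier hΩ ho hd hp hp' hpn hpn' hle ht,
      p' - p, edge_hasTangent hΩ ho hx₀ hd hp hp' hne hpn hpn' hle ht, ?_⟩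
    rw [lineAngle_eq_arcsin (sub_ne_zero.2 hne.symm) ?_ hn hb0 (hxn.symm ▸ hd.le), hxn]
    intro h
    rw [h, inner_zero_right] at hxn
    exact hd.ne hxn
  have hcont : ContinuousAt (fun t : ℝ => Real.arcsin (d / ‖p + t • (p' - p) - x₀‖)) 0 := by
    refine Real.continuous_arcsin.continuousAt.comp (continuousAt_const.div (by fun_prop) ?_)
    simpa [hR] using hR0
  have hlim : Tendsto (fun t : ℝ => Real.arcsin (d / ‖p + t • (p' - p) - x₀‖)) (𝓝[>] 0)
      (𝓝 (Real.arcsin (d / R))) := by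
    have := hcont.tendsto.mono_left (nhdsWithin_le_nhds (s := Ioi 0))
    simpa [hR] using this
  refine ge_of_tendsto hlim ?_
  filter_upwards [Ioo_mem_nhdsGT (zero_lt_one' ℝ)] with t ht
  exact hbound t ht

/-- The Horgan–Payne inequality for a convex domain with an edge that touches the inscribed disc
and ends on the circumscribed circle (both centered at `x₀`). -/
theorem horganPayneInequality_of_edge {R : ℝ} (hΩ : Convex ℝ Ω) (ho : IsOpen Ω) (hd : 0 < d)
    (hin : Metric.ball x₀ d ⊆ Ω) (hout : Ω ⊆ Metric.closedBall x₀ R) (hn : ‖n‖ = 1)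
    (hp : p ∈ closure Ω) (hp' : p' ∈ closure Ω) (hne : p ≠ p') (hpn : inner ℝ n (p - x₀) = d)
    (hpn' : inner ℝ n (p' - x₀) = d) (hle : ∀ x ∈ Ω, inner ℝ n (x - x₀) ≤ d)
    (hR : ‖p - x₀‖ = R) : IsStarShapedBall Ω x₀ ∧ HorganPayneInequality Ω x₀ := by
  have hx₀ : x₀ ∈ Ω := hin (Metric.mem_ball_self hd)
  refine ⟨⟨ho, Metric.isBounded_closedBall.subset hout, d, hd, hin, fun y hy z hz =>
    hΩ.segment_subset (hin hy) hz⟩, ?_⟩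
  have hdR : d ≤ R := by
    rw [← hpn, ← hR]
    refine (real_inner_le_norm _ _).trans ?_
    rw [hn, one_mul]
  have hR0 : 0 < R := hd.trans_le hdR
  have hω := horganPayneAngle_le_of_edge hΩ ho hx₀ hd hn hp hp' hne hpn hpn' hle hR
  have h0 := horganPayneAngle_nonneg Ω x₀
  have hle1 := Real.arcsin_le_pi_div_two (d / R)
  have hπ := Real.pi_pos
  have hdR1 : d / R ≤ 1 := (div_le_one hR0).2 hdR
  have hq : (d / R) ^ 2 ≤ 1 := pow_le_one₀ (by positivity) hdR1
  have hq0 : 0 < (d / R) ^ 2 := by positivity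
  rw [HorganPayneInequality, ge_iff_le]
  calc Real.sin (horganPayneAngle Ω x₀ / 2) ≤ Real.sin (Real.arcsin (d / R) / 2) :=
        Real.sin_le_sin_of_le_of_le_pi_div_two (by linarith) (by linarith) (by linarith)
    _ = √((1 - √(1 - (d / R) ^ 2)) / 2) := by
        rw [Real.sin_half_eq_sqrt (by linarith) (by linarith), Real.cos_arcsin]
    _ ≤ _ := by
        refine le_infSupConstant_of_convex hΩ ho hd (Real.sqrt_nonneg _) ?_ hR0 ?_ hin hout
        · rw [Real.sqrt_lt' one_pos]
          linarith
        · rw [Real.sq_sqrt (by linarith)]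
          field_simp
          ring

end Edge

section Polygon

variable {S : Set Plane} {x₀ : Plane} {d : ℝ}

lemma interior_convexHull_isBounded (hS : S.Finite) :
    Bornology.IsBounded (interior (convexHull ℝ S)) :=
  (hS.isCompact_convexHull ℝ).isBounded.subset interior_subset

lemma ball_subset_of_support (hS : S.Finite)
    (h : ∀ w : Plane, ∃ s ∈ S, d * ‖w‖ ≤ inner ℝ w (s - x₀)) :
    Metric.ball x₀ d ⊆ convexHull ℝ S := by
  intro x hx
  by_contra hxS
  obtain ⟨f, u, hfu, hux⟩ := geometric_hahn_banach_closed_point (convex_convexHull ℝ S)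
    (hS.isClosed_convexHull ℝ) hxS
  set w := (InnerProductSpace.toDual ℝ Plane).symm f with hw
  have hfw : ∀ y, f y = inner ℝ w y := fun y => by
    rw [hw, InnerProductSpace.toDual_symm_apply]
  obtain ⟨s, hs, hsd⟩ := h w
  have h1 := (hfu s (subset_convexHull ℝ S hs)).trans hux
  rw [hfw, hfw] at h1
  have h2 : inner ℝ w (x - x₀) ≤ ‖w‖ * ‖x - x₀‖ := real_inner_le_norm _ _
  rw [mem_ball_iff_norm] at hx
  rw [inner_sub_right] at hsd h2
  nlinarith [norm_nonneg w]

/-- The Horgan–Payne inequality for a convex polygon with vertices `S`. -/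
theorem horganPayneInequality_of_vertices {R : ℝ} {n p p' : Plane} (hd : 0 < d)
    (hin : Metric.ball x₀ d ⊆ convexHull ℝ S) (hout : ∀ s ∈ S, ‖s - x₀‖ ≤ R) (hn : ‖n‖ = 1)
    (hp : p ∈ S) (hp' : p' ∈ S) (hne : p ≠ p') (hpn : inner ℝ n (p - x₀) = d)
    (hpn' : inner ℝ n (p' - x₀) = d) (hle : ∀ s ∈ S, inner ℝ n (s - x₀) ≤ d)
    (hR : ‖p - x₀‖ = R) :
    IsStarShapedBall (interior (convexHull ℝ S)) x₀ ∧
      HorganPayneInequality (interior (convexHull ℝ S)) x₀ := by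
  have hin' : Metric.ball x₀ d ⊆ interior (convexHull ℝ S) :=
    interior_maximal hin Metric.isOpen_ball
  have hcl : ∀ s ∈ S, s ∈ closure (interior (convexHull ℝ S)) := by
    intro s hs
    rw [(convex_convexHull ℝ S).closure_interior_eq_closure_of_nonempty_interior
      ⟨x₀, hin' (Metric.mem_ball_self hd)⟩]
    exact subset_closure (subset_convexHull ℝ S hs)
  refine horganPayneInequality_of_edge (convex_convexHull ℝ S).interior isOpen_interior hd hin' ?_
    hn (hcl p hp) (hcl p' hp') hne hpn hpn' ?_ hR
  · refine interior_subset.trans (convexHull_min (fun s hs => ?_) (convex_closedBall x₀ R))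
    rw [mem_closedBall_iff_norm]
    exact hout s hs
  · intro x hx
    have hc : Convex ℝ {x : Plane | inner ℝ n (x - x₀) ≤ d} := by
      have : {x : Plane | inner ℝ n (x - x₀) ≤ d} = {x | innerSL ℝ n x ≤ d + inner ℝ n x₀} := by
        ext x
        simp [inner_sub_right]
      rw [this]
      exact convex_halfSpace_le (innerSL ℝ n).toLinearMap.isLinear _
    exact convexHull_min hle hc (interior_subset hx)

/-- The barycenter of a polygon is a fixed point of its affine symmetries. -/
lemma barycenter_fixed (hS : S.Finite) (hne : (interior (convexHull ℝ S)).Nonempty)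
    (A : Plane ≃L[ℝ] Plane) (b : Plane) (hAS : (fun x => A x + b) '' S = S) :
    A (barycenter (interior (convexHull ℝ S))) + b = barycenter (interior (convexHull ℝ S)) := by
  set Ω := interior (convexHull ℝ S) with hΩ
  have hm : MeasurableSet Ω := isOpen_interior.measurableSet
  have hpos : 0 < volume.real Ω := by
    refine ENNReal.toReal_pos (isOpen_interior.measure_pos volume hne).ne' ?_
    exact (interior_convexHull_isBounded hS).measure_lt_top.ne
  have himg : (fun x => A x + b) '' Ω = Ω := by
    have h1 := (A.toHomeomorph.trans (Homeomorph.addRight b)).image_interior (convexHull ℝ S)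
    have h2 := (A.toLinearMap.toAffineMap + AffineMap.const ℝ Plane b).image_convexHull S
    have e1 : ⇑(A.toHomeomorph.trans (Homeomorph.addRight b)) = fun x => A x + b := rfl
    have e2 : ⇑(A.toLinearMap.toAffineMap + AffineMap.const ℝ Plane b) = fun x => A x + b := rfl
    rw [e1] at h1
    rw [e2, hAS] at h2
    rw [hΩ, h1, h2]
  have hder : ∀ x ∈ Ω, HasFDerivWithinAt (fun x => A x + b) (A : Plane →L[ℝ] Plane) Ω x :=
    fun x _ => (A.hasFDerivAt.add_const b).hasFDerivWithinAt
  have hinj : InjOn (fun x => A x + b) Ω := fun x _ y _ h => A.injective (add_right_cancel h)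
  have h1 := integral_image_eq_integral_abs_det_fderiv_smul volume hm hder hinj (fun _ => (1 : ℝ))
  have h2 := integral_image_eq_integral_abs_det_fderiv_smul volume hm hder hinj (fun x => x)
  rw [himg] at h1 h2
  simp only [setIntegral_const, smul_eq_mul, mul_one] at h1
  have hdet : |(A : Plane →L[ℝ] Plane).det| = 1 := by
    have : volume.real Ω * (|(A : Plane →L[ℝ] Plane).det| - 1) = 0 := by linarith
    have := (mul_eq_zero.1 this).resolve_left hpos.ne'
    linarith
  have hfin : IsFiniteMeasure (volume.restrict Ω) :=
    ⟨by simpa using (interior_convexHull_isBounded hS).measure_lt_top⟩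
  have hint : IntegrableOn (fun x : Plane => x) Ω := by
    obtain ⟨C, hC⟩ := (interior_convexHull_isBounded hS).exists_norm_le
    exact Integrable.of_bound aestronglyMeasurable_id C
      ((ae_restrict_iff' hm).2 (Eventually.of_forall fun x hx => hC x hx))
  simp only [hdet, one_smul] at h2
  have h3 : ∫ x in Ω, (A x + b) = A (∫ x in Ω, x) + volume.real Ω • b := by
    have hAi : IntegrableOn (fun x => A x) Ω := (A : Plane →L[ℝ] Plane).integrable_comp hint
    rw [integral_add hAi (integrable_const b), setIntegral_const]
    congr 1
    exact (A : Plane →L[ℝ] Plane).integral_comp_comm hint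
  rw [h3] at h2
  rw [barycenter, setAverage_eq]
  conv_rhs => rw [h2]
  rw [map_smul, smul_add, smul_smul, inv_mul_cancel₀ hpos.ne', one_smul]

end Polygon

section Symmetry

variable {a b c d : ℝ}

/-- The unimodular linear map of the plane with the matrix `(a, b; c, d)`. -/
noncomputable def planeEquiv (a b c d : ℝ) (h : a * d - b * c = 1) : Plane ≃L[ℝ] Plane :=
  LinearEquiv.toContinuousLinearEquiv
    { toFun := fun y => !₂[a * y 0 + b * y 1, c * y 0 + d * y 1]
      invFun := fun y => !₂[d * y 0 - b * y 1, a * y 1 - c * y 0]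
      map_add' := fun x y => by ext i; fin_cases i <;> simp <;> ring
      map_smul' := fun t y => by ext i; fin_cases i <;> simp <;> ring
      left_inv := fun y => by
        ext i
        fin_cases i
        · simp
          linear_combination y 0 * h
        · simp
          linear_combination y 1 * h
      right_inv := fun y => by
        ext i
        fin_cases i
        · simp
          linear_combination y 0 * h
        · simp
          linear_combination y 1 * h }

lemma planeEquiv_apply (h : a * d - b * c = 1) (y : Plane) :
    planeEquiv a b c d h y = !₂[a * y 0 + b * y 1, c * y 0 + d * y 1] := rfl

lemma eq_zero_of_planeEquiv_eq (h : a * d - b * c = 1) (h1 : a + d ≠ 2) {y : Plane}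
    (hy : planeEquiv a b c d h y = y) : y = 0 := by
  have e0 : a * y 0 + b * y 1 = y 0 := congrArg (fun z : Plane => z 0) hy
  have e1 : c * y 0 + d * y 1 = y 1 := congrArg (fun z : Plane => z 1) hy
  have h2 : 2 - (a + d) ≠ 0 := sub_ne_zero.2 h1.symm
  ext i
  fin_cases i
  · refine (mul_eq_zero.1 (?_ : (2 - (a + d)) * y 0 = 0)).resolve_left h2
    linear_combination (d - 1) * e0 - b * e1 - y 0 * h
  · refine (mul_eq_zero.1 (?_ : (2 - (a + d)) * y 1 = 0)).resolve_left h2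
    linear_combination (a - 1) * e1 - c * e0 - y 1 * h

/-- The Horgan–Payne inequality with respect to the barycenter, for a polygon with vertices `S`
whose symmetry with center `x₀` has no other fixed point. -/
theorem horganPayneInequality_barycenter {S : Set Plane} {x₀ n p p' : Plane} {δ R : ℝ}
    (hS : S.Finite) (hδ : 0 < δ)
    (hin : Metric.ball x₀ δ ⊆ convexHull ℝ S) (hout : ∀ s ∈ S, ‖s - x₀‖ ≤ R) (hn : ‖n‖ = 1)
    (hp : p ∈ S) (hp' : p' ∈ S) (hne : p ≠ p') (hpn : inner ℝ n (p - x₀) = δ)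
    (hpn' : inner ℝ n (p' - x₀) = δ) (hle : ∀ s ∈ S, inner ℝ n (s - x₀) ≤ δ)
    (hR : ‖p - x₀‖ = R) (h : a * d - b * c = 1) (h1 : a + d ≠ 2)
    (hsymm : ∀ s ∈ S, x₀ + planeEquiv a b c d h (s - x₀) ∈ S) :
    IsStarShapedBall (interior (convexHull ℝ S)) (barycenter (interior (convexHull ℝ S))) ∧
      HorganPayneInequality (interior (convexHull ℝ S))
        (barycenter (interior (convexHull ℝ S))) := by
  have hnon : (interior (convexHull ℝ S)).Nonempty :=
    ⟨x₀, interior_maximal hin Metric.isOpen_ball (Metric.mem_ball_self hδ)⟩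
  set A := planeEquiv a b c d h
  have e : ∀ x, A x + (x₀ - A x₀) = x₀ + A (x - x₀) := fun x => by rw [map_sub]; module
  have himg : (fun x => A x + (x₀ - A x₀)) '' S = S := by
    have hsub : (fun x => A x + (x₀ - A x₀)) '' S ⊆ S := by
      rintro _ ⟨x, hx, rfl⟩
      simp only [e]
      exact hsymm x hx
    refine eq_of_subset_of_ncard_le hsub (le_of_eq ?_) hS
    exact (ncard_image_of_injective S fun x y hxy => A.injective (add_right_cancel hxy)).symm
  have hfix := barycenter_fixed hS hnon A (x₀ - A x₀) himg
  set m := barycenter (interior (convexHull ℝ S))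
  have hm : m = x₀ := by
    rw [e] at hfix
    refine sub_eq_zero.1 (eq_zero_of_planeEquiv_eq h h1 ?_)
    change A (m - x₀) = m - x₀
    exact eq_sub_of_add_eq' hfix
  rw [hm]
  exact horganPayneInequality_of_vertices hδ hin hout hn hp hp' hne hpn hpn' hle hR

end Symmetry

section Parallelogram

lemma inner_sq_mul_add_inner_sq_mul {f g : Plane} (h : inner ℝ f g = 0) (w : Plane) :
    inner ℝ w f ^ 2 * ‖g‖ ^ 2 + inner ℝ w g ^ 2 * ‖f‖ ^ 2 = ‖w‖ ^ 2 * ‖f‖ ^ 2 * ‖g‖ ^ 2 := by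
  simp only [plane_norm_sq, plane_inner] at *
  linear_combination ((w 0 ^ 2 - w 1 ^ 2) * (f 0 * g 0 - f 1 * g 1) +
    2 * w 0 * w 1 * (f 0 * g 1 + f 1 * g 0)) * h

lemma planeEquiv_neg_apply (h : (-1 : ℝ) * -1 - 0 * 0 = 1) (y : Plane) :
    planeEquiv (-1) 0 0 (-1) h y = -y := by
  rw [planeEquiv_apply]
  ext i
  fin_cases i <;> simp

lemma horganPayneInequality_rhombus_of_le {c f g : Plane} (hf : f ≠ 0) (hg : g ≠ 0)
    (hfg : inner ℝ f g = 0) (hle : ‖g‖ ≤ ‖f‖) {S : Set Plane}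
    (hS : S = {c - f, c + g, c + f, c - g}) :
    IsStarShapedBall (interior (convexHull ℝ S)) (barycenter (interior (convexHull ℝ S))) ∧
      HorganPayneInequality (interior (convexHull ℝ S))
        (barycenter (interior (convexHull ℝ S))) := by
  have hF : 0 < ‖f‖ := norm_pos_iff.2 hf
  have hG : 0 < ‖g‖ := norm_pos_iff.2 hg
  set N := √(‖f‖ ^ 2 + ‖g‖ ^ 2)
  have hN : 0 < N := Real.sqrt_pos.2 (by positivity)
  have hN2 : N ^ 2 = ‖f‖ ^ 2 + ‖g‖ ^ 2 := Real.sq_sqrt (by positivity)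
  set d := ‖f‖ * ‖g‖ / N with hd
  have hd0 : 0 < d := by positivity
  set n : Plane := d • ((1 / ‖f‖ ^ 2) • f + (1 / ‖g‖ ^ 2) • g) with hn
  have hgf : inner ℝ g f = 0 := by rw [real_inner_comm]; exact hfg
  have hnf : inner ℝ n f = d := by
    simp only [hn, inner_smul_left, inner_add_left, hgf, real_inner_self_eq_norm_sq]
    simp
    field_simp
  have hng : inner ℝ n g = d := by
    simp only [hn, inner_smul_left, inner_add_left, hfg, real_inner_self_eq_norm_sq]
    simp
    field_simp
  have hn1 : ‖n‖ = 1 := by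
    have h := inner_sq_mul_add_inner_sq_mul hfg n
    rw [hnf, hng] at h
    have hdN : d ^ 2 * N ^ 2 = ‖f‖ ^ 2 * ‖g‖ ^ 2 := by rw [hd]; field_simp
    have h2 : ‖n‖ ^ 2 = 1 := by
      have h3 : ‖f‖ ^ 2 * ‖g‖ ^ 2 ≠ 0 := by positivity
      refine mul_right_cancel₀ h3 ?_
      rw [hN2] at hdN
      linear_combination hdN - h
    nlinarith [norm_nonneg n]
  have hsup : ∀ w : Plane, ∃ s ∈ S, d * ‖w‖ ≤ inner ℝ w (s - c) := by
    intro w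
    have hw := inner_sq_mul_add_inner_sq_mul hfg w
    have key : ∀ M : ℝ, 0 ≤ M → inner ℝ w f ^ 2 ≤ M ^ 2 → inner ℝ w g ^ 2 ≤ M ^ 2 →
        d * ‖w‖ ≤ M := by
      intro M hM h1 h2
      refine (sq_le_sq₀ (by positivity) hM).1 ?_
      rw [hd, mul_pow, div_pow, hN2, div_mul_eq_mul_div, div_le_iff₀ (by positivity)]
      nlinarith [mul_le_mul_of_nonneg_right h1 (sq_nonneg ‖g‖),
        mul_le_mul_of_nonneg_right h2 (sq_nonneg ‖f‖)]
    rcases le_total |inner ℝ w g| |inner ℝ w f| with h | h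
    · have := key _ (abs_nonneg _) (sq_abs _).ge (sq_le_sq.2 (by rwa [abs_abs]))
      rcases abs_cases (inner ℝ w f : ℝ) with ⟨e, -⟩ | ⟨e, -⟩
      · exact ⟨c + f, by simp [hS], by rwa [add_sub_cancel_left, ← e]⟩
      · exact ⟨c - f, by simp [hS], by rwa [sub_sub_cancel_left, inner_neg_right, ← e]⟩
    · have := key _ (abs_nonneg _) (sq_le_sq.2 (by rwa [abs_abs])) (sq_abs _).ge
      rcases abs_cases (inner ℝ w g : ℝ) with ⟨e, -⟩ | ⟨e, -⟩
      · exact ⟨c + g, by simp [hS], by rwa [add_sub_cancel_left, ← e]⟩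
      · exact ⟨c - g, by simp [hS], by rwa [sub_sub_cancel_left, inner_neg_right, ← e]⟩
  have hSf : S.Finite := by rw [hS]; exact toFinite _
  refine horganPayneInequality_barycenter (x₀ := c) (n := n) (p := c + f) (p' := c + g) (δ := d)
    (R := ‖f‖) (a := -1) (b := 0) (c := 0) (d := -1) hSf hd0 (ball_subset_of_support hSf hsup)
    ?_ hn1 (by simp [hS]) (by simp [hS]) ?_ (by rwa [add_sub_cancel_left])
    (by rwa [add_sub_cancel_left]) ?_ (by rw [add_sub_cancel_left]) (by norm_num) (by norm_num) ?_
  · rw [hS]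
    rintro s (rfl | rfl | rfl | rfl)
    · simp
    · simpa using hle
    · simp
    · simpa using hle
  · intro h
    rw [add_left_cancel h, real_inner_self_eq_norm_sq] at hfg
    exact hG.ne' (pow_eq_zero_iff two_ne_zero |>.1 hfg)
  · rw [hS]
    rintro s (rfl | rfl | rfl | rfl)
    · rw [sub_sub_cancel_left, inner_neg_right, hnf]; linarith
    · rw [add_sub_cancel_left, hng]
    · rw [add_sub_cancel_left, hnf]
    · rw [sub_sub_cancel_left, inner_neg_right, hng]; linarith
  · intro s hs
    rw [planeEquiv_neg_apply]
    rw [hS] at hs ⊢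
    rcases hs with rfl | rfl | rfl | rfl <;> simp [← sub_eq_add_neg]

theorem horganPayneInequality_of_isRhombus {Ω : Set Plane} (h : IsRhombus Ω) :
    IsStarShapedBall Ω (barycenter Ω) ∧ HorganPayneInequality Ω (barycenter Ω) := by
  obtain ⟨p, u, v, huv, hnorm, rfl⟩ := h
  rw [LinearIndependent.pair_iff] at huv
  set f : Plane := (1 / 2 : ℝ) • (u + v) with hf
  set g : Plane := (1 / 2 : ℝ) • (u - v) with hg
  have hf0 : f ≠ 0 := fun h0 => by
    have := huv (1 / 2) (1 / 2) (by rw [← h0, hf]; module)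
    norm_num at this
  have hg0 : g ≠ 0 := fun h0 => by
    have := huv (1 / 2) (-1 / 2) (by rw [← h0, hg]; module)
    norm_num at this
  have hfg : inner ℝ f g = 0 := by
    rw [hf, hg, inner_smul_left, inner_smul_right, (real_inner_add_sub_eq_zero_iff u v).2 hnorm]
    simp
  have e1 : p = p + f - f := by module
  have e2 : p + u = p + f + g := by rw [hf, hg]; module
  have e3 : p + u + v = p + f + f := by rw [hf]; module
  have e4 : p + v = p + f - g := by rw [hf, hg]; module
  rcases le_total ‖g‖ ‖f‖ with hle | hle
  · refine horganPayneInequality_rhombus_of_le (c := p + f) hf0 hg0 hfg hle ?_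
    rw [← e1, ← e2, ← e3, ← e4]
  · refine horganPayneInequality_rhombus_of_le (c := p + f) hg0 hf0
      (by rw [real_inner_comm]; exact hfg) hle ?_
    rw [← e1, ← e2, ← e3, ← e4]
    ext x
    simp only [mem_insert_iff, mem_singleton_iff]
    tauto

lemma horganPayneInequality_rectangle_of_le {q u v : Plane} (hu : u ≠ 0) (hv : v ≠ 0)
    (huv : inner ℝ u v = 0) (hle : ‖u‖ ≤ ‖v‖) {S : Set Plane}
    (hS : S = {q, q + u, q + u + v, q + v}) :
    IsStarShapedBall (interior (convexHull ℝ S)) (barycenter (interior (convexHull ℝ S))) ∧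
      HorganPayneInequality (interior (convexHull ℝ S))
        (barycenter (interior (convexHull ℝ S))) := by
  have hU : 0 < ‖u‖ := norm_pos_iff.2 hu
  have hV : 0 < ‖v‖ := norm_pos_iff.2 hv
  have hvu : inner ℝ v u = 0 := by rw [real_inner_comm]; exact huv
  set c : Plane := q + (1 / 2 : ℝ) • (u + v) with hc
  have e1 : q - c = -((1 / 2 : ℝ) • (u + v)) := by rw [hc]; module
  have e2 : q + u - c = (1 / 2 : ℝ) • (u - v) := by rw [hc]; module
  have e3 : q + u + v - c = (1 / 2 : ℝ) • (u + v) := by rw [hc]; module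
  have e4 : q + v - c = -((1 / 2 : ℝ) • (u - v)) := by rw [hc]; module
  have hnorm : ‖u - v‖ = ‖u + v‖ := by
    refine (sq_eq_sq₀ (norm_nonneg _) (norm_nonneg _)).1 ?_
    rw [norm_sub_sq_real, norm_add_sq_real, huv]
    ring
  have hsup : ∀ w : Plane, ∃ s ∈ S, ‖u‖ / 2 * ‖w‖ ≤ inner ℝ w (s - c) := by
    intro w
    have hw := inner_sq_mul_add_inner_sq_mul huv w
    have key : ‖u‖ * ‖w‖ ≤ |inner ℝ w u| + |inner ℝ w v| := by
      refine (sq_le_sq₀ (by positivity) (by positivity)).1 ?_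
      have h1 : (‖u‖ * ‖w‖) ^ 2 * ‖v‖ ^ 2 ≤ (inner ℝ w u ^ 2 + inner ℝ w v ^ 2) * ‖v‖ ^ 2 := by
        nlinarith [mul_le_mul_of_nonneg_left (pow_le_pow_left₀ hU.le hle 2)
          (sq_nonneg (inner ℝ w v : ℝ))]
      have h2 := le_of_mul_le_mul_right h1 (by positivity)
      nlinarith [sq_abs (inner ℝ w u : ℝ), sq_abs (inner ℝ w v : ℝ),
        mul_nonneg (abs_nonneg (inner ℝ w u : ℝ)) (abs_nonneg (inner ℝ w v : ℝ))]
    have hplus : inner ℝ w ((1 / 2 : ℝ) • (u + v)) = (inner ℝ w u + inner ℝ w v) / 2 := by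
      rw [inner_smul_right, inner_add_right]; ring
    have hminus : inner ℝ w ((1 / 2 : ℝ) • (u - v)) = (inner ℝ w u - inner ℝ w v) / 2 := by
      rw [inner_smul_right, inner_sub_right]; ring
    rcases abs_cases (inner ℝ w u : ℝ) with ⟨h1, -⟩ | ⟨h1, -⟩ <;>
      rcases abs_cases (inner ℝ w v : ℝ) with ⟨h2, -⟩ | ⟨h2, -⟩ <;> rw [h1, h2] at key
    · exact ⟨q + u + v, by simp [hS], by rw [e3, hplus]; linarith⟩
    · exact ⟨q + u, by simp [hS], by rw [e2, hminus]; linarith⟩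
    · exact ⟨q + v, by simp [hS], by rw [e4, inner_neg_right, hminus]; linarith⟩
    · exact ⟨q, by simp [hS], by rw [e1, inner_neg_right, hplus]; linarith⟩
  have hSf : S.Finite := by rw [hS]; exact toFinite _
  have hnplus : inner ℝ ((1 / ‖u‖) • u) ((1 / 2 : ℝ) • (u + v)) = ‖u‖ / 2 := by
    rw [inner_smul_left, inner_smul_right, inner_add_right, huv, real_inner_self_eq_norm_sq]
    simp
    field_simp
  have hnminus : inner ℝ ((1 / ‖u‖) • u) ((1 / 2 : ℝ) • (u - v)) = ‖u‖ / 2 := by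
    rw [inner_smul_left, inner_smul_right, inner_sub_right, huv, real_inner_self_eq_norm_sq]
    simp
    field_simp
  refine horganPayneInequality_barycenter (x₀ := c) (n := (1 / ‖u‖) • u) (p := q + u + v)
    (p' := q + u) (δ := ‖u‖ / 2) (R := ‖(1 / 2 : ℝ) • (u + v)‖) (a := -1) (b := 0) (c := 0)
    (d := -1) hSf (by positivity) (ball_subset_of_support hSf hsup) ?_ ?_ (by simp [hS])
    (by simp [hS]) (by simpa using hv) (by rw [e3, hnplus]) (by rw [e2, hnminus]) ?_ (by rw [e3])
    (by norm_num) (by norm_num) ?_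
  · rw [hS]
    rintro s (rfl | rfl | rfl | rfl)
    · rw [e1, norm_neg]
    · rw [e2, norm_smul, norm_smul, hnorm]
    · rw [e3]
    · rw [e4, norm_neg, norm_smul, norm_smul, hnorm]
  · rw [norm_smul, norm_div, norm_one, norm_norm]
    field_simp
  · rw [hS]
    rintro s (rfl | rfl | rfl | rfl)
    · rw [e1, inner_neg_right, hnplus]; linarith
    · rw [e2, hnminus]
    · rw [e3, hnplus]
    · rw [e4, inner_neg_right, hnminus]; linarith
  · intro s hs
    rw [planeEquiv_neg_apply]
    have s1 : c + -(q - c) = q + u + v := by rw [hc]; module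
    have s2 : c + -(q + u - c) = q + v := by rw [hc]; module
    have s3 : c + -(q + u + v - c) = q := by rw [hc]; module
    have s4 : c + -(q + v - c) = q + u := by rw [hc]; module
    rw [hS] at hs ⊢
    rcases hs with rfl | rfl | rfl | rfl
    · rw [s1]; simp
    · rw [s2]; simp
    · rw [s3]; simp
    · rw [s4]; simp

theorem horganPayneInequality_of_isRectangle {Ω : Set Plane} (h : IsRectangle Ω) :
    IsStarShapedBall Ω (barycenter Ω) ∧ HorganPayneInequality Ω (barycenter Ω) := by
  obtain ⟨p, u, v, hu, hv, huv, rfl⟩ := h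
  rcases le_total ‖u‖ ‖v‖ with hle | hle
  · exact horganPayneInequality_rectangle_of_le hu hv huv hle rfl
  · refine horganPayneInequality_rectangle_of_le (q := p) hv hu
      (by rw [real_inner_comm]; exact huv) hle ?_
    have : p + v + u = p + u + v := by module
    rw [this]
    ext x
    simp only [mem_insert_iff, mem_singleton_iff]
    tauto

end Parallelogram

section Triangle

lemma horganPayneInequality_triangle_of_le {g A B C : Plane} (hsum : A + B + C = 0)
    (hκ : A 0 * B 1 - A 1 * B 0 ≠ 0) (hBA : ‖B‖ ≤ ‖A‖) (hCB : ‖C‖ ≤ ‖B‖) {S : Set Plane}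
    (hS : S = {g + A, g + B, g + C}) :
    IsStarShapedBall (interior (convexHull ℝ S)) (barycenter (interior (convexHull ℝ S))) ∧
      HorganPayneInequality (interior (convexHull ℝ S))
        (barycenter (interior (convexHull ℝ S))) := by
  set κ := A 0 * B 1 - A 1 * B 0 with hκd
  have hC : C = -A - B := by
    rw [eq_sub_iff_add_eq, ← sub_eq_zero, ← hsum]
    module
  have hC0 : C 0 = -A 0 - B 0 := by rw [hC]; rfl
  have hC1 : C 1 = -A 1 - B 1 := by rw [hC]; rfl
  have hAB : A ≠ B := by
    rintro rfl
    exact hκ (by rw [hκd]; ring)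
  have hD : 0 < ‖A - B‖ := norm_pos_iff.2 (sub_ne_zero.2 hAB)
  have hκ0 : 0 < |κ| := abs_pos.2 hκ
  set d := |κ| / ‖A - B‖ with hd
  have hd0 : 0 < d := by positivity
  have hBC2 : ‖B - C‖ ^ 2 ≤ ‖A - B‖ ^ 2 := by
    have h1 := pow_le_pow_left₀ (norm_nonneg _) hBA 2
    have h2 := pow_le_pow_left₀ (norm_nonneg _) hCB 2
    simp only [plane_norm_sq, PiLp.sub_apply, hC0, hC1] at h1 h2 ⊢
    nlinarith
  have hCA2 : ‖C - A‖ ^ 2 ≤ ‖A - B‖ ^ 2 := by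
    have h1 := pow_le_pow_left₀ (norm_nonneg _) hBA 2
    have h2 := pow_le_pow_left₀ (norm_nonneg _) hCB 2
    simp only [plane_norm_sq, PiLp.sub_apply, hC0, hC1] at h1 h2 ⊢
    nlinarith
  have hbary : ∀ (P Q w : Plane), ‖Q - P‖ ^ 2 ≤ ‖A - B‖ ^ 2 → ‖w‖ < d →
      (w 0 * (Q 1 - P 1) - w 1 * (Q 0 - P 0)) / κ ≤ 1 := by
    intro P Q w h hw
    refine (le_abs_self _).trans ?_
    rw [abs_div, div_le_one hκ0]
    refine (sq_le_sq₀ (by positivity) hκ0.le).1 ?_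
    have hwD : ‖w‖ * ‖A - B‖ ≤ |κ| := ((lt_div_iff₀ hD).1 hw).le
    have h2 : (w 0 * (Q 1 - P 1) - w 1 * (Q 0 - P 0)) ^ 2 ≤ ‖w‖ ^ 2 * ‖Q - P‖ ^ 2 := by
      simp only [plane_norm_sq, PiLp.sub_apply]
      nlinarith [sq_nonneg (w 0 * (Q 0 - P 0) + w 1 * (Q 1 - P 1))]
    rw [sq_abs]
    calc _ ≤ ‖w‖ ^ 2 * ‖Q - P‖ ^ 2 := h2
      _ ≤ ‖w‖ ^ 2 * ‖A - B‖ ^ 2 := by gcongr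
      _ = (‖w‖ * ‖A - B‖) ^ 2 := by ring
      _ ≤ |κ| ^ 2 := by gcongr
  have hin : Metric.ball g d ⊆ convexHull ℝ S := by
    intro x hx
    rw [mem_ball_iff_norm] at hx
    set w := x - g with hw
    have h1 := hbary A B w (by rw [norm_sub_rev]) hx
    have h2 := hbary B C w (by rw [norm_sub_rev]; exact hBC2) hx
    have h3 := hbary C A w (by rw [norm_sub_rev]; exact hCA2) hx
    set l1 := (w 0 * (B 1 - A 1) - w 1 * (B 0 - A 0)) / κ with hl1
    set l2 := (w 0 * (C 1 - B 1) - w 1 * (C 0 - B 0)) / κ with hl2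
    set l3 := (w 0 * (A 1 - C 1) - w 1 * (A 0 - C 0)) / κ with hl3
    have hl : l1 + l2 + l3 = 0 := by
      rw [hl1, hl2, hl3]
      field_simp
      ring
    have hmem : ∀ i ∈ (Finset.univ : Finset (Fin 3)),
        (![g + A, g + B, g + C] : Fin 3 → Plane) i ∈ convexHull ℝ S := by
      intro i _
      apply subset_convexHull
      fin_cases i <;> simp [hS]
    have hcomb := (convex_convexHull ℝ S).sum_mem (t := Finset.univ)
      (w := ![(1 - l2) / 3, (1 - l3) / 3, (1 - l1) / 3]) (by
        intro i _
        fin_cases i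
        · show 0 ≤ (1 - l2) / 3
          linarith
        · show 0 ≤ (1 - l3) / 3
          linarith
        · show 0 ≤ (1 - l1) / 3
          linarith) (by
        rw [Fin.sum_univ_three]
        show (1 - l2) / 3 + (1 - l3) / 3 + (1 - l1) / 3 = 1
        linarith) hmem
    rw [Fin.sum_univ_three] at hcomb
    have hwx : x = ((1 - l2) / 3) • (g + A) + ((1 - l3) / 3) • (g + B) +
        ((1 - l1) / 3) • (g + C) := by
      have hxw : ∀ i, x i = g i + w i := fun i => by rw [hw]; simp
      ext i
      fin_cases i
      · simp only [Fin.zero_eta, PiLp.add_apply, PiLp.smul_apply, smul_eq_mul, hxw, hC0]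
        rw [hl1, hl2, hl3, hC0, hC1]
        field_simp
        rw [hκd]
        ring
      · simp only [Fin.mk_one, PiLp.add_apply, PiLp.smul_apply, smul_eq_mul, hxw, hC1]
        rw [hl1, hl2, hl3, hC0, hC1]
        field_simp
        rw [hκd]
        ring
    rw [hwx]
    exact hcomb
  set n : Plane := (d / κ) • !₂[B 1 - A 1, A 0 - B 0] with hn
  have hninner : ∀ y : Plane, inner ℝ n y = d / κ * ((B 1 - A 1) * y 0 + (A 0 - B 0) * y 1) := by
    intro y
    rw [hn, inner_smul_left, plane_inner]
    simp
  have hnA : inner ℝ n A = d := by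
    rw [hninner]
    have : (B 1 - A 1) * A 0 + (A 0 - B 0) * A 1 = κ := by rw [hκd]; ring
    rw [this]
    field_simp
  have hnB : inner ℝ n B = d := by
    rw [hninner]
    have : (B 1 - A 1) * B 0 + (A 0 - B 0) * B 1 = κ := by rw [hκd]; ring
    rw [this]
    field_simp
  have hnC : inner ℝ n C ≤ d := by
    rw [hC, inner_sub_right, inner_neg_right, hnA, hnB]
    linarith
  have hn1 : ‖n‖ = 1 := by
    have h1 : ‖(!₂[B 1 - A 1, A 0 - B 0] : Plane)‖ = ‖A - B‖ := by
      refine (sq_eq_sq₀ (norm_nonneg _) (norm_nonneg _)).1 ?_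
      rw [plane_norm_sq, plane_norm_sq]
      simp
      ring
    rw [hn, norm_smul, h1, norm_div, Real.norm_eq_abs, Real.norm_eq_abs, abs_of_pos hd0, hd]
    field_simp
  have hdet : (B 0 * B 1 - A 1 * C 0) / κ * ((-B 0 * B 1 + A 0 * C 1) / κ) -
      (-B 0 ^ 2 + A 0 * C 0) / κ * ((B 1 ^ 2 - A 1 * C 1) / κ) = 1 := by
    rw [hC0, hC1]
    field_simp
    rw [hκd]
    ring
  have hmap : ∀ y : Plane, ∀ s t : ℝ, y = s • A + t • B →
      planeEquiv _ _ _ _ hdet y = s • B + t • C := by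
    rintro y s t rfl
    rw [planeEquiv_apply]
    ext i
    fin_cases i
    · simp [hC0, hC1]
      field_simp
      rw [hκd]
      ring
    · simp [hC0, hC1]
      field_simp
      rw [hκd]
      ring
  have hSf : S.Finite := by rw [hS]; exact toFinite _
  refine horganPayneInequality_barycenter (x₀ := g) (n := n) (p := g + A) (p' := g + B) (δ := d)
    (R := ‖A‖) hSf hd0 hin ?_ hn1 (by simp [hS]) (by simp [hS]) (by simpa using hAB)
    (by rwa [add_sub_cancel_left]) (by rwa [add_sub_cancel_left]) ?_
    (by rw [add_sub_cancel_left]) hdet ?_ ?_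
  · rw [hS]
    rintro s (rfl | rfl | rfl) <;> rw [add_sub_cancel_left]
    · exact hBA
    · exact hCB.trans hBA
  · rw [hS]
    rintro s (rfl | rfl | rfl) <;> rw [add_sub_cancel_left]
    · exact hnA.le
    · exact hnB.le
    · exact hnC
  · have : (B 0 * B 1 - A 1 * C 0) / κ + (-B 0 * B 1 + A 0 * C 1) / κ = -1 := by
      rw [hC0, hC1]
      field_simp
      rw [hκd]
      ring
    rw [this]
    norm_num
  · intro s hs
    rw [hS] at hs ⊢
    rcases hs with rfl | rfl | rfl <;> rw [add_sub_cancel_left]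
    · rw [hmap A 1 0 (by module)]; simp
    · rw [hmap B 0 1 (by module)]; simp
    · have : (-1 : ℝ) • B + (-1 : ℝ) • C = A := by rw [hC]; module
      rw [hmap C (-1) (-1) (by rw [hC]; module), this]; simp

theorem horganPayneInequality_of_isTriangle {Ω : Set Plane} (h : IsTriangle Ω) :
    IsStarShapedBall Ω (barycenter Ω) ∧ HorganPayneInequality Ω (barycenter Ω) := by
  obtain ⟨p₀, hp₀, rfl⟩ := h
  set g : Plane := (1 / 3 : ℝ) • (p₀ 0 + p₀ 1 + p₀ 2) with hg₀
  set σ := Tuple.sort fun i => -‖p₀ i - g‖ with hσ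
  have hmono : Monotone ((fun i => -‖p₀ i - g‖) ∘ σ) := Tuple.monotone_sort _
  have hg : g = (1 / 3 : ℝ) • (p₀ (σ 0) + p₀ (σ 1) + p₀ (σ 2)) := by
    have := Equiv.sum_comp σ p₀
    rw [Fin.sum_univ_three, Fin.sum_univ_three] at this
    rw [this]
  have hpσ := hp₀.comp_embedding σ.toEmbedding
  rw [← EquivLike.range_comp p₀ σ]
  set p := p₀ ∘ σ with hp
  have hpi : AffineIndependent ℝ p := hpσ
  have h01 : ‖p 1 - g‖ ≤ ‖p 0 - g‖ := neg_le_neg_iff.1 (hmono (show (0 : Fin 3) ≤ 1 by decide))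
  have h12 : ‖p 2 - g‖ ≤ ‖p 1 - g‖ := neg_le_neg_iff.1 (hmono (show (1 : Fin 3) ≤ 2 by decide))
  have hgp : g = (1 / 3 : ℝ) • (p 0 + p 1 + p 2) := hg
  have hind : ∀ s t : ℝ, s • (p 0 - g) + t • (p 1 - g) = 0 → s = 0 ∧ t = 0 := by
    intro s t hst
    have h := affineIndependent_iff.1 hpi Finset.univ
      ![s - (s + t) / 3, t - (s + t) / 3, -((s + t) / 3)]
      (by rw [Fin.sum_univ_three]; simp; ring)
      (by
        rw [Fin.sum_univ_three, ← hst, hgp]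
        simp
        module)
    have h0 : s - (s + t) / 3 = 0 := h 0 (Finset.mem_univ _)
    have h1 : t - (s + t) / 3 = 0 := h 1 (Finset.mem_univ _)
    have h2 : -((s + t) / 3) = 0 := h 2 (Finset.mem_univ _)
    constructor <;> linarith
  refine horganPayneInequality_triangle_of_le (g := g) (A := p 0 - g) (B := p 1 - g)
    (C := p 2 - g) (by rw [hgp]; module) ?_ h01 h12 ?_
  · intro hκ
    set A := p 0 - g
    set B := p 1 - g
    have h0 := hind (B 0) (-A 0) (by
      ext i
      fin_cases i
      · simp
        ring
      · simp
        linear_combination -hκ)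
    have h1 := hind (B 1) (-A 1) (by
      ext i
      fin_cases i
      · simp
        linear_combination hκ
      · simp
        ring)
    have hA : A = 0 := by
      ext i
      fin_cases i
      · simpa using h0.2
      · simpa using h1.2
    have := (hind 1 0 (by rw [hA]; simp)).1
    norm_num at this
  · ext x
    simp only [mem_range, Fin.exists_fin_succ, mem_insert_iff, mem_singleton_iff]
    simp [eq_comm]

end Triangle

section RegularPolygon

/-- The point of the unit circle with the polar angle `θ`. -/
noncomputable def circlePoint (θ : ℝ) : Plane := !₂[Real.cos θ, Real.sin θ]

lemma inner_circlePoint (α θ : ℝ) :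
    inner ℝ (circlePoint α) (circlePoint θ) = Real.cos (α - θ) := by
  rw [plane_inner, Real.cos_sub]
  simp [circlePoint]

lemma norm_circlePoint (θ : ℝ) : ‖circlePoint θ‖ = 1 := by
  have h : ‖circlePoint θ‖ ^ 2 = 1 := by
    rw [← real_inner_self_eq_norm_sq, inner_circlePoint, sub_self, Real.cos_zero]
  nlinarith [norm_nonneg (circlePoint θ)]

lemma exists_eq_smul_circlePoint (w : Plane) : ∃ α, w = ‖w‖ • circlePoint α := by
  refine ⟨(toComplex w).arg, ?_⟩
  have h : ‖w‖ = ‖toComplex w‖ := by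
    refine (sq_eq_sq₀ (norm_nonneg _) (norm_nonneg _)).1 ?_
    rw [plane_norm_sq, Complex.sq_norm, Complex.normSq_apply]
    simp [toComplex]
    ring
  have e : ‖toComplex w‖ • circlePoint (toComplex w).arg =
      !₂[‖toComplex w‖ * Real.cos (toComplex w).arg, ‖toComplex w‖ * Real.sin (toComplex w).arg] := by
    ext i
    fin_cases i <;> simp [circlePoint]
  rw [h, e, Complex.norm_mul_cos_arg, Complex.norm_mul_sin_arg]
  ext i
  fin_cases i <;> simp

lemma planeEquiv_circlePoint {δ : ℝ}
    (h : Real.cos δ * Real.cos δ - -Real.sin δ * Real.sin δ = 1) (r θ : ℝ) :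
    planeEquiv _ _ _ _ h (r • circlePoint θ) = r • circlePoint (θ + δ) := by
  rw [planeEquiv_apply]
  ext i
  fin_cases i
  · simp [circlePoint, Real.cos_add]
    ring
  · simp [circlePoint, Real.sin_add]
    ring

lemma cos_le_cos_of_le_of_le {x y : ℝ} (hx : 0 ≤ x) (h1 : x ≤ y) (h2 : y ≤ 2 * Real.pi - x) :
    Real.cos y ≤ Real.cos x := by
  rcases le_total y Real.pi with h | h
  · exact Real.cos_le_cos_of_nonneg_of_le_pi hx h h1
  · rw [← Real.cos_two_pi_sub y]
    exact Real.cos_le_cos_of_nonneg_of_le_pi hx (by linarith) (by linarith)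

theorem horganPayneInequality_of_isRegularPolygon {Ω : Set Plane} (h : IsRegularPolygon Ω) :
    IsStarShapedBall Ω (barycenter Ω) ∧ HorganPayneInequality Ω (barycenter Ω) := by
  obtain ⟨n, c, r, φ, hn3, hr, rfl⟩ := h
  have hn0 : 0 < n := by omega
  have hN : (3 : ℝ) ≤ n := by exact_mod_cast hn3
  have hN0 : (0 : ℝ) < n := by linarith
  have hπ := Real.pi_pos
  set S := range fun k : Fin n => c + r • !₂[Real.cos (φ + 2 * Real.pi * (k : ℕ) / n),
    Real.sin (φ + 2 * Real.pi * (k : ℕ) / n)] with hS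
  set δ := 2 * Real.pi / n with hδ
  have hδ0 : 0 < δ := by positivity
  have hnδ : n * δ = 2 * Real.pi := by rw [hδ]; field_simp
  have hδπ : δ < Real.pi := by nlinarith
  have hvert : ∀ k : ℕ, k < n → c + r • circlePoint (φ + k * δ) ∈ S := by
    intro k hk
    refine ⟨⟨k, hk⟩, ?_⟩
    have : φ + 2 * Real.pi * k / n = φ + k * δ := by rw [hδ]; ring
    simp only [circlePoint, this]
  have hvert' : ∀ k : ℤ, c + r • circlePoint (φ + k * δ) ∈ S := by
    intro k
    have h1 : 0 ≤ k % n := Int.emod_nonneg _ (by omega)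
    have h2 : k % n < n := Int.emod_lt_of_pos _ (by omega)
    have h3 : k = (k % n).toNat + n * (k / n) := by
      rw [Int.toNat_of_nonneg h1]
      exact (Int.emod_add_mul_ediv k n).symm
    have h4 := hvert (k % n).toNat (by omega)
    have h5 : φ + k * δ = φ + (k % n).toNat * δ + (k / n : ℤ) * (2 * Real.pi) := by
      have : (k : ℝ) = (k % n).toNat + n * (k / n : ℤ) := by exact_mod_cast h3
      rw [this, ← hnδ]
      ring
    have h6 : circlePoint (φ + k * δ) = circlePoint (φ + (k % n).toNat * δ) := by
      rw [circlePoint, circlePoint, h5, Real.cos_add_int_mul_two_pi, Real.sin_add_int_mul_two_pi]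
    rwa [h6]
  have hmem : ∀ s ∈ S, ∃ k : ℕ, k < n ∧ s = c + r • circlePoint (φ + k * δ) := by
    rintro s ⟨k, rfl⟩
    refine ⟨k, k.2, ?_⟩
    have : φ + 2 * Real.pi * (k : ℕ) / n = φ + (k : ℕ) * δ := by rw [hδ]; ring
    simp only [circlePoint, this]
  have hcos : 0 < Real.cos (δ / 2) := Real.cos_pos_of_mem_Ioo ⟨by linarith, by linarith⟩
  have hSf : S.Finite := finite_range _
  have hsup : ∀ w : Plane, ∃ s ∈ S, r * Real.cos (δ / 2) * ‖w‖ ≤ inner ℝ w (s - c) := by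
    intro w
    obtain ⟨α, hα⟩ := exists_eq_smul_circlePoint w
    refine ⟨_, hvert' (round ((α - φ) / δ)), ?_⟩
    have hround := abs_sub_round ((α - φ) / δ)
    set k : ℤ := round ((α - φ) / δ)
    have habs : |α - (φ + k * δ)| ≤ δ / 2 := by
      have : α - (φ + k * δ) = ((α - φ) / δ - k) * δ := by field_simp; ring
      rw [this, abs_mul, abs_of_pos hδ0]
      nlinarith
    have hle : Real.cos (δ / 2) ≤ Real.cos (α - (φ + k * δ)) := by
      rw [← Real.cos_abs (α - _)]
      exact Real.cos_le_cos_of_nonneg_of_le_pi (abs_nonneg _) (by linarith) habs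
    have e : inner ℝ w (c + r • circlePoint (φ + k * δ) - c) =
        r * Real.cos (α - (φ + k * δ)) * ‖w‖ := by
      rw [add_sub_cancel_left, inner_smul_right]
      conv_lhs => rw [hα]
      rw [inner_smul_left, inner_circlePoint]
      simp
      ring
    rw [e]
    gcongr
  have hdet : Real.cos δ * Real.cos δ - -Real.sin δ * Real.sin δ = 1 := by
    linear_combination Real.sin_sq_add_cos_sq δ
  have hcosδ : Real.cos δ ≠ 1 := fun h =>
    hδ0.ne' ((Real.cos_eq_one_iff_of_lt_of_lt (by linarith) (by linarith)).1 h)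
  have hin : ∀ k : ℕ, inner ℝ (circlePoint (φ + δ / 2)) (c + r • circlePoint (φ + k * δ) - c) =
      r * Real.cos (δ / 2 - k * δ) := by
    intro k
    rw [add_sub_cancel_left, inner_smul_right, inner_circlePoint]
    congr 2
    ring
  have hin0 := hin 0
  have hin1 := hin 1
  refine horganPayneInequality_barycenter (x₀ := c) (n := circlePoint (φ + δ / 2))
    (δ := r * Real.cos (δ / 2)) (R := r) hSf (by positivity) (ball_subset_of_support hSf hsup) ?_
    (norm_circlePoint _) (hvert 0 (by omega)) (hvert 1 (by omega)) ?_ ?_ ?_ ?_ ?_ hdet ?_ ?_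
  · intro s hs
    obtain ⟨k, -, rfl⟩ := hmem s hs
    rw [add_sub_cancel_left, norm_smul, norm_circlePoint, Real.norm_eq_abs, abs_of_pos hr, mul_one]
  · intro h
    have h1 := smul_right_injective Plane hr.ne' (add_left_cancel h)
    have h2 := inner_circlePoint (φ + (1 : ℕ) * δ) (φ + (0 : ℕ) * δ)
    rw [h1, inner_circlePoint, sub_self, Real.cos_zero] at h2
    refine hcosδ ?_
    rw [h2]
    congr 1
    push_cast
    ring
  · rw [hin0]
    simp
  · rw [hin1, ← Real.cos_neg]
    congr 2
    push_cast
    ring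
  · intro s hs
    obtain ⟨k, hk, rfl⟩ := hmem s hs
    rw [hin]
    refine mul_le_mul_of_nonneg_left ?_ hr.le
    rcases Nat.eq_zero_or_pos k with rfl | hk0
    · simp
    · rw [← Real.cos_neg]
      have h1 : (1 : ℝ) ≤ k := by exact_mod_cast hk0
      have h2 : (k : ℝ) + 1 ≤ n := by exact_mod_cast hk
      exact cos_le_cos_of_le_of_le (by linarith) (by nlinarith) (by nlinarith)
  · rw [add_sub_cancel_left, norm_smul, norm_circlePoint, Real.norm_eq_abs, abs_of_pos hr, mul_one]
  · intro h
    exact hcosδ (by linarith)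
  · intro s hs
    obtain ⟨k, -, rfl⟩ := hmem s hs
    rw [add_sub_cancel_left, planeEquiv_circlePoint]
    have := hvert' (k + 1)
    have e : φ + k * δ + δ = φ + ((k + 1 : ℤ) : ℝ) * δ := by push_cast; ring
    rwa [e]

end RegularPolygon

theorem theorem2 :
    -- (i)
    (∀ Ω : Set Plane, (IsTriangle Ω ∨ IsRectangle Ω ∨ IsRhombus Ω ∨ IsRegularPolygon Ω) →
      IsStarShapedBall Ω (barycenter Ω) ∧ HorganPayneInequality Ω (barycenter Ω)) ∧
    -- (ii)
    (∃ (Ω : Set Plane) (x₀ : Plane), IsStarShapedBall Ω x₀ ∧ ¬ HorganPayneInequality Ω x₀) ∧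
    -- the Cupid's bow
    (∀ c : ℝ, 0 < c → IsStarShapedBall (cupidsBow c) 0) ∧
    (∀ᶠ c : ℝ in atTop, ¬ HorganPayneInequality (cupidsBow c) 0) ∧
    ¬ HorganPayneInequality (cupidsBow 2.58) 0 ∧
    -- the double stadium
    (∀ᶠ ε : ℝ in 𝓝[>] 0,
      IsStarShapedBall (doubleStadium ε) 0 ∧ ¬ HorganPayneInequality (doubleStadium ε) 0) ∧
    -- the octagon
    (∀ᶠ q : ℝ in 𝓝[>] 0,
      IsStarShapedBall (octagon q) 0 ∧ ¬ HorganPayneInequality (octagon q) 0) := by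

  refine ⟨?_, ⟨_, _, isStarShapedBall_cupidsBow (by norm_num), not_horganPayneInequality_cupidsBow⟩,
    fun c hc => isStarShapedBall_cupidsBow hc, eventually_not_horganPayneInequality_cupidsBow,
    not_horganPayneInequality_cupidsBow, ?_, ?_⟩
  · rintro Ω (h | h | h | h)
    · exact horganPayneInequality_of_isTriangle h
    · exact horganPayneInequality_of_isRectangle h
    · exact horganPayneInequality_of_isRhombus h
    · exact horganPayneInequality_of_isRegularPolygon h
  · filter_upwards [Ioo_mem_nhdsGT (show (0 : ℝ) < 1 / 1000 by norm_num)] with ε hε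
    exact ⟨isStarShapedBall_doubleStadium hε.1 (by linarith [hε.2]),
      not_horganPayneInequality_doubleStadium hε.1 hε.2.le⟩
  · filter_upwards [Ioo_mem_nhdsGT (show (0 : ℝ) < 1 / 6000 by norm_num)] with q hq
    exact ⟨isStarShapedBall_octagon hq.1 (by linarith [hq.2]),
      not_horganPayneInequality_octagon hq.1 hq.2.le⟩
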